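/- For integers $m \ge 1$ and a partition $\lambda = (\lambda_1 \ge \dots \ge \lambda_m \ge 0)$, let $\chi^{\mathrm{Sp}(2m)}_{\lambda}$ denote the character of the irreducible rational representation of $\mathrm{Sp}(2m,\mathbb{C})$ with highest weight $\lambda$, evaluated at a torus element with eigenvalues $x_1^{\pm 1}, \dots, x_m^{\pm 1}$, and let $(2^a,1^b)$ denote the partition with $a$ parts equal to $2$ and $b$ parts equal to $1$ (and the remaining parts equal to $0$). Then for every integer $m \ge 1$ and all nonzero complex numbers $x_1,\dots,x_m$, $$\sum_{k=0}^m \binom{m-k}{\lfloor (m-k)/2 \rfloor} \sum_{1 \le i_1 < \cdots < i_k \le m}\ \prod_{j=1}^k \bigl(x_{i_j}^2+x_{i_j}^{-2}\bigr) = \sum_{\ell=0}^{\lfloor m/2 \rfloor}\ \sum_{z=0}^{\lfloor m/2 \rfloor-\ell} (-1)^z\, \chi^{\mathrm{Sp}(2m)}_{(2^{m-2\ell-2z},\,1^{2z})},$$ where the inner sum over $i_1<\dots<i_k$ on the left-hand side equals $1$ when $k=0$. -/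

import Mathlib

open scoped BigOperators

noncomputable section

/-- The symplectic group `Sp(2m, ℂ)`: complex matrices `A`, with rows and columns indexed by
`Fin m ⊕ Fin m`, such that `A * J * Aᵀ = J` (equivalently `Aᵀ * J * A = J`), where
`J = [[0, -1], [1, 0]]`. -/
abbrev Sp (m : ℕ) : Type := Matrix.symplecticGroup (Fin m) ℂ

/-- The element `diag(x₁, …, x_m, x₁⁻¹, …, x_m⁻¹)` of the diagonal maximal torus of
`Sp(2m, ℂ)`. -/
def spTorus {m : ℕ} (x : Fin m → ℂˣ) : Sp m :=
  ⟨Matrix.diagonal (Sum.elim (fun i => (x i : ℂ)) (fun i => (((x i)⁻¹ : ℂˣ) : ℂ))), by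
    rw [SymplecticGroup.mem_iff, Matrix.diagonal_transpose]
    ext i j
    rcases i with i | i <;> rcases j with j | j <;>
      simp only [Matrix.J, Matrix.mul_diagonal, Matrix.diagonal_mul, Matrix.fromBlocks_apply₁₁,
        Matrix.fromBlocks_apply₁₂, Matrix.fromBlocks_apply₂₁, Matrix.fromBlocks_apply₂₂,
        Matrix.zero_apply, Matrix.neg_apply, Matrix.one_apply, Sum.elim_inl, Sum.elim_inr] <;>
      by_cases h : i = j <;> simp [h]⟩

/-- `b` lies in the standard Borel subgroup of `Sp(2m, ℂ)`: the stabilizer of the flag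
`⟨e₁⟩ ⊂ ⟨e₁, e₂⟩ ⊂ ⋯ ⊂ ⟨e₁, …, e_m⟩` of isotropic subspaces. Its maximal torus is the diagonal
one, and the corresponding positive roots are `ε_i - ε_j`, `ε_i + ε_j` (`i < j`) and `2 ε_i`. -/
def InBorel {m : ℕ} (b : Sp m) : Prop :=
  (∀ i j : Fin m, b.1 (Sum.inr i) (Sum.inl j) = 0) ∧
    ∀ i j : Fin m, j < i → b.1 (Sum.inl i) (Sum.inl j) = 0

section Representations

variable {m : ℕ} {V : Type*} [AddCommGroup V] [Module ℂ V]

/-- A representation of `Sp(2m, ℂ)` is rational (algebraic) if all its matrix coefficients are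
polynomial functions of the matrix entries (as symplectic matrices have determinant `1`, these are
all the regular functions on the group). -/
def IsRationalRep (ρ : Representation ℂ (Sp m) V) : Prop :=
  ∀ (v : V) (f : Module.Dual ℂ V),
    ∃ p : MvPolynomial ((Fin m ⊕ Fin m) × (Fin m ⊕ Fin m)) ℂ,
      ∀ g : Sp m, f (ρ g v) = MvPolynomial.eval (fun ij => g.1 ij.1 ij.2) p

/-- `v` is a highest weight vector of weight `lam₁ ε₁ + ⋯ + lam_m ε_m`: it is nonzero, and the
Borel subgroup acts on it through the character `b ↦ ∏ i, b_ii ^ lam_i`. -/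
def IsHighestWeightVector (ρ : Representation ℂ (Sp m) V) (lam : Fin m → ℕ) (v : V) : Prop :=
  v ≠ 0 ∧ ∀ b : Sp m, InBorel b → ρ b v = (∏ i, b.1 (Sum.inl i) (Sum.inl i) ^ lam i) • v

/-- `ρ` is a finite-dimensional irreducible rational representation of `Sp(2m, ℂ)` with highest
weight `lam`. -/
structure IsIrrepOfHighestWeight (ρ : Representation ℂ (Sp m) V) (lam : Fin m → ℕ) : Prop where
  finite : Module.Finite ℂ V
  rational : IsRationalRep ρ
  irreducible : ρ.IsIrreducible
  highest : ∃ v : V, IsHighestWeightVector ρ lam v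

end Representations

open Classical in
/-- The irreducible character `χ_lam` of `Sp(2m, ℂ)`, for a partition
`lam = (lam₁ ≥ ⋯ ≥ lam_m ≥ 0)`: the character (trace) of the irreducible representation with
highest weight `lam`, which exists and is unique up to isomorphism. The underlying space is
taken to be some `ℂⁿ`. (The value is `0` if there is no such representation, that is, if `lam` is
not weakly decreasing.) -/
def irrCharSp (m : ℕ) (lam : Fin m → ℕ) (g : Sp m) : ℂ :=
  if h : ∃ (n : ℕ) (ρ : Representation ℂ (Sp m) (Fin n → ℂ)), IsIrrepOfHighestWeight ρ lam then
    h.choose_spec.choose.character g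
  else 0

/-- The partition `(2^a, 1^b)`, padded with zeros to `m` parts (for `a + b ≤ m`). -/
def twoOnePartition (m a b : ℕ) (i : Fin m) : ℕ :=
  if (i : ℕ) < a then 2 else if (i : ℕ) < a + b then 1 else 0

end

/-! Let g_j be the coefficient of t^j in ∏ (x_i + x_i⁻¹ + t + t⁻¹) (`genCoeff`) and d_j = g_j -
g_{j+2}. Both sides of the identity equal ∑_{0 ≤ j ≤ m} (-1)^j d_j².

Left side (`sum_choose_eq`): the generating functions at t and at -t multiply to ∏ (x_i² + x_i⁻² -
t² - t⁻²). Taking the coefficient of t^0 minus that of t^(-2) produces the central binomial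
coefficients from the right-hand product, and, because g_{-j} = g_j, the alternating sum of squares
from the two factors.

Right side: for r ≤ s ≤ m the character of (2^(m-s), 1^(s-r)) is the determinant d_r (d_s + d_{s+2})
- (d_{r-1} + d_{r+1}) d_{s+1} (`irrCharSp_eq_twoColumnDet`, `laurentEval_twoColumnDet`), and the
alternating double sum of these determinants telescopes (`sum_det_eq`).

The determinant formula is the heart of the matter. It is obtained from the Casimir operator,
without the Weyl character formula. The irreducible representation is the cyclic span of a product
of two minors in a tensor power of the natural representation (`twoColumnRep_isIrrep`). Density of
the big cell shows that the highest weight space of a cyclic highest weight module is a line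
(`IsHighestWeightVector.eq_smul_of_mem_span`); this gives irreducibility, uniqueness up to
isomorphism (hence `IsIrrepOfHighestWeight.irrCharSp_eq`), and the scalar action of the Casimir
operator. Moving root vectors cyclically around a trace turns that scalar action into a differential
equation for the character on the torus (`trace_casimir_term`, `exists_laurent_irrCharSp`).

The determinant satisfies the same equation. The kernel ∏ (x_i + x_i⁻¹ + t + t⁻¹)(x_i + x_i⁻¹ + u +
u⁻¹) times the Weyl denominator of Sp(4) is killed by the radial Casimir operator in x plus (t∂_t)²
+ (u∂_u)² minus a constant (`sum_generating_eq_zero`), an infinitesimal form of the skew duality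
between Sp(2m) and Sp(4). Character and determinant both have coefficient 1 at the highest weight,
and all their other exponents have strictly smaller Casimir value. Their difference is thus an
eigenfunction whose leading exponent would give the wrong eigenvalue, so it vanishes
(`IsRadialEigen.eq_zero`). -/

section SymplecticCharacters

open Matrix Filter Topology

/-! ### Density of the big cell of Sp(2m). -/

section BigCell

variable {m : ℕ}

/-- If `A` and `C` have no common kernel and `Aᵀ * C` is symmetric, some symmetric `X` makes
`A + X * C` invertible. -/
theorem exists_isSymm_isUnit_add_mul {l R : Type*} [Fintype l] [DecidableEq l] [Field R]
    {A C : Matrix l l R} (hker : ∀ x : l → R, A *ᵥ x = 0 → C *ᵥ x = 0 → x = 0)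
    (hsymm : Aᵀ * C = Cᵀ * A) :
    ∃ X : Matrix l l R, X.IsSymm ∧ IsUnit (A + X * C) := by
  -- In coordinates where C becomes diag(1, 0), symmetry forces A into the form [[Q₁₁, 0], [Q₂₁,
  -- Q₂₂]] with Q₁₁ symmetric, and the kernel condition makes Q₂₂ invertible. Adding Y = diag(1 -
  -- Q₁₁, 0) replaces Q₁₁ by 1.
  rcases exists_rank_normal_form C with ⟨V, U, s, hV, hU, heq⟩
  set P := V * C * U with P_def
  set Q := Vᵀ⁻¹ * A * U with Q_def
  set f := fun (x : Matrix l l R) ↦ x.submatrix s.symm s.symm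
  have hf (x) : f x = x.submatrix s.symm s.symm := rfl
  have f_unit {x} : IsUnit x → IsUnit (f x) := (isUnit_submatrix_equiv ..).2
  have f_mul (x y) : f (x * y) = f x * f y := submatrix_mul _ _ _ _ _ s.symm.bijective
  have _ : Invertible V := hV.invertible
  have _ : Invertible U := hU.invertible
  have _ : Invertible (f Vᵀ) := (f_unit (V.isUnit_transpose.2 hV)).invertible
  have con1 (x : Fin C.rank ⊕ Fin (Fintype.card l - C.rank) → R)
      (heq1 : (f Q) • x = 0) (heq2 : (f P) • x = 0) : x = 0 := by
    refine (f_unit hU).smul_left_cancel.1 ?_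
    rw [f_mul, f_mul, mul_assoc, mul_smul, IsUnit.smul_eq_zero, mul_smul, hf,
      smul_eq_mulVec, submatrix_mulVec_equiv, Equiv.symm_symm] at heq1 heq2
    · rw [Equiv.comp_symm_eq, Pi.zero_comp] at heq1 heq2
      exact s.surjective.injective_comp_right <| by simpa using hker _ heq1 heq2
    · exact f_unit hV
    · exact f_unit <| isUnit_nonsing_inv_iff.2 <| V.isUnit_transpose.2 hV
  have con2 : Qᵀ * P = Pᵀ * Q := by
    simp only [P_def, mul_assoc, transpose_mul, transpose_nonsing_inv, transpose_transpose, Q_def,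
      inv_mul_cancel_left_of_invertible, mul_inv_cancel_left_of_invertible]
    rw [← mul_assoc Aᵀ, hsymm, mul_assoc]
  replace con2 : (f Q).toBlocks₁₁ᵀ = (f Q).toBlocks₁₁ ∧ (f Q).toBlocks₁₂ = 0 := by
    apply_fun reindex s s at con2
    rw [reindex_apply, reindex_apply, ← hf, ← hf, f_mul, f_mul Pᵀ, heq, hf,
      ← transpose_submatrix, ← hf Q, ← (f Q).fromBlocks_toBlocks, hf (_)ᵀ, hf
      ((fromBlocks 1 0 0 0).submatrix _ _)] at con2
    simp [fromBlocks_transpose, fromBlocks_multiply] at con2; tauto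
  have con3 : IsUnit (f Q).toBlocks₂₂ := by
    refine mulVec_injective_iff_isUnit.1 ?_
    rw [← coe_mulVecLin, ← LinearMap.ker_eq_bot]
    refine ker_mulVecLin_eq_bot_iff.2 fun x hx ↦ Sum.elim_injective' <|
      (con1 _ ?_ ?_).trans Sum.elim_zero_zero.symm
    · rw [← (f Q).fromBlocks_toBlocks]; simp [hx, con2.2, fromBlocks_mulVec]
    · simp [hf, heq, fromBlocks_mulVec]
  set Y : Matrix (Fin C.rank ⊕ Fin (Fintype.card l - C.rank)) (Fin C.rank ⊕
    Fin (Fintype.card l - C.rank)) R := fromBlocks (1 - (f Q).toBlocks₁₁) 0 0 0 with Y_def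
  have hY_symm : Y.IsSymm := by
    rw [Y_def, isSymm_fromBlocks_iff]
    exact ⟨IsSymm.sub isSymm_one con2.1, by simp⟩
  set X := (f Vᵀ) * Y * (f V) with X_def
  refine ⟨X.submatrix s s, IsSymm.submatrix ?_ s, (isUnit_submatrix_equiv s.symm s.symm).1 ?_⟩
  · simp_rw [X_def, Matrix.IsSymm, transpose_mul, hY_symm.eq, hf, transpose_submatrix,
      transpose_transpose, mul_assoc]
  · have heq' : f (A + X.submatrix s s * C) = (f Vᵀ) * (f Q + Y * (f P)) * f (U⁻¹) := by
      simp_rw [hf, submatrix_add, Pi.add_apply, Q_def, P_def, ← hf, f_mul, hf, mul_add, ← mul_assoc,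
        ← inv_submatrix_equiv, add_mul, mul_assoc _ (U.submatrix _ _), mul_inv_of_invertible]
      simp [X_def]; rfl
    rw [← hf, heq', IsUnit.mul_iff, IsUnit.mul_iff]
    refine ⟨⟨isUnit_of_invertible _, ?_⟩, ?_⟩
    · nth_rw 1 [Y_def, heq, ← (f Q).fromBlocks_toBlocks, con2.2]
      simpa [hf, fromBlocks_multiply, fromBlocks_add]
    · exact f_unit <| isUnit_nonsing_inv_iff.2 hU

/-- If `det (M + N) ≠ 0`, then `det (M + s • N) ≠ 0` for all small `s ≠ 0`. -/
theorem eventually_det_add_smul_ne_zero {n : Type*} [Fintype n] [DecidableEq n]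
    (M N : Matrix n n ℂ) (h : (M + N).det ≠ 0) : ∀ᶠ s : ℂ in 𝓝[≠] 0, (M + s • N).det ≠ 0 := by
  set P : Polynomial ℂ :=
    (M.map Polynomial.C + (Polynomial.X : Polynomial ℂ) • N.map Polynomial.C).det with hP
  have hev : ∀ s : ℂ, P.eval s = (M + s • N).det := by
    intro s
    rw [hP, ← Polynomial.coe_evalRingHom, RingHom.map_det]
    congr 1
    ext i j
    simp [Polynomial.coe_evalRingHom]
    ring
  have hP0 : P ≠ 0 := by
    intro h0
    apply h
    have := hev 1
    rw [h0] at this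
    simpa using this.symm
  have hfin : (P.roots.toFinset : Set ℂ).Finite := Finset.finite_toSet _
  have : ∀ᶠ s : ℂ in 𝓝[≠] 0, s ∉ (P.roots.toFinset : Set ℂ) \ {0} := by
    apply nhdsWithin_le_nhds
    exact (hfin.subset Set.sdiff_subset).isClosed.isOpen_compl.mem_nhds (by simp)
  filter_upwards [this, self_mem_nhdsWithin] with s hs hs0 hdet
  apply hs
  refine ⟨?_, hs0⟩
  simp only [Finset.mem_coe, Multiset.mem_toFinset, Polynomial.mem_roots hP0, Polynomial.IsRoot.def]
  rw [hev, hdet]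

/-- The unipotent element with blocks `1, S, 0, 1`. -/
noncomputable def siegelUpper (S : Matrix (Fin m) (Fin m) ℂ) (hS : S.IsSymm) : Sp m :=
  ⟨fromBlocks 1 S 0 1, by
    rw [SymplecticGroup.fromBlocks_mem_iff]; simp [hS.eq]⟩

/-- The unipotent element with blocks `1, 0, S, 1`. -/
noncomputable def siegelLower (S : Matrix (Fin m) (Fin m) ℂ) (hS : S.IsSymm) : Sp m :=
  ⟨fromBlocks 1 0 S 1, by
    rw [SymplecticGroup.fromBlocks_mem_iff]; simp [hS.eq]⟩

/-- The element of the Siegel Levi subgroup with blocks `A, 0, 0, (A⁻¹)ᵀ`. -/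
noncomputable def siegelLevi (A : Matrix (Fin m) (Fin m) ℂ) (hA : A.det ≠ 0) : Sp m :=
  ⟨fromBlocks A 0 0 (A⁻¹)ᵀ, by
    rw [SymplecticGroup.fromBlocks_mem_iff]
    simp [← transpose_mul, nonsing_inv_mul A (isUnit_iff_ne_zero.2 hA)]⟩

/-- The pairing of the weights of the natural representation with a regular dominant cocharacter. -/
def spHeight (m : ℕ) : Fin m ⊕ Fin m → ℤ :=
  Sum.elim (fun i => (m : ℤ) - i) (fun i => -((m : ℤ) - i))

/-- Membership in the unipotent radical of the Borel subgroup opposite to the standard one. -/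
def IsOppUnipotent (u : Sp m) : Prop :=
  ∀ a b, u.1 a b ≠ (1 : Matrix _ _ ℂ) a b → spHeight m a < spHeight m b

theorem IsOppUnipotent.mul {u w : Sp m} (hu : IsOppUnipotent u) (hw : IsOppUnipotent w) :
    IsOppUnipotent (u * w) := by
  intro a b hab
  by_contra hlt
  apply hab
  have key : ∀ c, u.1 a c * w.1 c b = (1 : Matrix _ _ ℂ) a c * w.1 c b := by
    intro c
    by_cases h : u.1 a c = (1 : Matrix _ _ ℂ) a c
    · rw [h]
    · have h1 := hu a c h
      have h2 : w.1 c b = (1 : Matrix _ _ ℂ) c b := by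
        by_contra h'
        have := hw c b h'
        omega
      have hcb : c ≠ b := by rintro rfl; exact hlt h1
      rw [h2, one_apply_ne hcb, mul_zero, mul_zero]
  have hwab : w.1 a b = (1 : Matrix _ _ ℂ) a b := by
    by_contra h'
    exact hlt (hw a b h')
  calc (u * w).1 a b = ∑ c, u.1 a c * w.1 c b := by
        rw [Submonoid.coe_mul, Matrix.mul_apply]
    _ = ∑ c, (1 : Matrix _ _ ℂ) a c * w.1 c b := Finset.sum_congr rfl fun c _ => key c
    _ = ((1 : Matrix (Fin m ⊕ Fin m) (Fin m ⊕ Fin m) ℂ) * w.1) a b := by rw [Matrix.mul_apply]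
    _ = _ := by rw [one_mul, hwab]

theorem InBorel.mul {b c : Sp m} (hb : InBorel b) (hc : InBorel c) : InBorel (b * c) := by
  refine ⟨fun i j => ?_, fun i j hij => ?_⟩
  · rw [Submonoid.coe_mul, Matrix.mul_apply, Fintype.sum_sum_type]
    simp [hb.1, hc.1]
  · rw [Submonoid.coe_mul, Matrix.mul_apply, Fintype.sum_sum_type]
    simp only [hc.1, mul_zero, Finset.sum_const_zero, add_zero]
    refine Finset.sum_eq_zero fun k _ => ?_
    by_cases hk : k < i
    · rw [hb.2 i k hk, zero_mul]
    · rw [hc.2 k j (lt_of_lt_of_le hij (not_lt.1 hk)), mul_zero]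

/-- The matrix `A` with everything outside its leading block up to `j` replaced by the identity. -/
def leadingBlock (A : Matrix (Fin m) (Fin m) ℂ) (j : Fin m) : Matrix (Fin m) (Fin m) ℂ :=
  Matrix.of fun i k => if i ≤ j ∧ k ≤ j then A i k else (1 : Matrix (Fin m) (Fin m) ℂ) i k

/-- A matrix with nonzero leading minors has an LU decomposition. -/
theorem exists_lu (A : Matrix (Fin m) (Fin m) ℂ) (hA : ∀ j, (leadingBlock A j).det ≠ 0) :
    ∃ L R : Matrix (Fin m) (Fin m) ℂ, A = L * R ∧ (∀ i j, i ≤ j → L i j = (1 : Matrix _ _ ℂ) i j) ∧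
      (∀ i j, j < i → R i j = 0) ∧ L.det = 1 ∧ R.det ≠ 0 := by
  -- These are the columns of R⁻¹: each is supported on indices up to j, and A sends it to a vector
  -- that agrees with the j-th basis vector in rows up to j.
  set y : Fin m → Fin m → ℂ := fun j => (leadingBlock A j)⁻¹ *ᵥ Pi.single j 1 with hy
  have hBy : ∀ j, leadingBlock A j *ᵥ y j = Pi.single j 1 := by
    intro j
    rw [hy, mulVec_mulVec, mul_nonsing_inv _ (isUnit_iff_ne_zero.2 (hA j)), one_mulVec]
  have hy0 : ∀ j i, j < i → y j i = 0 := by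
    intro j i hij
    have h := congrFun (hBy j) i
    rw [Pi.single_eq_of_ne hij.ne', mulVec, dotProduct] at h
    rw [← h, Finset.sum_eq_single i]
    · simp [leadingBlock, hij.not_ge]
    · intro k _ hk
      simp [leadingBlock, hij.not_ge, hk.symm]
    · simp
  set Y : Matrix (Fin m) (Fin m) ℂ := Matrix.of fun i j => y j i with hY
  have hL : ∀ i j, i ≤ j → (A * Y) i j = (1 : Matrix _ _ ℂ) i j := by
    intro i j hij
    have h := congrFun (hBy j) i
    rw [mulVec, dotProduct] at h
    rw [Matrix.mul_apply]
    calc ∑ k, A i k * Y k j = ∑ k, leadingBlock A j i k * y j k := by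
          refine Finset.sum_congr rfl fun k _ => ?_
          by_cases hk : k ≤ j
          · simp [leadingBlock, hij, hk, hY]
          · simp [hY, hy0 j k (not_le.1 hk)]
      _ = _ := by
          rw [h, Pi.single_apply, one_apply]
  have hLdet : (A * Y).det = 1 := by
    rw [det_of_isLowerTriangular (A * Y)]
    · exact Finset.prod_eq_one fun i _ => by rw [hL i i le_rfl, one_apply_eq]
    · intro i j hij
      have hij : i < j := hij
      rw [hL i j hij.le, one_apply_ne hij.ne]
  have hYdet : Y.det ≠ 0 := by
    intro h
    rw [det_mul, h, mul_zero] at hLdet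
    exact zero_ne_one hLdet
  have hYu := isUnit_iff_ne_zero.2 hYdet
  refine ⟨A * Y, Y⁻¹, ?_, hL, ?_, hLdet, ?_⟩
  · rw [Matrix.mul_assoc, mul_nonsing_inv _ hYu, mul_one]
  · have : Invertible Y := Y.invertibleOfIsUnitDet hYu
    have ht : BlockTriangular Y id := fun i j hij => hy0 j i hij
    exact fun i j hij => blockTriangular_inv_of_blockTriangular ht hij
  · rw [det_nonsing_inv, Ring.inverse_eq_inv']
    exact inv_ne_zero hYdet

/-- The inverse of a lower unitriangular matrix is lower unitriangular. -/
theorem inv_apply_of_lower_unitriangular {L : Matrix (Fin m) (Fin m) ℂ}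
    (hL : ∀ i j, i ≤ j → L i j = (1 : Matrix _ _ ℂ) i j) (hdet : L.det = 1) (i j : Fin m)
    (hij : i ≤ j) : L⁻¹ i j = (1 : Matrix _ _ ℂ) i j := by
  have hu : IsUnit L.det := by rw [hdet]; exact isUnit_one
  have : Invertible L := L.invertibleOfIsUnitDet hu
  have ht : BlockTriangular L OrderDual.toDual := fun i j hij => by
    have hij : i < j := hij
    rw [hL i j hij.le, one_apply_ne hij.ne]
  have ht' := blockTriangular_inv_of_blockTriangular ht
  rcases hij.eq_or_lt with rfl | hlt
  · have h := congrFun (congrFun (mul_nonsing_inv L hu) i) i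
    rw [Matrix.mul_apply, Finset.sum_eq_single i, hL i i le_rfl, one_apply_eq, one_mul] at h
    · rw [h, one_apply_eq]
    · intro k _ hk
      rcases lt_or_gt_of_ne hk with h' | h'
      · rw [ht' (show OrderDual.toDual i < OrderDual.toDual k from h'), mul_zero]
      · rw [hL i k h'.le, one_apply_ne h'.ne, zero_mul]
    · simp
  · rw [ht' (show OrderDual.toDual j < OrderDual.toDual i from hlt), one_apply_ne hlt.ne]

/-- The big cell of `Sp(2m, ℂ)`. -/
def bigCell (m : ℕ) : Set (Sp m) := {g | ∃ u b, IsOppUnipotent u ∧ InBorel b ∧ g = u * b}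

theorem siegelUpper_inBorel (S : Matrix (Fin m) (Fin m) ℂ) (hS : S.IsSymm) :
    InBorel (siegelUpper S hS) := by
  refine ⟨fun i j => by simp [siegelUpper], fun i j hij => by simp [siegelUpper, hij.ne']⟩

theorem siegelLower_isOppUnipotent (S : Matrix (Fin m) (Fin m) ℂ) (hS : S.IsSymm) :
    IsOppUnipotent (siegelLower S hS) := by
  rintro (i | i) (j | j) h
  · simp [siegelLower, one_apply] at h
  · simp [siegelLower, one_apply] at h
  · simp only [spHeight, Sum.elim_inl, Sum.elim_inr]
    have := i.2
    have := j.2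
    omega
  · simp [siegelLower, one_apply] at h

theorem siegelLevi_mem_bigCell (A : Matrix (Fin m) (Fin m) ℂ) (hA : A.det ≠ 0)
    (h : ∀ j, (leadingBlock A j).det ≠ 0) : siegelLevi A hA ∈ bigCell m := by
  obtain ⟨L, R, hLR, hL, hR, hLdet, hRdet⟩ := exists_lu A h
  refine ⟨siegelLevi L (by rw [hLdet]; exact one_ne_zero), siegelLevi R hRdet, ?_, ?_, ?_⟩
  · rintro (i | i) (j | j) h
    · have hji : j < i := by
        by_contra h'
        apply h
        simp [siegelLevi, hL i j (not_lt.1 h'), one_apply]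
      simp only [spHeight, Sum.elim_inl]
      have : (j : ℕ) < i := hji
      omega
    · simp [siegelLevi] at h
    · simp [siegelLevi] at h
    · have hji : i < j := by
        by_contra h'
        apply h
        simp [siegelLevi, inv_apply_of_lower_unitriangular hL hLdet j i (not_lt.1 h'), one_apply,
          eq_comm]
      simp only [spHeight, Sum.elim_inr]
      have : (i : ℕ) < j := hji
      omega
  · exact ⟨fun i j => by simp [siegelLevi], fun i j hij => by simp [siegelLevi, hR i j hij]⟩
  · apply Subtype.ext
    simp only [siegelLevi, Submonoid.coe_mul, fromBlocks_multiply, mul_zero, zero_mul, add_zero,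
      zero_add, ← transpose_mul, ← Matrix.mul_inv_rev, ← hLR]

theorem mul_mem_bigCell {u g b : Sp m} (hu : IsOppUnipotent u) (hg : g ∈ bigCell m)
    (hb : InBorel b) : u * g * b ∈ bigCell m := by
  obtain ⟨u', b', hu', hb', rfl⟩ := hg
  exact ⟨u * u', b' * b, hu.mul hu', hb'.mul hb, by simp only [mul_assoc]⟩

/-- Along the line from A to the identity, each leading minor is a polynomial that is nonzero at the
identity, hence nonzero at all points near A other than possibly A itself. There the LU
decomposition applies. -/
theorem siegelLevi_mem_closure_bigCell (A : Matrix (Fin m) (Fin m) ℂ) (hA : A.det ≠ 0) :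
    siegelLevi A hA ∈ closure (bigCell m) := by
  classical
  set As : ℂ → Matrix (Fin m) (Fin m) ℂ := fun s => A + s • (1 - A) with hAs
  set γ : ℂ → Sp m := fun s => if h : (As s).det ≠ 0 then siegelLevi (As s) h else 1 with hγ
  have h1 : ∀ᶠ s in 𝓝[≠] (0 : ℂ), (As s).det ≠ 0 :=
    eventually_det_add_smul_ne_zero A (1 - A) (by simp)
  have h2 : ∀ᶠ s in 𝓝[≠] (0 : ℂ), ∀ j, (leadingBlock (As s) j).det ≠ 0 := by
    rw [eventually_all]
    intro j
    have := eventually_det_add_smul_ne_zero (leadingBlock A j) (1 - leadingBlock A j) (by simp)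
    filter_upwards [this] with s hs
    convert hs using 2
    ext i k
    simp only [leadingBlock, hAs, of_apply, Matrix.add_apply, Matrix.smul_apply, Matrix.sub_apply]
    split_ifs <;> simp
  have hcont : Continuous As := by fun_prop
  have hlim : Tendsto γ (𝓝[≠] 0) (𝓝 (siegelLevi A hA)) := by
    rw [tendsto_subtype_rng]
    have hA0 : As 0 = A := by simp [hAs]
    have hinv : Tendsto (fun s => (As s)⁻¹) (𝓝[≠] 0) (𝓝 A⁻¹) := by
      simp only [Matrix.inv_def, Ring.inverse_eq_inv']
      have hd : Tendsto (fun s => (As s).det) (𝓝[≠] 0) (𝓝 A.det) := by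
        have : Continuous fun s => (As s).det := hcont.matrix_det
        simpa [hA0] using (this.tendsto 0).mono_left nhdsWithin_le_nhds
      have ha : Tendsto (fun s => (As s).adjugate) (𝓝[≠] 0) (𝓝 A.adjugate) := by
        have : Continuous fun s => (As s).adjugate := hcont.matrix_adjugate
        simpa [hA0] using (this.tendsto 0).mono_left nhdsWithin_le_nhds
      exact (hd.inv₀ hA).smul ha
    have hAt : Tendsto As (𝓝[≠] 0) (𝓝 A) := by
      simpa [hA0] using (hcont.tendsto 0).mono_left nhdsWithin_le_nhds
    have hcomb : Continuous fun p : Matrix (Fin m) (Fin m) ℂ × Matrix (Fin m) (Fin m) ℂ =>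
        fromBlocks p.1 0 0 p.2ᵀ :=
      Continuous.matrix_fromBlocks continuous_fst continuous_const continuous_const
        continuous_snd.matrix_transpose
    have := (hcomb.tendsto (A, A⁻¹)).comp (hAt.prodMk_nhds hinv)
    refine this.congr' ?_
    filter_upwards [h1] with s hs
    simp only [hγ, dif_pos hs, siegelLevi, Function.comp]
  refine mem_closure_of_tendsto hlim ?_
  filter_upwards [h1, h2] with s hs1 hs2
  simp only [hγ, dif_pos hs1]
  exact siegelLevi_mem_bigCell _ hs1 hs2

/-- An invertible upper left block allows a block lower-diagonal-upper factorisation. The outer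
factors preserve the big cell under multiplication, so only the Levi factor has to be approximated.
-/
theorem mem_closure_bigCell_of_det_ne_zero (g : Sp m) (hg : g.1.toBlocks₁₁.det ≠ 0) :
    g ∈ closure (bigCell m) := by
  set A := g.1.toBlocks₁₁ with hA
  set B := g.1.toBlocks₁₂ with hB
  set C := g.1.toBlocks₂₁ with hC
  set D := g.1.toBlocks₂₂ with hD
  have hgb : g.1 = fromBlocks A B C D := (fromBlocks_toBlocks g.1).symm
  have hmem := g.2
  have hmemT := SymplecticGroup.transpose_mem g.2
  rw [hgb, SymplecticGroup.fromBlocks_mem_iff] at hmem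
  rw [hgb, fromBlocks_transpose, SymplecticGroup.fromBlocks_mem_iff] at hmemT
  simp only [transpose_transpose] at hmemT
  have hu : IsUnit A.det := isUnit_iff_ne_zero.2 hg
  have hAt : IsUnit (Aᵀ).det := by rwa [det_transpose]
  have hS1 : (C * A⁻¹).IsSymm := by
    rw [Matrix.IsSymm, transpose_mul, transpose_nonsing_inv]
    calc (Aᵀ)⁻¹ * Cᵀ = (Aᵀ)⁻¹ * (Cᵀ * A) * A⁻¹ := by
          rw [← Matrix.mul_assoc, mul_nonsing_inv_cancel_right _ _ hu]
      _ = C * A⁻¹ := by rw [← hmem.1, nonsing_inv_mul_cancel_left _ _ hAt]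
  have hS2 : (A⁻¹ * B).IsSymm := by
    rw [Matrix.IsSymm, transpose_mul, transpose_nonsing_inv]
    calc Bᵀ * (Aᵀ)⁻¹ = A⁻¹ * (A * Bᵀ) * (Aᵀ)⁻¹ := by
          rw [nonsing_inv_mul_cancel_left _ _ hu]
      _ = A⁻¹ * B := by
          rw [hmemT.1, ← Matrix.mul_assoc, mul_nonsing_inv_cancel_right _ _ hAt]
  have hDe : D = C * A⁻¹ * B + (A⁻¹)ᵀ := by
    have h3 : Aᵀ * D = 1 + Cᵀ * B := by rw [← hmem.2.2]; abel
    calc D = (Aᵀ)⁻¹ * (Aᵀ * D) := (nonsing_inv_mul_cancel_left _ _ hAt).symm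
      _ = (A⁻¹)ᵀ + ((Aᵀ)⁻¹ * Cᵀ) * B := by
          rw [h3, Matrix.mul_add, mul_one, transpose_nonsing_inv, Matrix.mul_assoc]
      _ = (A⁻¹)ᵀ + (C * A⁻¹) * B := by
          congr 2
          rw [← hS1.eq, transpose_mul, transpose_nonsing_inv]
      _ = _ := add_comm _ _
  have hdec : g = siegelLower (C * A⁻¹) hS1 * siegelLevi A hg * siegelUpper (A⁻¹ * B) hS2 := by
    apply Subtype.ext
    simp only [siegelLower, siegelLevi, siegelUpper, Submonoid.coe_mul, fromBlocks_multiply, hgb]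
    rw [fromBlocks_inj]
    refine ⟨by simp, by simp [mul_nonsing_inv_cancel_left _ _ hu],
      by simp [nonsing_inv_mul_cancel_right _ _ hu], ?_⟩
    simp only [mul_zero, zero_add, mul_one, one_mul, add_zero,
      nonsing_inv_mul_cancel_right _ _ hu]
    rw [hDe, Matrix.mul_assoc]
  rw [hdec]
  have hc : Continuous fun h : Sp m =>
      siegelLower (C * A⁻¹) hS1 * h * siegelUpper (A⁻¹ * B) hS2 :=
    (continuous_const.mul continuous_id).mul continuous_const
  have himg : Set.MapsTo (fun h : Sp m =>
      siegelLower (C * A⁻¹) hS1 * h * siegelUpper (A⁻¹ * B) hS2) (bigCell m) (bigCell m) :=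
    fun h hh => mul_mem_bigCell (siegelLower_isOppUnipotent _ _) hh (siegelUpper_inBorel _ _)
  have hfin := map_mem_closure hc (siegelLevi_mem_closure_bigCell A hg) himg
  exact hfin

/-- Left multiplication by an upper Siegel unipotent with parameter sX changes the upper left block
to A + sXC. A suitable symmetric X makes this invertible for all small s ≠ 0, and s → 0 recovers g.
-/
theorem dense_bigCell (m : ℕ) : Dense (bigCell m) := by
  intro g
  set A := g.1.toBlocks₁₁ with hA
  set C := g.1.toBlocks₂₁ with hC
  have hgb : g.1 = fromBlocks A g.1.toBlocks₁₂ C g.1.toBlocks₂₂ := (fromBlocks_toBlocks g.1).symm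
  have hmem := g.2
  rw [hgb, SymplecticGroup.fromBlocks_mem_iff] at hmem
  obtain ⟨X, hX, hXu⟩ : ∃ X : Matrix (Fin m) (Fin m) ℂ, X.IsSymm ∧ IsUnit (A + X * C) := by
    refine exists_isSymm_isUnit_add_mul (fun x hx1 hx2 => ?_) hmem.1
    have h0 : g.1 *ᵥ Sum.elim x 0 = 0 := by
      rw [hgb, fromBlocks_mulVec]
      simp [hx1, hx2]
    have hdet : g.1.det ≠ 0 := (SymplecticGroup.symplectic_det g.2).ne_zero
    have := eq_zero_of_mulVec_eq_zero hdet h0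
    ext i
    simpa using congrFun this (Sum.inl i)
  have hXs : ∀ s : ℂ, (s • X).IsSymm := fun s => by
    rw [Matrix.IsSymm, transpose_smul, hX.eq]
  have hev := eventually_det_add_smul_ne_zero A (X * C)
    ((isUnit_iff_isUnit_det _).1 hXu).ne_zero
  set γ : ℂ → Sp m := fun s => siegelUpper (s • X) (hXs s) * g with hγ
  have hcont : Continuous γ := by
    refine Continuous.mul ?_ continuous_const
    refine Continuous.subtype_mk ?_ _
    exact Continuous.matrix_fromBlocks continuous_const (by fun_prop) continuous_const
      continuous_const
  have h0 : γ 0 = g := by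
    have : siegelUpper (0 • X) (hXs 0) = 1 := Subtype.ext (by simp [siegelUpper])
    simp only [hγ, this, one_mul]
  have hlim : Tendsto γ (𝓝[≠] 0) (𝓝 g) := by
    have := (hcont.tendsto 0).mono_left (nhdsWithin_le_nhds (s := {0}ᶜ))
    rwa [h0] at this
  refine isClosed_closure.mem_of_tendsto hlim ?_
  filter_upwards [hev] with s hs
  apply mem_closure_bigCell_of_det_ne_zero
  have : (γ s).1.toBlocks₁₁ = A + s • (X * C) := by
    simp only [hγ, Submonoid.coe_mul, siegelUpper]
    rw [hgb, fromBlocks_multiply, toBlocks_fromBlocks₁₁, one_mul, Matrix.smul_mul]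
  rwa [this]

end BigCell

/-! ### Highest weight vectors and the contraction argument. -/

section HighestWeight

variable {m : ℕ}

/-- The eigenvalues of a torus element in the natural representation. -/
def torusEntry {m : ℕ} (x : Fin m → ℂˣ) : Fin m ⊕ Fin m → ℂ :=
  Sum.elim (fun i => (x i : ℂ)) (fun i => (((x i)⁻¹ : ℂˣ) : ℂ))

theorem torusEntry_ne_zero (x : Fin m → ℂˣ) (a : Fin m ⊕ Fin m) : torusEntry x a ≠ 0 := by
  rcases a with i | i <;> simp [torusEntry]

theorem torusEntry_inv (x : Fin m → ℂˣ) (a : Fin m ⊕ Fin m) :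
    torusEntry x⁻¹ a = (torusEntry x a)⁻¹ := by
  rcases a with i | i <;> simp [torusEntry]

theorem spTorus_coe (x : Fin m → ℂˣ) : (spTorus x).1 = diagonal (torusEntry x) := rfl

theorem spTorus_inv (x : Fin m → ℂˣ) : (spTorus x)⁻¹ = spTorus x⁻¹ := by
  rw [inv_eq_iff_mul_eq_one]
  apply Subtype.ext
  rw [Submonoid.coe_mul, spTorus_coe, spTorus_coe, diagonal_mul_diagonal]
  simp [torusEntry_inv, torusEntry_ne_zero]

theorem spTorus_inBorel (x : Fin m → ℂˣ) : InBorel (spTorus x) :=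
  ⟨fun i j => by simp [spTorus_coe], fun i j h => by simp [spTorus_coe, h.ne']⟩

/-- The regular dominant one-parameter subgroup of the torus. -/
noncomputable def dominantTorus (m : ℕ) (r : ℝ) (i : Fin m) : ℂˣ :=
  Units.mk0 (Complex.exp (((r * ((m : ℤ) - i : ℤ) : ℝ) : ℂ))) (Complex.exp_ne_zero _)

theorem torusEntry_dominantTorus (r : ℝ) (a : Fin m ⊕ Fin m) :
    torusEntry (dominantTorus m r) a = Complex.exp ((r * spHeight m a : ℝ) : ℂ) := by
  rcases a with i | i
  · simp [torusEntry, dominantTorus, spHeight]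
  · simp only [torusEntry, dominantTorus, spHeight, Sum.elim_inr, Units.val_inv_eq_inv_val,
      Units.val_mk0, ← Complex.exp_neg]
    congr 1
    push_cast
    ring

/-- Conjugation scales the (a, b) entry by the exponential of r times the height difference, and
that difference is negative wherever u differs from the identity. -/
theorem tendsto_dominantTorus_conj {u : Sp m} (hu : IsOppUnipotent u) :
    Tendsto (fun r => spTorus (dominantTorus m r) * u * (spTorus (dominantTorus m r))⁻¹) atTop
      (𝓝 1) := by
  rw [tendsto_subtype_rng]
  refine tendsto_pi_nhds.2 fun a => tendsto_pi_nhds.2 fun b => ?_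
  have hval : ∀ r : ℝ, (spTorus (dominantTorus m r) * u * (spTorus (dominantTorus m r))⁻¹).1 a b =
      u.1 a b * Complex.exp ((r * (spHeight m a - spHeight m b) : ℝ) : ℂ) := by
    intro r
    rw [spTorus_inv, Submonoid.coe_mul, Submonoid.coe_mul, spTorus_coe, spTorus_coe,
      mul_diagonal, diagonal_mul, torusEntry_inv, torusEntry_dominantTorus,
      torusEntry_dominantTorus, ← Complex.exp_neg, mul_comm (Complex.exp _) (u.1 a b), mul_assoc,
      ← Complex.exp_add]
    congr 2
    push_cast
    ring
  refine Tendsto.congr (fun r => (hval r).symm) ?_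
  by_cases h : u.1 a b = (1 : Matrix (Fin m ⊕ Fin m) (Fin m ⊕ Fin m) ℂ) a b
  · by_cases hab : a = b
    · subst hab
      simp [h]
    · rw [h, one_apply_ne hab]
      simp [hab]
  · have hlt := hu a b h
    have hab : a ≠ b := by rintro rfl; exact lt_irrefl _ hlt
    have hneg : ((spHeight m a : ℝ) - spHeight m b) < 0 := by
      have : (spHeight m a : ℝ) < spHeight m b := by exact_mod_cast hlt
      linarith
    have h1 : Tendsto (fun r : ℝ => Real.exp (r * ((spHeight m a : ℝ) - spHeight m b))) atTop
        (𝓝 0) := Real.tendsto_exp_atBot.comp (tendsto_id.atTop_mul_const_of_neg hneg)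
    have h2 : Tendsto (fun r : ℝ => u.1 a b *
        ((Real.exp (r * ((spHeight m a : ℝ) - spHeight m b)) : ℝ) : ℂ)) atTop (𝓝 (u.1 a b * ((0:ℝ):ℂ))) :=
      tendsto_const_nhds.mul ((Complex.continuous_ofReal.tendsto 0).comp h1)
    simpa [hab] using h2

variable {V : Type*} [AddCommGroup V] [Module ℂ V]

theorem IsRationalRep.continuous {ρ : Representation ℂ (Sp m) V} (hρ : IsRationalRep ρ) (v : V)
    (f : Module.Dual ℂ V) : Continuous fun g => f (ρ g v) := by
  obtain ⟨p, hp⟩ := hρ v f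
  simp only [hp]
  refine (MvPolynomial.continuous_eval p).comp ?_
  refine continuous_pi fun ij => ?_
  exact (continuous_subtype_val).matrix_elem ij.1 ij.2

/-- In the span of the orbit of a highest weight vector, the highest weight space is a line. -/
theorem IsHighestWeightVector.eq_smul_of_mem_span {ρ : Representation ℂ (Sp m) V}
    (hρ : IsRationalRep ρ) {lam : Fin m → ℕ} {v w : V} (hv : IsHighestWeightVector ρ lam v)
    (hw : w ∈ Submodule.span ℂ (Set.range fun g => ρ g v))
    (hwt : ∀ x : Fin m → ℂˣ, ρ (spTorus x) w = (∏ i, (x i : ℂ) ^ lam i) • w) :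
    ∃ c : ℂ, w = c • v := by
  set χ : ℝ → ℂ := fun r => ∏ i, (dominantTorus m r i : ℂ) ^ lam i with hχ
  have hχ0 : ∀ r, χ r ≠ 0 := fun r =>
    Finset.prod_ne_zero_iff.2 fun i _ => pow_ne_zero _ (Units.ne_zero _)
  -- S collects the vectors whose normalised torus translates converge, tested against every
  -- functional, to a multiple of v. On the big cell the opposite unipotent factor is contracted to
  -- 1 and the Borel factor contributes its character.
  let S : Submodule ℂ V :=
    { carrier := {y | ∃ c : ℂ, ∀ f : Module.Dual ℂ V, Tendsto
        (fun r => (χ r)⁻¹ * f (ρ (spTorus (dominantTorus m r)) y)) atTop (𝓝 (c * f v))}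
      zero_mem' := ⟨0, fun f => by simp⟩
      add_mem' := by
        rintro y z ⟨c, hc⟩ ⟨d, hd⟩
        refine ⟨c + d, fun f => ?_⟩
        have := (hc f).add (hd f)
        simpa only [map_add, mul_add, add_mul] using this
      smul_mem' := by
        rintro a y ⟨c, hc⟩
        refine ⟨a * c, fun f => ?_⟩
        have := (hc f).const_mul a
        simpa only [map_smul, smul_eq_mul, mul_assoc, mul_left_comm _ a] using this }
  have hbig : ∀ g ∈ bigCell m, ρ g v ∈ S := by
    rintro _ ⟨u, b, hu, hb, rfl⟩
    refine ⟨∏ i, b.1 (Sum.inl i) (Sum.inl i) ^ lam i, fun f => ?_⟩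
    have hlim := ((hρ.continuous v f).tendsto 1).comp (tendsto_dominantTorus_conj hu)
    rw [map_one, Module.End.one_apply] at hlim
    refine Tendsto.congr (fun r => ?_) (hlim.const_mul _)
    have ht := hv.2 _ (spTorus_inBorel (dominantTorus m r))
    have hval : ∏ i, (spTorus (dominantTorus m r)).1 (Sum.inl i) (Sum.inl i) ^ lam i = χ r := by
      simp [spTorus_coe, torusEntry, hχ]
    rw [hval] at ht
    have hkey : ρ (spTorus (dominantTorus m r)) (ρ u v) =
        χ r • ρ (spTorus (dominantTorus m r) * u * (spTorus (dominantTorus m r))⁻¹) v := by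
      rw [← map_smul, ← ht, ← Module.End.mul_apply, ← Module.End.mul_apply, ← map_mul, ← map_mul,
        inv_mul_cancel_right]
    rw [map_mul, Module.End.mul_apply, hv.2 b hb]
    simp only [map_smul, Function.comp, hkey, smul_eq_mul]
    rw [mul_left_comm, inv_mul_cancel_left₀ (hχ0 r)]
  -- S is not assumed closed. A functional that vanishes on S but not at ρ g v would be a continuous
  -- function of g vanishing on the dense big cell.
  have hall : ∀ g, ρ g v ∈ S := by
    intro g
    by_contra hg
    obtain ⟨f, hf, hSf⟩ := Submodule.exists_le_ker_of_notMem hg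
    have hclosed : IsClosed {h : Sp m | f (ρ h v) = 0} :=
      isClosed_eq (hρ.continuous v f) continuous_const
    have hsub : closure (bigCell m) ⊆ {h : Sp m | f (ρ h v) = 0} :=
      hclosed.closure_subset_iff.2 fun h hh => hSf (hbig h hh)
    exact hf (hsub (dense_bigCell m g))
  have hwS : w ∈ S := by
    refine (Submodule.span_le.2 ?_) hw
    rintro _ ⟨g, rfl⟩
    exact hall g
  obtain ⟨c, hc⟩ := hwS
  refine ⟨c, ?_⟩
  rw [← sub_eq_zero, ← Module.forall_dual_apply_eq_zero_iff ℂ]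
  intro f
  have h1 := hc f
  have h2 : (fun r => (χ r)⁻¹ * f (ρ (spTorus (dominantTorus m r)) w)) = fun _ => f w := by
    funext r
    rw [hwt, map_smul, smul_eq_mul, inv_mul_cancel_left₀ (hχ0 r)]
  rw [h2] at h1
  have := tendsto_nhds_unique h1 tendsto_const_nhds
  rw [map_sub, map_smul, smul_eq_mul, this, sub_self]

theorem IsHighestWeightVector.torus {ρ : Representation ℂ (Sp m) V} {lam : Fin m → ℕ} {v : V}
    (hv : IsHighestWeightVector ρ lam v) (x : Fin m → ℂˣ) :
    ρ (spTorus x) v = (∏ i, (x i : ℂ) ^ lam i) • v := by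
  rw [hv.2 _ (spTorus_inBorel x)]
  simp [spTorus_coe, torusEntry]

variable {W : Type*} [AddCommGroup W] [Module ℂ W]

theorem IsRationalRep.prod {ρ : Representation ℂ (Sp m) V} {σ : Representation ℂ (Sp m) W}
    (hρ : IsRationalRep ρ) (hσ : IsRationalRep σ) : IsRationalRep (ρ.prod σ) := by
  rintro ⟨v, w⟩ f
  obtain ⟨p, hp⟩ := hρ v (f ∘ₗ LinearMap.inl ℂ V W)
  obtain ⟨q, hq⟩ := hσ w (f ∘ₗ LinearMap.inr ℂ V W)
  refine ⟨p + q, fun g => ?_⟩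
  rw [map_add, ← hp g, ← hq g]
  simp [← map_add]

/-- A subrepresentation of an irreducible representation is trivial. -/
theorem IsIrreducible.eq_bot_or_eq_top {ρ : Representation ℂ (Sp m) V} (h : ρ.IsIrreducible)
    (N : Submodule ℂ V) (hN : ∀ g, ∀ v ∈ N, ρ g v ∈ N) : N = ⊥ ∨ N = ⊤ := by
  rcases h.eq_bot_or_eq_top (⟨N, fun g v hv => hN g v hv⟩ : Subrepresentation ρ) with h | h
  · left; exact congrArg Subrepresentation.toSubmodule h
  · right; exact congrArg Subrepresentation.toSubmodule h

theorem mem_span_orbit (ρ : Representation ℂ (Sp m) V) (v : V) (g : Sp m) {w : V}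
    (hw : w ∈ Submodule.span ℂ (Set.range fun g => ρ g v)) :
    ρ g w ∈ Submodule.span ℂ (Set.range fun g => ρ g v) := by
  have : Submodule.span ℂ (Set.range fun g => ρ g v) ≤
      (Submodule.span ℂ (Set.range fun g => ρ g v)).comap (ρ g) := by
    rw [Submodule.span_le]
    rintro _ ⟨h, rfl⟩
    refine Submodule.subset_span ⟨g * h, ?_⟩
    simp [map_mul]
  exact this hw

/-- The cyclic submodule generated by a pair of highest weight vectors projects isomorphically
onto the first factor when both factors are irreducible. -/
theorem graph_bijective {ρ : Representation ℂ (Sp m) V} {σ : Representation ℂ (Sp m) W}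
    {lam : Fin m → ℕ} {v : V} {w : W}
    (hρ : IsRationalRep ρ) (hσ : IsRationalRep σ) (hρi : ρ.IsIrreducible) (hσi : σ.IsIrreducible)
    (hv : IsHighestWeightVector ρ lam v) (hw : IsHighestWeightVector σ lam w) :
    Function.Bijective ((LinearMap.fst ℂ V W).domRestrict
      (Submodule.span ℂ (Set.range fun g => (ρ.prod σ) g (v, w)))) := by
  set N := Submodule.span ℂ (Set.range fun g => (ρ.prod σ) g (v, w)) with hN
  have hvw : IsHighestWeightVector (ρ.prod σ) lam (v, w) := by
    refine ⟨fun h => hv.1 (congrArg Prod.fst h), fun b hb => ?_⟩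
    simp [hv.2 b hb, hw.2 b hb]
  have hNinv : ∀ g, ∀ y ∈ N, (ρ.prod σ) g y ∈ N := fun g y hy => mem_span_orbit _ _ g hy
  have hmem : (v, w) ∈ N := Submodule.subset_span ⟨1, by simp⟩
  constructor
  · rw [← LinearMap.ker_eq_bot, LinearMap.ker_eq_bot']
    rintro ⟨⟨a, b⟩, hab⟩ h0
    have ha : a = 0 := h0
    subst ha
    rcases IsIrreducible.eq_bot_or_eq_top hσi (N.comap (LinearMap.inr ℂ V W)) (fun g y hy => by
      have := hNinv g _ hy
      simpa using this) with h | h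
    · have hb : b ∈ N.comap (LinearMap.inr ℂ V W) := hab
      rw [h, Submodule.mem_bot] at hb
      subst hb
      rfl
    · exfalso
      have hw' : ((0 : V), w) ∈ N := by
        have : w ∈ N.comap (LinearMap.inr ℂ V W) := by rw [h]; trivial
        exact this
      -- The vector (0, w) has the same torus weight as the generator (v, w), so it would have to be
      -- proportional to it, which v ≠ 0 and w ≠ 0 exclude.
      obtain ⟨c, hc⟩ := hvw.eq_smul_of_mem_span (hρ.prod hσ) hw' (fun x => by
        simp [hw.torus x])
      have h1 : c • v = 0 := (congrArg Prod.fst hc).symm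
      have h2 : w = c • w := congrArg Prod.snd hc
      rcases smul_eq_zero.1 h1 with h1 | h1
      · rw [h1, zero_smul] at h2
        exact hw.1 h2
      · exact hv.1 h1
  · rw [← LinearMap.range_eq_top]
    rcases IsIrreducible.eq_bot_or_eq_top hρi (LinearMap.range
      ((LinearMap.fst ℂ V W).domRestrict N)) (by
        rintro g _ ⟨⟨y, hy⟩, rfl⟩
        exact ⟨⟨(ρ.prod σ) g y, hNinv g y hy⟩, by simp⟩) with h | h
    · exfalso
      have : v ∈ LinearMap.range ((LinearMap.fst ℂ V W).domRestrict N) := ⟨⟨(v, w), hmem⟩, rfl⟩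
      rw [h, Submodule.mem_bot] at this
      exact hv.1 this
    · exact h

end HighestWeight

/-! ### Uniqueness of the irreducible representation with given highest weight. -/

section Uniqueness

variable {m : ℕ} {V : Type*} [AddCommGroup V] [Module ℂ V] {W : Type*} [AddCommGroup W] [Module ℂ W]

/-- Irreducible rational representations with the same highest weight are isomorphic. -/
theorem IsIrrepOfHighestWeight.nonempty_equiv {ρ : Representation ℂ (Sp m) V}
    {σ : Representation ℂ (Sp m) W} {lam : Fin m → ℕ} (hρ : IsIrrepOfHighestWeight ρ lam)
    (hσ : IsIrrepOfHighestWeight σ lam) : Nonempty (ρ.Equiv σ) := by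
  obtain ⟨v, hv⟩ := hρ.highest
  obtain ⟨w, hw⟩ := hσ.highest
  have hbij := graph_bijective hρ.rational hσ.rational hρ.irreducible hσ.irreducible hv hw
  set N := Submodule.span ℂ (Set.range fun g => (ρ.prod σ) g (v, w)) with hN
  set e := LinearEquiv.ofBijective _ hbij with he
  have hNinv : ∀ g, ∀ y ∈ N, (ρ.prod σ) g y ∈ N := fun g y hy => mem_span_orbit _ _ g hy
  have hmem : (v, w) ∈ N := Submodule.subset_span ⟨1, by simp⟩
  -- The cyclic submodule N is the graph of this intertwiner, which sends v to w and so is nonzero;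
  -- Schur's lemma then makes it bijective.
  let φ₀ : V →ₗ[ℂ] W := ((LinearMap.snd ℂ V W).domRestrict N) ∘ₗ e.symm.toLinearMap
  have hφ₀ : ∀ y : N, φ₀ y.1.1 = y.1.2 := by
    intro y
    have : e.symm y.1.1 = y := by
      rw [LinearEquiv.symm_apply_eq]
      rfl
    simp only [φ₀, LinearMap.comp_apply, LinearEquiv.coe_coe, this]
    rfl
  have hint : ∀ g, φ₀ ∘ₗ ρ g = σ g ∘ₗ φ₀ := by
    intro g
    ext y
    obtain ⟨⟨n, hn⟩, rfl⟩ := hbij.2 y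
    have h1 := hφ₀ ⟨n, hn⟩
    have h2 := hφ₀ ⟨_, hNinv g n hn⟩
    simp only [LinearMap.comp_apply]
    change φ₀ (ρ g n.1) = σ g (φ₀ n.1)
    rw [h1]
    exact h2
  let φ : ρ.IntertwiningMap σ := ⟨φ₀, hint⟩
  have := hρ.irreducible
  have := hσ.irreducible
  rcases Representation.IsIrreducible.bijective_or_eq_zero φ with h | h
  · exact ⟨φ.ofBijective h⟩
  · exfalso
    have h1 : φ v = w := hφ₀ ⟨_, hmem⟩
    rw [h] at h1
    exact hw.1 h1.symm

/-- Transport of an irreducible representation along a linear equivalence. -/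
theorem IsIrrepOfHighestWeight.exists_conj {ρ : Representation ℂ (Sp m) V} {lam : Fin m → ℕ}
    (hρ : IsIrrepOfHighestWeight ρ lam) (e : V ≃ₗ[ℂ] W) :
    ∃ σ : Representation ℂ (Sp m) W, IsIrrepOfHighestWeight σ lam := by
  let σ : Representation ℂ (Sp m) W :=
    { toFun := fun g => e.toLinearMap ∘ₗ ρ g ∘ₗ e.symm.toLinearMap
      map_one' := by ext; simp
      map_mul' := fun g h => by ext; simp }
  have hσ : ∀ g w, σ g w = e (ρ g (e.symm w)) := fun g w => rfl
  refine ⟨σ, ⟨?_, ?_, ?_, ?_⟩⟩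
  · have := hρ.finite
    exact Module.Finite.equiv e
  · intro w f
    obtain ⟨p, hp⟩ := hρ.rational (e.symm w) (f ∘ₗ e.toLinearMap)
    exact ⟨p, fun g => by rw [← hp g]; rfl⟩
  · have hirr := hρ.irreducible
    have hnt : Nontrivial (Subrepresentation σ) := by
      obtain ⟨v, hv⟩ := hρ.highest
      refine ⟨⊥, ⊤, fun h => hv.1 ?_⟩
      have h1 : e v ∈ (⊤ : Subrepresentation σ).toSubmodule := Submodule.mem_top
      rw [← h] at h1
      have h2 : e v = 0 := h1
      simpa using h2
    refine { eq_bot_or_eq_top := fun N => ?_ }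
    rcases IsIrreducible.eq_bot_or_eq_top hirr (N.toSubmodule.comap e.toLinearMap)
      (fun g v hv => by
        have := N.apply_mem_toSubmodule g hv
        simpa [hσ] using this) with h | h
    · left
      apply Subrepresentation.toSubmodule_injective
      change N.toSubmodule = ⊥
      rw [eq_bot_iff]
      intro w hw
      have h1 : e.symm w ∈ N.toSubmodule.comap e.toLinearMap := by simpa using hw
      rw [h, Submodule.mem_bot] at h1
      simpa using h1
    · right
      apply Subrepresentation.toSubmodule_injective
      change N.toSubmodule = ⊤
      rw [eq_top_iff]
      intro w _
      have h1 : e.symm w ∈ N.toSubmodule.comap e.toLinearMap := by rw [h]; trivial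
      simpa using h1
  · obtain ⟨v, hv⟩ := hρ.highest
    refine ⟨e v, by simpa using hv.1, fun b hb => ?_⟩
    rw [hσ, LinearEquiv.symm_apply_apply, hv.2 b hb, map_smul]

/-- `irrCharSp` is the character of any irreducible representation of the given highest weight. -/
theorem IsIrrepOfHighestWeight.irrCharSp_eq {ρ : Representation ℂ (Sp m) V} {lam : Fin m → ℕ}
    (hρ : IsIrrepOfHighestWeight ρ lam) (g : Sp m) : irrCharSp m lam g = ρ.character g := by
  have := hρ.finite
  have hex : ∃ (n : ℕ) (σ : Representation ℂ (Sp m) (Fin n → ℂ)), IsIrrepOfHighestWeight σ lam :=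
    ⟨_, hρ.exists_conj (Module.finBasis ℂ V).equivFun⟩
  rw [irrCharSp, dif_pos hex]
  obtain ⟨φ⟩ := hex.choose_spec.choose_spec.nonempty_equiv hρ
  rw [Representation.char_iso φ]

end Uniqueness

/-! ### Tensor powers of matrices in coordinates. -/

section TensorPower

variable {ι I : Type*} [Fintype ι] [DecidableEq ι] [Fintype I] [DecidableEq I]

/-- The tensor product of a family of matrices, acting on functions `(ι → I) → ℂ`. -/
def piKron (A : ι → Matrix I I ℂ) : Matrix (ι → I) (ι → I) ℂ :=
  Matrix.of fun j k => ∏ a, A a (j a) (k a)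

omit [DecidableEq I] in
theorem piKron_mul (A B : ι → Matrix I I ℂ) : piKron A * piKron B = piKron (A * B) := by
  ext j k
  simp only [piKron, Matrix.mul_apply, of_apply, ← Finset.prod_mul_distrib, Pi.mul_apply,
    Finset.prod_univ_sum, Fintype.piFinset_univ]

omit [DecidableEq ι] [Fintype I] in
theorem piKron_one : piKron (1 : ι → Matrix I I ℂ) = 1 := by
  ext j k
  simp only [piKron, of_apply, Pi.one_apply, Matrix.one_apply, Finset.prod_ite_zero,
    Finset.mem_univ, forall_const, Finset.prod_const_one, funext_iff]

omit [DecidableEq ι] [Fintype I] [DecidableEq I] in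
theorem piKron_conjTranspose (A : ι → Matrix I I ℂ) :
    (piKron A)ᴴ = piKron fun a => (A a)ᴴ := by
  ext j k
  simp [piKron]

omit [DecidableEq ι] [Fintype I] in
theorem piKron_diagonal (d : I → ℂ) :
    piKron (fun _ : ι => diagonal d) = diagonal fun j => ∏ a, d (j a) := by
  ext j k
  by_cases h : j = k
  · subst h; simp [piKron]
  · rw [diagonal_apply_ne _ h]
    obtain ⟨a, ha⟩ := Function.ne_iff.1 h
    simp only [piKron, of_apply]
    exact Finset.prod_eq_zero (Finset.mem_univ a) (diagonal_apply_ne _ ha)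

omit [DecidableEq I] in
theorem tensorPower_mul (A B : Matrix I I ℂ) :
    piKron (fun _ : ι => A) * piKron (fun _ : ι => B) = piKron fun _ : ι => A * B :=
  piKron_mul _ _

end TensorPower

/-! ### Highest weight vectors from products of minors. -/

section Minors

variable {m : ℕ}

/-- The minor of `M` on the rows `k` and the first `n` columns. -/
noncomputable def leadingMinor {n : ℕ} (h : n ≤ m) (M : Matrix (Fin m ⊕ Fin m) (Fin m ⊕ Fin m) ℂ)
    (k : Fin n → Fin m ⊕ Fin m) : ℂ :=
  (Matrix.of fun a b : Fin n => M (k a) (Sum.inl (Fin.castLE h b))).det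

/-- The minors of N are the coordinates of the wedge of its first n columns, so applying M to that
tensor multiplies N by M on the left. The proof is multilinearity of the determinant in its rows. -/
theorem sum_prod_mul_leadingMinor {n : ℕ} (h : n ≤ m)
    (M N : Matrix (Fin m ⊕ Fin m) (Fin m ⊕ Fin m) ℂ) (j : Fin n → Fin m ⊕ Fin m) :
    ∑ k : Fin n → Fin m ⊕ Fin m, (∏ a, M (j a) (k a)) * leadingMinor h N k =
      leadingMinor h (M * N) j := by
  have h1 : leadingMinor h (M * N) j = detRowAlternating.toMultilinearMap
      (fun a : Fin n => ∑ i : Fin m ⊕ Fin m,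
        M (j a) i • fun b : Fin n => N i (Sum.inl (Fin.castLE h b))) := by
    simp only [leadingMinor]
    change det _ = det _
    congr 1
    ext a b
    simp [Matrix.mul_apply]
  rw [h1, MultilinearMap.map_sum]
  refine Finset.sum_congr rfl fun k _ => ?_
  rw [MultilinearMap.map_smul_univ]
  rfl

theorem leadingMinor_eq_zero {n : ℕ} (h : n ≤ m) (M : Matrix (Fin m ⊕ Fin m) (Fin m ⊕ Fin m) ℂ)
    {k : Fin n → Fin m ⊕ Fin m} (hk : ¬ Function.Injective k) : leadingMinor h M k = 0 := by
  simp only [Function.Injective, not_forall] at hk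
  obtain ⟨a, b, hab, hne⟩ := hk
  exact det_zero_of_row_eq hne (by ext c; simp [hab])

theorem leadingMinor_one_castLE {n : ℕ} (h : n ≤ m) :
    leadingMinor h 1 (fun a => Sum.inl (Fin.castLE h a)) = 1 := by
  rw [leadingMinor, ← det_one (n := Fin n)]
  congr 1
  ext a b
  simp [Matrix.one_apply]

/-- The first n columns of a Borel element are the first n columns of the identity times an upper
triangular n × n block, whose determinant is the product of its diagonal. -/
theorem leadingMinor_of_inBorel {n : ℕ} (h : n ≤ m) {b : Sp m} (hb : InBorel b)
    (k : Fin n → Fin m ⊕ Fin m) :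
    leadingMinor h b.1 k = leadingMinor h 1 k *
      ∏ i : Fin n, b.1 (Sum.inl (Fin.castLE h i)) (Sum.inl (Fin.castLE h i)) := by
  set B : Matrix (Fin n) (Fin n) ℂ :=
    Matrix.of fun c d => b.1 (Sum.inl (Fin.castLE h c)) (Sum.inl (Fin.castLE h d)) with hB
  have hdet : B.det = ∏ i : Fin n, b.1 (Sum.inl (Fin.castLE h i)) (Sum.inl (Fin.castLE h i)) := by
    rw [det_of_isUpperTriangular]
    · rfl
    · intro i j hij
      exact hb.2 _ _ hij
  rw [← hdet, leadingMinor, leadingMinor, ← det_mul]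
  congr 1
  ext a d
  simp only [of_apply, Matrix.mul_apply, hB]
  by_cases hex : ∃ c : Fin n, k a = Sum.inl (Fin.castLE h c)
  · obtain ⟨c, hc⟩ := hex
    rw [hc, Finset.sum_eq_single c]
    · simp
    · intro e _ he
      rw [Matrix.one_apply_ne, zero_mul]
      simpa [eq_comm] using he
    · simp
  · push Not at hex
    rw [Finset.sum_eq_zero fun c _ => by rw [Matrix.one_apply_ne (hex c), zero_mul]]
    rcases hka : k a with i | i
    · refine hb.2 _ _ ?_
      by_contra hlt
      have hlt' : (i : ℕ) ≤ d := not_lt.1 hlt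
      exact hex ⟨i, by omega⟩ (by rw [hka]; rfl)
    · exact hb.1 _ _

/-- The highest weight vector of weight `(2^q, 1^(p-q))` in the tensor power. -/
noncomputable def twoColumnVector {p q : ℕ} (hp : p ≤ m) (hq : q ≤ m)
    (M : Matrix (Fin m ⊕ Fin m) (Fin m ⊕ Fin m) ℂ) (j : Fin p ⊕ Fin q → Fin m ⊕ Fin m) : ℂ :=
  leadingMinor hp M (fun a => j (Sum.inl a)) * leadingMinor hq M (fun a => j (Sum.inr a))

theorem piKron_mulVec_twoColumnVector {p q : ℕ} (hp : p ≤ m) (hq : q ≤ m)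
    (M N : Matrix (Fin m ⊕ Fin m) (Fin m ⊕ Fin m) ℂ) :
    piKron (fun _ : Fin p ⊕ Fin q => M) *ᵥ twoColumnVector hp hq N =
      twoColumnVector hp hq (M * N) := by
  ext j
  simp only [twoColumnVector, ← sum_prod_mul_leadingMinor]
  rw [Finset.sum_mul_sum, ← Fintype.sum_prod_type', mulVec, dotProduct]
  refine Fintype.sum_equiv (Equiv.sumArrowEquivProdArrow _ _ _) _ _ fun k => ?_
  simp only [piKron, of_apply, Fintype.prod_sum_type, Equiv.sumArrowEquivProdArrow,
    Equiv.coe_fn_mk]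
  simp only [twoColumnVector, Function.comp_def]
  ring

theorem twoColumnVector_eq_zero {p q : ℕ} (hp : p ≤ m) (hq : q ≤ m)
    (M : Matrix (Fin m ⊕ Fin m) (Fin m ⊕ Fin m) ℂ) {j : Fin p ⊕ Fin q → Fin m ⊕ Fin m}
    (hj : ¬ (Function.Injective (fun a => j (Sum.inl a)) ∧
      Function.Injective (fun a => j (Sum.inr a)))) :
    twoColumnVector hp hq M j = 0 := by
  rw [twoColumnVector]
  by_cases h : Function.Injective (fun a => j (Sum.inl a))
  · rw [leadingMinor_eq_zero hq M (fun h' => hj ⟨h, h'⟩), mul_zero]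
  · rw [leadingMinor_eq_zero hp M h, zero_mul]

theorem twoColumnVector_one_ne_zero {p q : ℕ} (hp : p ≤ m) (hq : q ≤ m) :
    twoColumnVector hp hq 1 ≠ 0 := by
  intro h
  have := congrFun h (Sum.elim (fun a => Sum.inl (Fin.castLE hp a))
    (fun a => Sum.inl (Fin.castLE hq a)))
  simp only [twoColumnVector, Sum.elim_inl, Sum.elim_inr, leadingMinor_one_castLE, mul_one,
    Pi.zero_apply] at this
  exact one_ne_zero this

theorem prod_castLE_eq {n : ℕ} (h : n ≤ m) (f : Fin m → ℂ) :
    ∏ i : Fin n, f (Fin.castLE h i) = ∏ i : Fin m, f i ^ (if (i : ℕ) < n then 1 else 0) := by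
  have : ∏ i : Fin m, f i ^ (if (i : ℕ) < n then 1 else 0) =
      ∏ i ∈ Finset.univ.filter (fun i : Fin m => (i : ℕ) < n), f i := by
    rw [Finset.prod_filter]
    refine Finset.prod_congr rfl fun i _ => ?_
    split_ifs <;> simp
  rw [this]
  refine Finset.prod_bij (fun i _ => Fin.castLE h i) ?_ ?_ ?_ ?_
  · intro i _; simp
  · intro i _ j _ hij; simpa using hij
  · intro i hi
    exact ⟨⟨i, (Finset.mem_filter.1 hi).2⟩, Finset.mem_univ _, rfl⟩
  · intro i _; rfl

theorem twoColumnVector_of_inBorel {p q : ℕ} (hp : p ≤ m) (hqp : q ≤ p) {b : Sp m}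
    (hb : InBorel b) :
    twoColumnVector hp (hqp.trans hp) b.1 =
      (∏ i, b.1 (Sum.inl i) (Sum.inl i) ^ twoOnePartition m q (p - q) i) •
        twoColumnVector hp (hqp.trans hp) 1 := by
  have hw : ∏ i, b.1 (Sum.inl i) (Sum.inl i) ^ twoOnePartition m q (p - q) i =
      (∏ i : Fin p, b.1 (Sum.inl (Fin.castLE hp i)) (Sum.inl (Fin.castLE hp i))) *
      ∏ i : Fin q, b.1 (Sum.inl (Fin.castLE (hqp.trans hp) i))
        (Sum.inl (Fin.castLE (hqp.trans hp) i)) := by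
    rw [prod_castLE_eq hp (fun i => b.1 (Sum.inl i) (Sum.inl i)),
      prod_castLE_eq (hqp.trans hp) (fun i => b.1 (Sum.inl i) (Sum.inl i)),
      ← Finset.prod_mul_distrib]
    refine Finset.prod_congr rfl fun i _ => ?_
    rw [← pow_add]
    congr 1
    simp only [twoOnePartition]
    split_ifs <;> omega
  ext j
  rw [hw, Pi.smul_apply, smul_eq_mul, twoColumnVector, twoColumnVector,
    leadingMinor_of_inBorel hp hb, leadingMinor_of_inBorel (hqp.trans hp) hb]
  ring

end Minors

/-! ### Orthogonal projections commuting with a self-adjoint family. -/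

section Projection

/-- A subspace of `J → ℂ` admits a projection commuting with every matrix that preserves it together
with its conjugate transpose. -/
theorem exists_orthogonal_projection {J : Type*} [Fintype J] [DecidableEq J]
    (W : Submodule ℂ (J → ℂ)) :
    ∃ π : Matrix J J ℂ, (∀ y, π *ᵥ y ∈ W) ∧ (∀ y ∈ W, π *ᵥ y = y) ∧
      ∀ A : Matrix J J ℂ, (∀ y ∈ W, A *ᵥ y ∈ W) → (∀ y ∈ W, Aᴴ *ᵥ y ∈ W) → A * π = π * A := by
  let e : EuclideanSpace ℂ J ≃ₗ[ℂ] (J → ℂ) := WithLp.linearEquiv 2 ℂ (J → ℂ)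
  let U : Submodule ℂ (EuclideanSpace ℂ J) := W.comap e.toLinearMap
  let P : (J → ℂ) →ₗ[ℂ] (J → ℂ) :=
    e.toLinearMap ∘ₗ (U.starProjection : EuclideanSpace ℂ J →ₗ[ℂ] EuclideanSpace ℂ J) ∘ₗ
      e.symm.toLinearMap
  have hPv : ∀ y, P y = e (U.starProjection (e.symm y)) := fun y => rfl
  have hPW : ∀ y, P y ∈ W := fun y => U.starProjection_apply_mem (e.symm y)
  have hPid : ∀ y ∈ W, P y = y := by
    intro y hy
    rw [hPv, Submodule.starProjection_eq_self_iff.2, LinearEquiv.apply_symm_apply]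
    change e (e.symm y) ∈ W
    rwa [LinearEquiv.apply_symm_apply]
  have hinner : ∀ y z : J → ℂ, inner ℂ (e.symm y) (e.symm z) = z ⬝ᵥ star y := by
    intro y z
    rw [EuclideanSpace.inner_eq_star_dotProduct]
    rfl
  have hperp : ∀ y, ∀ w ∈ W, (y - P y) ⬝ᵥ star w = 0 := by
    intro y w hw
    rw [← hinner, map_sub]
    have h1 : e.symm (P y) = U.starProjection (e.symm y) := by
      rw [hPv, LinearEquiv.symm_apply_apply]
    rw [h1]
    have h2 := U.sub_starProjection_mem_orthogonal (e.symm y)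
    refine (Submodule.mem_orthogonal _ _).1 h2 (e.symm w) ?_
    change e (e.symm w) ∈ W
    rwa [LinearEquiv.apply_symm_apply]
  have hzero : ∀ z, (∀ w ∈ W, z ⬝ᵥ star w = 0) → P z = 0 := by
    intro z hz
    have h1 : e.symm z ∈ Uᗮ := by
      rw [Submodule.mem_orthogonal]
      intro u hu
      have := hz (e u) hu
      rwa [← hinner, LinearEquiv.symm_apply_apply] at this
    rw [hPv, (Submodule.starProjection_apply_eq_zero_iff U).2 h1, map_zero]
  refine ⟨LinearMap.toMatrix' P, fun y => ?_, fun y hy => ?_, fun A hA hAt => ?_⟩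
  · rw [LinearMap.toMatrix'_mulVec]; exact hPW y
  · rw [LinearMap.toMatrix'_mulVec]; exact hPid y hy
  · apply Matrix.toLin'.injective
    ext1 y
    apply LinearMap.ext_ring
    simp only [LinearMap.comp_apply, Matrix.toLin'_apply, ← mulVec_mulVec,
      LinearMap.toMatrix'_mulVec]
    set z := LinearMap.single ℂ (fun _ : J => ℂ) y 1
    -- A preserves the orthogonal complement of W because its adjoint preserves W.
    have h1 : P (A *ᵥ (z - P z)) = 0 := by
      refine hzero _ fun w hw => ?_
      have := hperp z _ (hAt w hw)
      rw [star_mulVec, conjTranspose_conjTranspose] at this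
      rw [← this, dotProduct_comm, dotProduct_mulVec, dotProduct_comm]
    rw [mulVec_sub, map_sub, hPid _ (hA _ (hPW z)), sub_eq_zero] at h1
    exact h1.symm

end Projection

/-! ### Torus characters and weights of tensors. -/

section Weights

variable {m : ℕ}

/-- The weights of the natural representation. -/
def entryWeight : Fin m ⊕ Fin m → Fin m → ℤ :=
  Sum.elim (fun i => Pi.single i 1) (fun i => -Pi.single i 1)

/-- The character of the torus attached to a weight. -/
noncomputable def torusChar (x : Fin m → ℂˣ) (μ : Fin m → ℤ) : ℂ := ∏ i, (x i : ℂ) ^ μ i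

theorem torusChar_add (x : Fin m → ℂˣ) (μ ν : Fin m → ℤ) :
    torusChar x (μ + ν) = torusChar x μ * torusChar x ν := by
  simp only [torusChar, ← Finset.prod_mul_distrib, Pi.add_apply]
  exact Finset.prod_congr rfl fun i _ => zpow_add₀ (Units.ne_zero _) _ _

theorem torusChar_zero (x : Fin m → ℂˣ) : torusChar x 0 = 1 := by simp [torusChar]

theorem torusChar_sum {ι : Type*} (s : Finset ι) (x : Fin m → ℂˣ) (μ : ι → Fin m → ℤ) :
    torusChar x (∑ a ∈ s, μ a) = ∏ a ∈ s, torusChar x (μ a) := by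
  classical
  induction s using Finset.induction_on with
  | empty => simp [torusChar_zero]
  | insert _ _ ha ih => rw [Finset.sum_insert ha, Finset.prod_insert ha, torusChar_add, ih]

theorem torusChar_single (x : Fin m → ℂˣ) (i : Fin m) (n : ℤ) :
    torusChar x (Pi.single i n) = (x i : ℂ) ^ n := by
  rw [torusChar, Finset.prod_eq_single i]
  · simp
  · intro j _ hj; simp [hj]
  · simp

theorem torusChar_neg (x : Fin m → ℂˣ) (μ : Fin m → ℤ) : torusChar x (-μ) = (torusChar x μ)⁻¹ := by
  simp [torusChar]

theorem torusChar_entryWeight (x : Fin m → ℂˣ) (a : Fin m ⊕ Fin m) :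
    torusChar x (entryWeight a) = torusEntry x a := by
  rcases a with i | i
  · simp [entryWeight, torusChar_single, torusEntry]
  · simp [entryWeight, torusChar_neg, torusChar_single, torusEntry]

theorem exists_torusChar_ne {μ ν : Fin m → ℤ} (h : μ ≠ ν) :
    ∃ x : Fin m → ℂˣ, torusChar x μ ≠ torusChar x ν := by
  obtain ⟨i, hi⟩ := Function.ne_iff.1 h
  let u : ℂˣ := Units.mk0 2 two_ne_zero
  refine ⟨Pi.mulSingle i u, fun heq => hi ?_⟩
  have key : ∀ κ : Fin m → ℤ, torusChar (Pi.mulSingle i u) κ = (2 : ℂ) ^ κ i := by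
    intro κ
    rw [torusChar, Finset.prod_eq_single i]
    · simp [u]
    · intro j _ hj; simp [hj]
    · simp
  rw [key, key] at heq
  have h2 : ((2 : ℝ) : ℂ) ^ μ i = ((2 : ℝ) : ℂ) ^ ν i := by simpa using heq
  have h3 : (2 : ℝ) ^ μ i = (2 : ℝ) ^ ν i := by exact_mod_cast h2
  exact zpow_right_injective₀ (by norm_num) (by norm_num) h3

/-- The weight of a basis vector of a tensor power of the natural representation. -/
def tensorWeight {ι : Type*} [Fintype ι] (j : ι → Fin m ⊕ Fin m) : Fin m → ℤ :=
  ∑ a, entryWeight (j a)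

theorem piKron_spTorus {ι : Type*} [Fintype ι] (x : Fin m → ℂˣ) :
    piKron (fun _ : ι => (spTorus x).1) = diagonal fun j => torusChar x (tensorWeight j) := by
  rw [spTorus_coe, piKron_diagonal]
  congr 1
  ext j
  simp [tensorWeight, torusChar_sum, torusChar_entryWeight]

end Weights

/-! ### The tensor representation and its invariant projections. -/

section TensorRep

variable {m : ℕ}

/-- Tensor powers of the natural representation. -/
noncomputable def tensorRep (m : ℕ) (ι : Type*) [Fintype ι] [DecidableEq ι] :
    Representation ℂ (Sp m) ((ι → Fin m ⊕ Fin m) → ℂ) where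
  toFun g := Matrix.toLin' (piKron fun _ => g.1)
  map_one' := by
    rw [Submonoid.coe_one]
    have h : piKron (fun _ : ι => (1 : Matrix (Fin m ⊕ Fin m) (Fin m ⊕ Fin m) ℂ)) = 1 := piKron_one
    rw [h, Matrix.toLin'_one]
    rfl
  map_mul' g h := by
    rw [Submonoid.coe_mul, ← tensorPower_mul, Matrix.toLin'_mul]
    rfl

variable {ι : Type*} [Fintype ι] [DecidableEq ι]

theorem tensorRep_apply (g : Sp m) (y : (ι → Fin m ⊕ Fin m) → ℂ) :
    tensorRep m ι g y = piKron (fun _ => g.1) *ᵥ y := by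
  simp [tensorRep]

theorem tensorRep_isRational : IsRationalRep (tensorRep m ι) := by
  intro v f
  refine ⟨∑ j : ι → Fin m ⊕ Fin m, ∑ k : ι → Fin m ⊕ Fin m,
    MvPolynomial.C (f (Pi.single j 1) * v k) * ∏ a, MvPolynomial.X (j a, k a), fun g => ?_⟩
  rw [tensorRep_apply, LinearMap.pi_apply_eq_sum_univ f]
  simp only [map_sum, map_mul, map_prod, MvPolynomial.eval_C, MvPolynomial.eval_X, mulVec,
    dotProduct, piKron, of_apply, smul_eq_mul, Finset.sum_mul]
  refine Finset.sum_congr rfl fun j _ => Finset.sum_congr rfl fun k _ => ?_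
  have : (fun i => if j = i then (1 : ℂ) else 0) = Pi.single j 1 := by
    ext i; simp [Pi.single_apply, eq_comm]
  rw [this]
  ring

/-- Stability of the group under the adjoint replaces averaging over a compact form: orthogonal
complements of invariant subspaces of tensor powers are invariant. -/
theorem conjTranspose_mem_sp (g : Sp m) : g.1ᴴ ∈ Matrix.symplecticGroup (Fin m) ℂ :=
  SymplecticGroup.map_mem (SymplecticGroup.transpose_mem g.2) (starRingEnd ℂ)

/-- A projection onto a subrepresentation of a tensor power commuting with the group. -/
theorem exists_equivariant_projection (W : Submodule ℂ ((ι → Fin m ⊕ Fin m) → ℂ))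
    (hW : ∀ g, ∀ y ∈ W, tensorRep m ι g y ∈ W) :
    ∃ π : Matrix (ι → Fin m ⊕ Fin m) (ι → Fin m ⊕ Fin m) ℂ, (∀ y, π *ᵥ y ∈ W) ∧
      (∀ y ∈ W, π *ᵥ y = y) ∧ ∀ g : Sp m, piKron (fun _ => g.1) * π = π * piKron fun _ => g.1 := by
  obtain ⟨π, h1, h2, h3⟩ := exists_orthogonal_projection W
  refine ⟨π, h1, h2, fun g => h3 _ (fun y hy => ?_) (fun y hy => ?_)⟩
  · rw [← tensorRep_apply]; exact hW g y hy
  · rw [piKron_conjTranspose]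
    have := hW ⟨g.1ᴴ, conjTranspose_mem_sp g⟩ y hy
    rwa [tensorRep_apply] at this

end TensorRep

/-! ### The irreducible representation of two-column shape. -/

section TwoColumn

variable {m p q : ℕ}

theorem twoColumnVector_isHighestWeightVector (hp : p ≤ m) (hqp : q ≤ p) :
    IsHighestWeightVector (tensorRep m (Fin p ⊕ Fin q)) (twoOnePartition m q (p - q))
      (twoColumnVector hp (hqp.trans hp) 1) := by
  refine ⟨twoColumnVector_one_ne_zero _ _, fun b hb => ?_⟩
  rw [tensorRep_apply, piKron_mulVec_twoColumnVector, mul_one, twoColumnVector_of_inBorel hp hqp hb]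

/-- The irreducible representation of highest weight `(2^q, 1^(p-q))` inside the tensor power. -/
noncomputable def twoColumnModule (hp : p ≤ m) (hqp : q ≤ p) :
    Submodule ℂ ((Fin p ⊕ Fin q → Fin m ⊕ Fin m) → ℂ) :=
  Submodule.span ℂ (Set.range fun g =>
    tensorRep m (Fin p ⊕ Fin q) g (twoColumnVector hp (hqp.trans hp) 1))

theorem twoColumnModule_invariant (hp : p ≤ m) (hqp : q ≤ p) (g : Sp m) :
    ∀ y ∈ twoColumnModule hp hqp, tensorRep m (Fin p ⊕ Fin q) g y ∈ twoColumnModule hp hqp :=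
  fun _ hy => mem_span_orbit _ _ g hy

theorem twoColumnVector_mem (hp : p ≤ m) (hqp : q ≤ p) :
    twoColumnVector hp (hqp.trans hp) 1 ∈ twoColumnModule hp hqp :=
  Submodule.subset_span ⟨1, by simp⟩

/-- The action of the symplectic group on `twoColumnModule`. -/
noncomputable def twoColumnRep (hp : p ≤ m) (hqp : q ≤ p) :
    Representation ℂ (Sp m) (twoColumnModule hp hqp) :=
  (⟨twoColumnModule hp hqp, fun g _ hv => twoColumnModule_invariant hp hqp g _ hv⟩ :
    Subrepresentation (tensorRep m (Fin p ⊕ Fin q))).toRepresentation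

theorem twoColumnRep_coe (hp : p ≤ m) (hqp : q ≤ p) (g : Sp m) (y : twoColumnModule hp hqp) :
    (twoColumnRep hp hqp g y : (Fin p ⊕ Fin q → Fin m ⊕ Fin m) → ℂ) =
      tensorRep m (Fin p ⊕ Fin q) g y := rfl

/-- The equivariant projection onto N keeps the weight of the generator v, so it sends v to c • v.
If c = 0 it kills the whole cyclic module, hence N; otherwise v itself lies in N. -/
theorem twoColumnModule_simple (hp : p ≤ m) (hqp : q ≤ p)
    (N : Submodule ℂ ((Fin p ⊕ Fin q → Fin m ⊕ Fin m) → ℂ)) (hNle : N ≤ twoColumnModule hp hqp)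
    (hN : ∀ g, ∀ y ∈ N, tensorRep m (Fin p ⊕ Fin q) g y ∈ N) :
    N = ⊥ ∨ N = twoColumnModule hp hqp := by
  obtain ⟨π, h1, h2, h3⟩ := exists_equivariant_projection N hN
  set v := twoColumnVector (m := m) hp (hqp.trans hp) 1 with hv
  have hhw := twoColumnVector_isHighestWeightVector hp hqp
  have hcomm : ∀ g y, tensorRep m (Fin p ⊕ Fin q) g (π *ᵥ y) =
      π *ᵥ tensorRep m (Fin p ⊕ Fin q) g y := by
    intro g y
    rw [tensorRep_apply, tensorRep_apply, mulVec_mulVec, mulVec_mulVec, h3]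
  obtain ⟨c, hc⟩ := hhw.eq_smul_of_mem_span tensorRep_isRational (hNle (h1 v)) (fun x => by
    rw [hcomm, hhw.torus, mulVec_smul])
  by_cases hc0 : c = 0
  · left
    rw [hc0, zero_smul] at hc
    rw [eq_bot_iff]
    intro y hy
    have hker : twoColumnModule hp hqp ≤ LinearMap.ker (Matrix.toLin' π) := by
      rw [twoColumnModule, Submodule.span_le]
      rintro _ ⟨g, rfl⟩
      rw [SetLike.mem_coe, LinearMap.mem_ker, Matrix.toLin'_apply, ← hcomm, hc, map_zero]
    have h4 := hker (hNle hy)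
    rw [LinearMap.mem_ker, Matrix.toLin'_apply, h2 y hy] at h4
    exact h4
  · right
    refine le_antisymm hNle ?_
    have hvN : v ∈ N := by
      have : v = c⁻¹ • (π *ᵥ v) := by rw [hc, smul_smul, inv_mul_cancel₀ hc0, one_smul]
      rw [this]
      exact N.smul_mem _ (h1 v)
    rw [twoColumnModule, Submodule.span_le]
    rintro _ ⟨g, rfl⟩
    exact hN g _ hvN

theorem twoColumnRep_isIrrep (hp : p ≤ m) (hqp : q ≤ p) :
    IsIrrepOfHighestWeight (twoColumnRep hp hqp) (twoOnePartition m q (p - q)) := by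
  have hhw := twoColumnVector_isHighestWeightVector hp hqp
  have hhw' : IsHighestWeightVector (twoColumnRep hp hqp) (twoOnePartition m q (p - q))
      ⟨_, twoColumnVector_mem hp hqp⟩ := by
    refine ⟨fun h => hhw.1 (congrArg Subtype.val h), fun b hb => ?_⟩
    apply Subtype.ext
    rw [twoColumnRep_coe]
    exact hhw.2 b hb
  refine ⟨inferInstance, ?_, ?_, _, hhw'⟩
  · intro v f
    obtain ⟨f', hf'⟩ := LinearMap.exists_extend f
    obtain ⟨P, hP⟩ := tensorRep_isRational v.1 f'
    refine ⟨P, fun g => ?_⟩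
    rw [← hP g, ← hf']
    rfl
  · have hnt : Nontrivial (Subrepresentation (twoColumnRep hp hqp)) := by
      refine ⟨⊥, ⊤, fun h => hhw'.1 ?_⟩
      have h1 : (⟨_, twoColumnVector_mem hp hqp⟩ : twoColumnModule hp hqp) ∈
        (⊤ : Subrepresentation (twoColumnRep hp hqp)).toSubmodule := Submodule.mem_top
      rw [← h] at h1
      exact h1
    refine { eq_bot_or_eq_top := fun N => ?_ }
    rcases twoColumnModule_simple hp hqp (N.toSubmodule.map (twoColumnModule hp hqp).subtype)
      (Submodule.map_subtype_le _ _) (by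
        rintro g _ ⟨y, hy, rfl⟩
        exact ⟨_, N.apply_mem_toSubmodule g hy, rfl⟩) with h | h
    · left
      apply Subrepresentation.toSubmodule_injective
      change N.toSubmodule = ⊥
      apply Submodule.map_injective_of_injective (Submodule.subtype_injective _)
      rw [h, Submodule.map_bot]
    · right
      apply Subrepresentation.toSubmodule_injective
      change N.toSubmodule = ⊤
      apply Submodule.map_injective_of_injective (Submodule.subtype_injective _)
      rw [h, Submodule.map_subtype_top]

theorem trace_restrict_eq_trace_mul {J : Type*} [Fintype J] [DecidableEq J]
    (W : Submodule ℂ (J → ℂ)) (A π : Matrix J J ℂ) (hA : ∀ y ∈ W, A *ᵥ y ∈ W)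
    (h1 : ∀ y, π *ᵥ y ∈ W) (h2 : ∀ y ∈ W, π *ᵥ y = y) :
    LinearMap.trace ℂ W ((Matrix.toLin' A).restrict (p := W) (q := W)
      (fun y hy => by simpa using hA y hy)) = (A * π).trace := by
  let P : (J → ℂ) →ₗ[ℂ] W := (Matrix.toLin' π).codRestrict W (fun y => by simpa using h1 y)
  have e1 : (A * π).trace = LinearMap.trace ℂ (J → ℂ) ((Matrix.toLin' A ∘ₗ W.subtype) ∘ₗ P) := by
    rw [← Matrix.trace_toLin'_eq, Matrix.toLin'_mul]
    rfl
  have e2 : (Matrix.toLin' A).restrict (p := W) (q := W) (fun y hy => by simpa using hA y hy) =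
      P ∘ₗ (Matrix.toLin' A ∘ₗ W.subtype) := by
    ext1 y
    apply Subtype.ext
    simp only [LinearMap.coe_restrict_apply, LinearMap.comp_apply, P, LinearMap.codRestrict_apply,
      Submodule.subtype_apply, Matrix.toLin'_apply]
    exact (h2 _ (hA y.1 y.2)).symm
  rw [e1, e2, LinearMap.trace_comp_comm']

/-- The projection matrix of the irreducible representation of highest weight `(2^q, 1^(p-q))`. -/
theorem exists_twoColumn_projection (hp : p ≤ m) (hqp : q ≤ p) :
    ∃ π : Matrix (Fin p ⊕ Fin q → Fin m ⊕ Fin m) (Fin p ⊕ Fin q → Fin m ⊕ Fin m) ℂ,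
      (∀ g : Sp m, piKron (fun _ => g.1) * π = π * piKron fun _ => g.1) ∧
      (∀ x, irrCharSp m (twoOnePartition m q (p - q)) (spTorus x) =
        (piKron (fun _ => (spTorus x).1) * π).trace) ∧
      (∀ j, π j j ≠ 0 → Function.Injective (fun a => j (Sum.inl a)) ∧
        Function.Injective (fun a => j (Sum.inr a))) ∧
      (∑ j, (if tensorWeight j = fun i => (twoOnePartition m q (p - q) i : ℤ) then π j j else 0)
        = 1) ∧
      ∀ M, (∀ g : Sp m, M * piKron (fun _ => g.1) = piKron (fun _ => g.1) * M) →
        M * π = π * M → ∃ c : ℂ, M * π = c • π := by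
  obtain ⟨π, h1, h2, h3⟩ := exists_equivariant_projection (twoColumnModule hp hqp)
    (twoColumnModule_invariant hp hqp)
  have hhw := twoColumnVector_isHighestWeightVector hp hqp
  have hvW := twoColumnVector_mem (m := m) hp hqp
  set v := twoColumnVector (m := m) hp (hqp.trans hp) 1 with hv
  have hline := fun w hw hwt => hhw.eq_smul_of_mem_span (w := w) tensorRep_isRational hw hwt
  set lam := twoOnePartition m q (p - q) with hlam
  have hchar : ∀ x : Fin m → ℂˣ, ∏ i, (x i : ℂ) ^ lam i = torusChar x (fun i => (lam i : ℤ)) := by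
    intro x; simp [torusChar]
  refine ⟨π, h3, ?_, ?_, ?_, ?_⟩
  · intro x
    rw [(twoColumnRep_isIrrep hp hqp).irrCharSp_eq, Representation.character,
      ← trace_restrict_eq_trace_mul (twoColumnModule hp hqp) _ π (fun y hy => ?_) h1 h2]
    · rfl
    · rw [← tensorRep_apply]
      exact twoColumnModule_invariant hp hqp _ y hy
  · intro j hj
    by_contra hinj
    apply hj
    -- The coordinates of every translate of the generator are products of two minors, and these
    -- vanish when a row index repeats within one column.
    have hle : twoColumnModule hp hqp ≤
        LinearMap.ker (LinearMap.proj (R := ℂ) (φ := fun _ => ℂ) j) := by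
      rw [twoColumnModule, Submodule.span_le]
      rintro _ ⟨g, rfl⟩
      simp only [SetLike.mem_coe, LinearMap.mem_ker, LinearMap.proj_apply]
      rw [tensorRep_apply, piKron_mulVec_twoColumnVector]
      exact twoColumnVector_eq_zero _ _ _ hinj
    have := hle (h1 (Pi.single j 1))
    simpa using this
  · have hπ0 : ∀ j k, tensorWeight j ≠ tensorWeight k → π j k = 0 := by
      intro j k hjk
      obtain ⟨x, hx⟩ := exists_torusChar_ne hjk
      have h4 := congrFun (congrFun (h3 (spTorus x)) j) k
      rw [piKron_spTorus, diagonal_mul, mul_diagonal, mul_comm, ← sub_eq_zero, ← mul_sub] at h4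
      exact (mul_eq_zero.1 h4).resolve_right (sub_ne_zero.2 hx)
    have hv0 : ∀ j, tensorWeight j ≠ (fun i => (lam i : ℤ)) → v j = 0 := by
      intro j hj
      obtain ⟨x, hx⟩ := exists_torusChar_ne hj
      have h4 := congrFun (hhw.torus x) j
      rw [tensorRep_apply, piKron_spTorus, mulVec_diagonal, hchar, Pi.smul_apply, smul_eq_mul,
        ← sub_eq_zero, ← sub_mul] at h4
      exact (mul_eq_zero.1 h4).resolve_left (sub_ne_zero.2 hx)
    -- Since π preserves weights, each of its columns indexed by the highest weight lies on the line
    -- through v. The diagonal sum is then ∑ c k * v k, which π v = v forces to be 1.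
    have hcol : ∀ k, ∃ c : ℂ,
        π *ᵥ (if tensorWeight k = fun i => (lam i : ℤ) then Pi.single k 1 else 0) = c • v := by
      intro k
      refine hline _ (h1 _) fun x => ?_
      ext j
      rw [tensorRep_apply, piKron_spTorus, mulVec_diagonal, hchar, Pi.smul_apply, smul_eq_mul]
      split_ifs with hk
      · simp only [mulVec_single_one, col_apply]
        by_cases hjk : tensorWeight j = tensorWeight k
        · rw [hjk, hk]
        · rw [hπ0 j k hjk, mul_zero, mul_zero]
      · simp
    choose c hc using hcol
    have hdiag : ∀ j, (if tensorWeight j = fun i => (lam i : ℤ) then π j j else 0) = c j * v j := by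
      intro j
      have h4 := congrFun (hc j) j
      rw [Pi.smul_apply, smul_eq_mul] at h4
      rw [← h4]
      split_ifs <;> simp
    have hsum : (∑ k, c k * v k) • v = v := by
      have hdec : v = ∑ k, v k •
          (if tensorWeight k = (fun i => (lam i : ℤ)) then Pi.single k (1 : ℂ) else 0) := by
        ext j
        rw [Finset.sum_apply, Finset.sum_eq_single j]
        · by_cases hj : tensorWeight j = fun i => (lam i : ℤ)
          · simp [hj]
          · simp [hj, hv0 j hj]
        · intro k _ hk
          split_ifs <;> simp [hk.symm]
        · simp
      have h5 : v = π *ᵥ v := (h2 v hvW).symm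
      conv_rhs => rw [h5, hdec]
      rw [Matrix.mulVec_sum, Finset.sum_smul]
      refine Finset.sum_congr rfl fun k _ => ?_
      rw [mulVec_smul, hc k, smul_smul, mul_comm]
    simp only [hdiag]
    have h6 : (∑ k, c k * v k - 1) • v = 0 := by rw [sub_smul, one_smul, hsum, sub_self]
    exact sub_eq_zero.1 ((smul_eq_zero.1 h6).resolve_right hhw.1)
  · intro M hM hMπ
    have hMv : M *ᵥ v ∈ twoColumnModule hp hqp := by
      have : M *ᵥ v = π *ᵥ (M *ᵥ v) := by
        rw [mulVec_mulVec, ← hMπ, ← mulVec_mulVec, h2 v hvW]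
      rw [this]
      exact h1 _
    obtain ⟨c, hc⟩ := hline (M *ᵥ v) hMv (fun x => by
      have h4 := hhw.torus x
      rw [tensorRep_apply] at h4 ⊢
      rw [mulVec_mulVec, ← hM, ← mulVec_mulVec, h4, mulVec_smul])
    refine ⟨c, ?_⟩
    have hall : twoColumnModule hp hqp ≤ LinearMap.ker (Matrix.toLin' (M - c • 1)) := by
      rw [twoColumnModule, Submodule.span_le]
      rintro _ ⟨g, rfl⟩
      simp only [SetLike.mem_coe, LinearMap.mem_ker, Matrix.toLin'_apply, sub_mulVec, smul_mulVec,
        one_mulVec]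
      rw [tensorRep_apply, mulVec_mulVec, hM, ← mulVec_mulVec, ← hv, hc, mulVec_smul, sub_self]
    apply Matrix.toLin'.injective
    refine LinearMap.ext fun y => ?_
    have h4 := hall (h1 y)
    simp only [LinearMap.mem_ker, Matrix.toLin'_apply, sub_mulVec, smul_mulVec,
        one_mulVec, sub_eq_zero] at h4
    simp only [Matrix.toLin'_apply, ← mulVec_mulVec, smul_mulVec]
    exact h4

end TwoColumn

/-! ### The Lie algebra action on tensor powers. -/

section TensorDerivation

variable {ι I : Type*} [Fintype ι] [DecidableEq ι] [Fintype I] [DecidableEq I]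

omit [Fintype I] in
theorem piKron_mulSingle_apply (a : ι) (X : Matrix I I ℂ) (j k : ι → I) :
    piKron (Pi.mulSingle a X) j k =
      X (j a) (k a) * ∏ b ∈ Finset.univ.erase a, (1 : Matrix I I ℂ) (j b) (k b) := by
  rw [piKron, of_apply, ← Finset.mul_prod_erase _ _ (Finset.mem_univ a), Pi.mulSingle_eq_same]
  congr 1
  refine Finset.prod_congr rfl fun b hb => ?_
  rw [Pi.mulSingle_eq_of_ne (Finset.ne_of_mem_erase hb)]

/-- The derivation action of matrices on a tensor power. -/
noncomputable def tensorDeriv (ι : Type*) {I : Type*} [Fintype ι] [DecidableEq ι] [DecidableEq I] :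
    Matrix I I ℂ →ₗ[ℂ] Matrix (ι → I) (ι → I) ℂ where
  toFun X := ∑ a, piKron (Pi.mulSingle a X)
  map_add' X Y := by
    rw [← Finset.sum_add_distrib]
    refine Finset.sum_congr rfl fun a _ => ?_
    ext j k
    simp only [Matrix.add_apply, piKron_mulSingle_apply, add_mul]
  map_smul' c X := by
    rw [RingHom.id_apply, Finset.smul_sum]
    refine Finset.sum_congr rfl fun a _ => ?_
    ext j k
    simp only [Matrix.smul_apply, piKron_mulSingle_apply, smul_eq_mul, mul_assoc]

omit [Fintype I] in
theorem tensorDeriv_apply (X : Matrix I I ℂ) :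
    tensorDeriv ι X = ∑ a, piKron (Pi.mulSingle a X) := rfl

/-- Operators acting at different tensor positions commute, so only the terms with both factors at
the same position survive. -/
theorem tensorDeriv_mul_sub (X Y : Matrix I I ℂ) :
    tensorDeriv ι X * tensorDeriv ι Y - tensorDeriv ι Y * tensorDeriv ι X =
      tensorDeriv ι (X * Y - Y * X) := by
  rw [map_sub]
  simp only [tensorDeriv_apply, Finset.sum_mul_sum, piKron_mul]
  have hswap : ∑ i, ∑ j, piKron ((Pi.mulSingle i Y : ι → Matrix I I ℂ) * Pi.mulSingle j X) =
      ∑ j, ∑ i, piKron ((Pi.mulSingle i Y : ι → Matrix I I ℂ) * Pi.mulSingle j X) :=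
    Finset.sum_comm
  rw [hswap, ← Finset.sum_sub_distrib, ← Finset.sum_sub_distrib]
  refine Finset.sum_congr rfl fun a _ => ?_
  rw [← Finset.sum_sub_distrib, Finset.sum_eq_single a]
  · rw [← Pi.mulSingle_mul, ← Pi.mulSingle_mul]
  · intro b _ hb
    rw [(Pi.mulSingle_commute (f := fun _ : ι => Matrix I I ℂ) hb.symm X Y).eq, sub_self]
  · simp

/-- This intertwining form serves both conjugation by a group element and the eigenvector equation
of a root vector under the torus, the latter with denominators cleared. -/
theorem piKron_mul_tensorDeriv {g X Y : Matrix I I ℂ} (h : g * X = Y * g) :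
    piKron (fun _ : ι => g) * tensorDeriv ι X = tensorDeriv ι Y * piKron fun _ => g := by
  simp only [tensorDeriv_apply, Finset.mul_sum, Finset.sum_mul, piKron_mul]
  refine Finset.sum_congr rfl fun a _ => ?_
  congr 1
  ext1 b
  by_cases hb : b = a
  · subst hb; simp [h]
  · simp [hb]

omit [Fintype I] in
theorem tensorDeriv_diagonal (d : I → ℂ) :
    tensorDeriv ι (diagonal d) = diagonal fun j : ι → I => ∑ a, d (j a) := by
  ext j k
  rw [tensorDeriv_apply, Matrix.sum_apply]
  by_cases h : j = k
  · subst h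
    simp [piKron_mulSingle_apply]
  · rw [diagonal_apply_ne _ h]
    obtain ⟨b, hb⟩ := Function.ne_iff.1 h
    refine Finset.sum_eq_zero fun a _ => ?_
    rw [piKron_mulSingle_apply]
    by_cases hab : b = a
    · subst hab
      rw [diagonal_apply_ne _ hb, zero_mul]
    · have h0 : ∏ b ∈ Finset.univ.erase a, (1 : Matrix I I ℂ) (j b) (k b) = 0 :=
        Finset.prod_eq_zero (Finset.mem_erase.2 ⟨hab, Finset.mem_univ b⟩)
          (Matrix.one_apply_ne (n := I) (α := ℂ) hb)
      rw [h0, mul_zero]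

omit [Fintype I] in
theorem hasDerivAt_piKron (X : Matrix I I ℂ) (j k : ι → I) :
    HasDerivAt (fun s : ℂ => piKron (fun _ : ι => 1 + s • X) j k) (tensorDeriv ι X j k) 0 := by
  have h : ∀ a ∈ (Finset.univ : Finset ι),
      HasDerivAt (fun s : ℂ => (1 + s • X) (j a) (k a)) (X (j a) (k a)) 0 := by
    intro a _
    have := ((hasDerivAt_id (0 : ℂ)).mul_const (X (j a) (k a))).const_add
      ((1 : Matrix I I ℂ) (j a) (k a))
    simpa using this
  have h2 := HasDerivAt.fun_finsetProd h
  refine h2.congr_deriv ?_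
  rw [tensorDeriv_apply, Matrix.sum_apply]
  refine Finset.sum_congr rfl fun a _ => ?_
  rw [piKron_mulSingle_apply, smul_eq_mul, mul_comm, zero_smul, add_zero]

/-- A matrix commuting with a curve of tensor powers commutes with its derivative. -/
theorem tensorDeriv_mul_comm {X : Matrix I I ℂ} {π : Matrix (ι → I) (ι → I) ℂ}
    (h : ∀ s : ℂ, piKron (fun _ : ι => 1 + s • X) * π = π * piKron fun _ => 1 + s • X) :
    tensorDeriv ι X * π = π * tensorDeriv ι X := by
  ext j k
  have h1 : HasDerivAt (fun s : ℂ =>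
      (piKron (fun _ : ι => 1 + s • X) * π : Matrix (ι → I) (ι → I) ℂ) j k)
      (∑ l, tensorDeriv ι X j l * π l k) 0 := by
    simp only [Matrix.mul_apply]
    exact HasDerivAt.fun_sum fun l _ => (hasDerivAt_piKron X j l).mul_const _
  have h2 : HasDerivAt (fun s : ℂ =>
      (π * piKron (fun _ : ι => 1 + s • X) : Matrix (ι → I) (ι → I) ℂ) j k)
      (∑ l, π j l * tensorDeriv ι X l k) 0 := by
    simp only [Matrix.mul_apply]
    exact HasDerivAt.fun_sum fun l _ => (hasDerivAt_piKron X l k).const_mul _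
  simp only [h] at h1
  rw [Matrix.mul_apply, Matrix.mul_apply]
  exact h1.unique h2

end TensorDerivation

/-! ### The Casimir operator and its invariance. -/

section Casimir

variable {m : ℕ}

/-- Projection of a matrix to the symplectic Lie algebra (up to a factor `2`). -/
def spProj (m : ℕ) : Matrix (Fin m ⊕ Fin m) (Fin m ⊕ Fin m) ℂ →ₗ[ℂ]
    Matrix (Fin m ⊕ Fin m) (Fin m ⊕ Fin m) ℂ where
  toFun X := X + J (Fin m) ℂ * Xᵀ * J (Fin m) ℂ
  map_add' X Y := by
    rw [transpose_add, Matrix.mul_add, Matrix.add_mul]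
    abel
  map_smul' c X := by
    simp [transpose_smul, smul_add]

theorem spProj_apply (X : Matrix (Fin m ⊕ Fin m) (Fin m ⊕ Fin m) ℂ) :
    spProj m X = X + J (Fin m) ℂ * Xᵀ * J (Fin m) ℂ := rfl

theorem spProj_mul_J (X : Matrix (Fin m ⊕ Fin m) (Fin m ⊕ Fin m) ℂ) :
    J (Fin m) ℂ * (spProj m X)ᵀ = -(spProj m X * J (Fin m) ℂ) := by
  have hJ := J_squared (Fin m) ℂ
  have h1 : J (Fin m) ℂ * Xᵀ * J (Fin m) ℂ * J (Fin m) ℂ = - (J (Fin m) ℂ * Xᵀ) := by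
    rw [Matrix.mul_assoc, hJ]; simp
  have h2 : J (Fin m) ℂ * (J (Fin m) ℂ * (X * J (Fin m) ℂ)) = - (X * J (Fin m) ℂ) := by
    rw [← Matrix.mul_assoc, hJ]; simp
  simp only [spProj_apply, transpose_add, transpose_mul, transpose_transpose, J_transpose,
    Matrix.mul_add, Matrix.add_mul, h1]
  simp only [Matrix.neg_mul, Matrix.mul_neg, neg_neg, h2]
  abel

/-- A square-zero element of the Lie algebra exponentiates to an affine line, so invariance under
the group can be differentiated along a polynomial curve. -/
theorem one_add_spProj_mem {X : Matrix (Fin m ⊕ Fin m) (Fin m ⊕ Fin m) ℂ}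
    (h : spProj m X * spProj m X = 0) (s : ℂ) :
    1 + s • spProj m X ∈ Matrix.symplecticGroup (Fin m) ℂ := by
  rw [SymplecticGroup.mem_iff, transpose_add, transpose_smul, transpose_one, Matrix.mul_add,
    mul_one, Matrix.mul_smul, Matrix.add_mul, one_mul, Matrix.smul_mul]
  rw [Matrix.add_mul, spProj_mul_J, Matrix.smul_mul, Matrix.mul_assoc, spProj_mul_J,
    Matrix.mul_neg, ← Matrix.mul_assoc, h]
  simp

/-- Projection to the Lie algebra is equivariant. -/
theorem spProj_conj (g : Sp m) (X : Matrix (Fin m ⊕ Fin m) (Fin m ⊕ Fin m) ℂ) :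
    spProj m (g.1 * X * (g⁻¹).1) = g.1 * spProj m X * (g⁻¹).1 := by
  have hg := SymplecticGroup.mem_iff'.1 g.2
  have hg' := SymplecticGroup.mem_iff'.1 (g⁻¹).2
  have e1 : (g⁻¹).1 * g.1 = 1 := by rw [← Submonoid.coe_mul, inv_mul_cancel]; rfl
  have e2 : g.1 * (g⁻¹).1 = 1 := by rw [← Submonoid.coe_mul, mul_inv_cancel]; rfl
  have h1 : J (Fin m) ℂ * ((g⁻¹).1)ᵀ = g.1 * J (Fin m) ℂ := by
    have h3 := SymplecticGroup.mem_iff.1 (g⁻¹).2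
    rw [← h3, ← Matrix.mul_assoc, ← Matrix.mul_assoc, e2, one_mul, h3]
  have h2 : (g.1)ᵀ * J (Fin m) ℂ = J (Fin m) ℂ * (g⁻¹).1 := by
    rw [← hg, Matrix.mul_assoc _ g.1, e2, mul_one, hg]
  rw [spProj_apply, spProj_apply, Matrix.mul_add, Matrix.add_mul]
  congr 1
  rw [transpose_mul, transpose_mul]
  calc J (Fin m) ℂ * ((g⁻¹).1ᵀ * (Xᵀ * g.1ᵀ)) * J (Fin m) ℂ
      = (J (Fin m) ℂ * (g⁻¹).1ᵀ) * Xᵀ * (g.1ᵀ * J (Fin m) ℂ) := by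
        simp only [Matrix.mul_assoc]
    _ = _ := by rw [h1, h2]; simp only [Matrix.mul_assoc]

section Bilinear

variable {n M : Type*} [Fintype n] [DecidableEq n] [AddCommGroup M] [Module ℂ M]

omit [DecidableEq n] in
theorem mul_single_eq_sum [DecidableEq n] (g : Matrix n n ℂ) (a b : n) :
    g * single a b 1 = ∑ c, g c a • single c b 1 := by
  ext i j
  rw [Matrix.sum_apply, Finset.sum_eq_single i]
  · by_cases hj : b = j
    · subst hj; simp
    · simp [hj, Matrix.mul_apply]
  · intro c _ hc; simp [hc]
  · simp

theorem single_mul_eq_sum (g : Matrix n n ℂ) (a b : n) :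
    single a b 1 * g = ∑ c, g b c • single a c 1 := by
  ext i j
  rw [Matrix.sum_apply, Finset.sum_eq_single j]
  · by_cases hi : a = i
    · subst hi; simp
    · simp [hi, Matrix.mul_apply]
  · intro c _ hc; simp [hc]
  · simp

theorem sum_single_left (B : Matrix n n ℂ →ₗ[ℂ] Matrix n n ℂ →ₗ[ℂ] M) (g : Matrix n n ℂ) :
    ∑ a, ∑ b, B (g * single a b 1) (single b a 1) =
      ∑ a, ∑ b, B (single a b 1) (single b a 1 * g) := by
  simp only [mul_single_eq_sum, single_mul_eq_sum, map_sum, map_smul, LinearMap.sum_apply,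
    LinearMap.smul_apply]
  calc ∑ a, ∑ b, ∑ c, g c a • B (single c b 1) (single b a 1)
      = ∑ a, ∑ c, ∑ b, g c a • B (single c b 1) (single b a 1) :=
        Finset.sum_congr rfl fun a _ => Finset.sum_comm
    _ = ∑ c, ∑ a, ∑ b, g c a • B (single c b 1) (single b a 1) := Finset.sum_comm
    _ = _ := Finset.sum_congr rfl fun a _ => Finset.sum_comm

theorem sum_single_right (B : Matrix n n ℂ →ₗ[ℂ] Matrix n n ℂ →ₗ[ℂ] M) (g : Matrix n n ℂ) :
    ∑ a, ∑ b, B (single a b 1 * g) (single b a 1) =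
      ∑ a, ∑ b, B (single a b 1) (g * single b a 1) := by
  simp only [mul_single_eq_sum, single_mul_eq_sum, map_sum, map_smul, LinearMap.sum_apply,
    LinearMap.smul_apply]
  exact Finset.sum_congr rfl fun a _ => Finset.sum_comm

/-- The canonical element `∑ E_ab ⊗ E_ba` is invariant under conjugation. -/
theorem sum_single_conj (B : Matrix n n ℂ →ₗ[ℂ] Matrix n n ℂ →ₗ[ℂ] M) {g h : Matrix n n ℂ}
    (hgh : g * h = 1) :
    ∑ a, ∑ b, B (g * single a b 1 * h) (g * single b a 1 * h) =
      ∑ a, ∑ b, B (single a b 1) (single b a 1) := by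
  have h1 := sum_single_left (B.compl₁₂ (LinearMap.mulRight ℂ h)
    (LinearMap.mulLeft ℂ g ∘ₗ LinearMap.mulRight ℂ h)) g
  have h2 := sum_single_right (B.compl₁₂ LinearMap.id (LinearMap.mulLeft ℂ g)) h
  simp only [LinearMap.compl₁₂_apply, LinearMap.comp_apply, LinearMap.mulRight_apply,
    LinearMap.mulLeft_apply, LinearMap.id_apply] at h1 h2
  simp only [Matrix.mul_assoc, hgh, mul_one] at h1 h2 ⊢
  rw [h1, h2]
  simp only [← Matrix.mul_assoc, hgh, one_mul]

end Bilinear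

/-- The Casimir operator on a tensor power. -/
noncomputable def tensorCasimir (m : ℕ) (ι : Type*) [Fintype ι] [DecidableEq ι] :
    Matrix (ι → Fin m ⊕ Fin m) (ι → Fin m ⊕ Fin m) ℂ :=
  ∑ a, ∑ b, tensorDeriv ι (spProj m (single a b 1)) * tensorDeriv ι (spProj m (single b a 1))

variable {ι : Type*} [Fintype ι] [DecidableEq ι]

theorem tensorCasimir_mul_comm (g : Sp m) :
    tensorCasimir m ι * piKron (fun _ => g.1) = piKron (fun _ => g.1) * tensorCasimir m ι := by
  have e1 : (g⁻¹).1 * g.1 = 1 := by rw [← Submonoid.coe_mul, inv_mul_cancel]; rfl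
  have e2 : g.1 * (g⁻¹).1 = 1 := by rw [← Submonoid.coe_mul, mul_inv_cancel]; rfl
  let B := (LinearMap.mul ℂ (Matrix (ι → Fin m ⊕ Fin m) (ι → Fin m ⊕ Fin m) ℂ)).compl₁₂
    (tensorDeriv ι ∘ₗ spProj m) (tensorDeriv ι ∘ₗ spProj m)
  have hB : ∀ X Y, B X Y = tensorDeriv ι (spProj m X) * tensorDeriv ι (spProj m Y) :=
    fun X Y => rfl
  have hconj : ∀ X, piKron (fun _ => g.1) * tensorDeriv ι (spProj m X) =
      tensorDeriv ι (spProj m (g.1 * X * (g⁻¹).1)) * piKron (fun _ => g.1) := by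
    intro X
    apply piKron_mul_tensorDeriv
    rw [spProj_conj, Matrix.mul_assoc _ _ g.1, e1, mul_one]
  have h := sum_single_conj B e2
  simp only [hB] at h
  rw [tensorCasimir]
  conv_lhs => rw [← h]
  simp only [Finset.mul_sum, Finset.sum_mul]
  refine Finset.sum_congr rfl fun a _ => Finset.sum_congr rfl fun b _ => ?_
  rw [Matrix.mul_assoc, ← hconj, ← Matrix.mul_assoc, ← hconj, Matrix.mul_assoc]

end Casimir

/-! ### Root vectors of the symplectic Lie algebra. -/

section RootVectors

variable {m : ℕ}

/-- The sign of a basis vector with respect to the symplectic form. -/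
def spSign : Fin m ⊕ Fin m → ℂ := Sum.elim 1 (-1)

theorem spSign_mul_self (a : Fin m ⊕ Fin m) : spSign a * spSign a = 1 := by
  rcases a with i | i <;> simp [spSign]

theorem spSign_swap (a : Fin m ⊕ Fin m) : spSign a.swap = -spSign a := by
  rcases a with i | i <;> simp [spSign]

theorem J_apply (a b : Fin m ⊕ Fin m) :
    J (Fin m) ℂ a b = if a = b.swap then spSign b else 0 := by
  rcases a with i | i <;> rcases b with j | j <;> simp [J, spSign, Matrix.one_apply]
  split_ifs <;> simp

theorem swap_ne_self (a : Fin m ⊕ Fin m) : a.swap ≠ a := by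
  rcases a with i | i <;> simp

theorem eq_swap_iff {a b : Fin m ⊕ Fin m} : a = b.swap ↔ b = a.swap := by
  constructor <;> rintro rfl <;> simp

theorem spProj_single (a b : Fin m ⊕ Fin m) :
    spProj m (single a b 1) = single a b 1 - (spSign a * spSign b) • single b.swap a.swap 1 := by
  rw [spProj_apply, sub_eq_add_neg]
  congr 1
  ext i j
  rw [transpose_single, Matrix.mul_apply]
  rw [Finset.sum_eq_single a]
  · simp only [mul_single_apply_same, mul_one, J_apply, Matrix.neg_apply, Matrix.smul_apply,
      single_apply, smul_eq_mul]
    by_cases hi : i = b.swap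
    · by_cases hj : a = j.swap
      · have hj' : a.swap = j := (eq_swap_iff.1 hj).symm
        have hs : spSign j = -spSign a := by rw [← hj', spSign_swap]
        rw [if_pos hi, if_pos hj, if_pos ⟨hi.symm, hj'⟩, hs]
        ring
      · have hj' : ¬ (b.swap = i ∧ a.swap = j) := fun h => hj (eq_swap_iff.1 h.2.symm)
        rw [if_neg hj, if_neg hj']
        simp
    · have hi' : ¬ (b.swap = i ∧ a.swap = j) := fun h => hi h.1.symm
      rw [if_neg hi, if_neg hi']
      simp
  · intro c _ hc
    rw [mul_single_apply_of_ne (hbj := hc), zero_mul]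
  · simp

theorem spProj_single_sq {a b : Fin m ⊕ Fin m} (hab : a ≠ b) :
    spProj m (single a b 1) * spProj m (single a b 1) = 0 := by
  have hab' : a.swap ≠ b.swap := fun h => hab (by simpa using congrArg Sum.swap h)
  simp [spProj_single, Matrix.mul_sub, Matrix.sub_mul, hab.symm, hab', swap_ne_self,
    (swap_ne_self _).symm]

/-- The coordinates of a weight, extended antisymmetrically. -/
def signedWeight (μ : Fin m → ℤ) : Fin m ⊕ Fin m → ℤ := Sum.elim μ (-μ)

theorem signedWeight_sum {ι : Type*} (s : Finset ι) (μ : ι → Fin m → ℤ) (a : Fin m ⊕ Fin m) :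
    signedWeight (∑ l ∈ s, μ l) a = ∑ l ∈ s, signedWeight (μ l) a := by
  rcases a with i | i <;> simp [signedWeight]

theorem spProj_single_self (a : Fin m ⊕ Fin m) :
    spProj m (single a a 1) =
      diagonal fun c => (signedWeight (entryWeight c) a : ℂ) := by
  rw [spProj_single, spSign_mul_self, one_smul]
  ext i j
  by_cases hij : i = j
  · subst hij
    rcases a with k | k <;> rcases i with i | i <;>
      simp [signedWeight, entryWeight, single_apply, Pi.single_apply]
  · rw [diagonal_apply_ne _ hij]
    have h1 : ¬ (a = i ∧ a = j) := fun h => hij (h.1.symm.trans h.2)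
    have h2 : ¬ (a.swap = i ∧ a.swap = j) := fun h => hij (h.1.symm.trans h.2)
    simp [h1, h2]

/-- The normalisation of the coroot attached to a pair of indices. -/
def corootScale (a b : Fin m ⊕ Fin m) : ℂ := if b = a.swap then 2 else 1

theorem spProj_single_commutator {a b : Fin m ⊕ Fin m} (hab : a ≠ b) :
    spProj m (single a b 1) * spProj m (single b a 1) -
      spProj m (single b a 1) * spProj m (single a b 1) =
      corootScale a b • (spProj m (single a a 1) - spProj m (single b b 1)) := by
  have hab' : a.swap ≠ b.swap := fun h => hab (by simpa using congrArg Sum.swap h)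
  by_cases h : b = a.swap
  · subst h
    simp only [spProj_single, corootScale, if_true, spSign_swap, Sum.swap_swap, spSign_mul_self,
      mul_neg, neg_mul, neg_smul, one_smul, sub_neg_eq_add, neg_neg]
    simp only [Matrix.mul_add, Matrix.add_mul, single_mul_single_same, mul_one]
    module
  · have h' : a ≠ b.swap := fun e => h (eq_swap_iff.1 e)
    have hs := spSign_mul_self a
    have hs' := spSign_mul_self b
    simp only [spProj_single, corootScale, if_neg h, Matrix.mul_sub, Matrix.sub_mul,
      Matrix.smul_mul, Matrix.mul_smul, single_mul_single_same, mul_one, one_smul]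
    rw [single_mul_single_of_ne (h := h), single_mul_single_of_ne (h := h'),
      single_mul_single_of_ne (h := fun e => h e.symm),
      single_mul_single_of_ne (h := fun e => h' e.symm)]
    have e1 : spSign a * spSign b * (spSign b * spSign a) = 1 := by
      linear_combination (spSign b * spSign b) * hs + hs'
    have e2 : spSign b * spSign a * (spSign a * spSign b) = 1 := by
      linear_combination (spSign b * spSign b) * hs + hs'
    simp only [smul_smul, e1, e2, hs, hs', one_smul, smul_zero, sub_zero, zero_sub,
      smul_neg]
    abel

theorem torusEntry_swap (x : Fin m → ℂˣ) (a : Fin m ⊕ Fin m) :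
    torusEntry x a.swap = (torusEntry x a)⁻¹ := by
  rcases a with i | i <;> simp [torusEntry]

theorem spTorus_mul_spProj_single (x : Fin m → ℂˣ) (a b : Fin m ⊕ Fin m) :
    (spTorus x).1 * (torusEntry x b • spProj m (single a b 1)) =
      (torusEntry x a • spProj m (single a b 1)) * (spTorus x).1 := by
  rw [spTorus_coe, spProj_single]
  ext i j
  rw [diagonal_mul, mul_diagonal]
  simp only [Matrix.smul_apply, Matrix.sub_apply, single_apply, smul_eq_mul]
  have ha := torusEntry_ne_zero x a
  have hb := torusEntry_ne_zero x b
  by_cases h1 : a = i ∧ b = j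
  · obtain ⟨rfl, rfl⟩ := h1
    by_cases h2 : b.swap = a ∧ a.swap = b
    · rw [if_pos ⟨rfl, rfl⟩, if_pos h2]
      ring
    · rw [if_pos ⟨rfl, rfl⟩, if_neg h2]
      ring
  · by_cases h2 : b.swap = i ∧ a.swap = j
    · obtain ⟨rfl, rfl⟩ := h2
      rw [if_neg h1, if_pos ⟨rfl, rfl⟩, torusEntry_swap, torusEntry_swap]
      field_simp
    · rw [if_neg h1, if_neg h2]
      ring

end RootVectors

/-! ### The radial part of the Casimir operator. -/

section RadialPart

variable {m : ℕ} {ι : Type*} [Fintype ι] [DecidableEq ι]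

theorem tensorDeriv_spProj_single_self (a : Fin m ⊕ Fin m) :
    tensorDeriv ι (spProj m (single a a 1)) =
      diagonal fun j => (signedWeight (tensorWeight j) a : ℂ) := by
  rw [spProj_single_self, tensorDeriv_diagonal]
  congr 1
  ext j
  rw [tensorWeight, signedWeight_sum]
  push_cast
  rfl

/-- A matrix commuting with the torus preserves weights. -/
theorem apply_eq_zero_of_tensorWeight_ne
    {π : Matrix (ι → Fin m ⊕ Fin m) (ι → Fin m ⊕ Fin m) ℂ}
    (hπ : ∀ g : Sp m, piKron (fun _ => g.1) * π = π * piKron fun _ => g.1)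
    {j k : ι → Fin m ⊕ Fin m} (hjk : tensorWeight j ≠ tensorWeight k) : π j k = 0 := by
  obtain ⟨x, hx⟩ := exists_torusChar_ne hjk
  have h4 := congrFun (congrFun (hπ (spTorus x)) j) k
  rw [piKron_spTorus, diagonal_mul, mul_diagonal, mul_comm, ← sub_eq_zero, ← mul_sub] at h4
  exact (mul_eq_zero.1 h4).resolve_right (sub_ne_zero.2 hx)

/-- For a ≠ b the generator squares to zero, and commutation follows by differentiating its
one-parameter group at 0. For a = b it is diagonal in weights, which π preserves. -/
theorem tensorDeriv_spProj_mul_comm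
    {π : Matrix (ι → Fin m ⊕ Fin m) (ι → Fin m ⊕ Fin m) ℂ}
    (hπ : ∀ g : Sp m, piKron (fun _ => g.1) * π = π * piKron fun _ => g.1)
    (a b : Fin m ⊕ Fin m) :
    tensorDeriv ι (spProj m (single a b 1)) * π = π * tensorDeriv ι (spProj m (single a b 1)) := by
  by_cases hab : a = b
  · subst hab
    rw [tensorDeriv_spProj_single_self]
    ext j k
    rw [diagonal_mul, mul_diagonal]
    by_cases h : tensorWeight j = tensorWeight k
    · rw [h, mul_comm]
    · rw [apply_eq_zero_of_tensorWeight_ne hπ h, mul_zero, zero_mul]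
  · exact tensorDeriv_mul_comm fun s => hπ ⟨_, one_add_spProj_mem (spProj_single_sq hab) s⟩

theorem tensorCasimir_mul_comm_of_commute
    {π : Matrix (ι → Fin m ⊕ Fin m) (ι → Fin m ⊕ Fin m) ℂ}
    (hπ : ∀ g : Sp m, piKron (fun _ => g.1) * π = π * piKron fun _ => g.1) :
    tensorCasimir m ι * π = π * tensorCasimir m ι := by
  simp only [tensorCasimir, Finset.sum_mul, Finset.mul_sum]
  refine Finset.sum_congr rfl fun a _ => Finset.sum_congr rfl fun b _ => ?_
  rw [Matrix.mul_assoc, tensorDeriv_spProj_mul_comm hπ, ← Matrix.mul_assoc,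
    tensorDeriv_spProj_mul_comm hπ, Matrix.mul_assoc]

theorem trace_torus_diagonal (x : Fin m → ℂˣ)
    (π : Matrix (ι → Fin m ⊕ Fin m) (ι → Fin m ⊕ Fin m) ℂ) (d : (ι → Fin m ⊕ Fin m) → ℂ) :
    (piKron (fun _ => (spTorus x).1) * diagonal d * π).trace =
      ∑ j, π j j * (d j * torusChar x (tensorWeight j)) := by
  rw [piKron_spTorus, diagonal_mul_diagonal, Matrix.trace]
  refine Finset.sum_congr rfl fun j _ => ?_
  rw [diag_apply, diagonal_mul]
  ring

/-- The symbol of the Casimir operator on the torus. -/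
noncomputable def casimirSymbol (x : Fin m → ℂˣ) (μ : Fin m → ℤ) : ℂ :=
  ∑ a : Fin m ⊕ Fin m, ∑ b : Fin m ⊕ Fin m, if a = b then (signedWeight μ a : ℂ) ^ 2 else
    corootScale a b * (torusEntry x a / (torusEntry x a - torusEntry x b)) *
      (signedWeight μ a - signedWeight μ b)

/-- For root vectors E, F and a torus element t, cyclicity of the trace gives x_b tr(tEFπ) = x_a
tr(tFEπ), with x_a and x_b the entries of t. The two traces differ by tr(t[E, F]π), where [E, F] is
diagonal, so both are determined by the weights as soon as x_a ≠ x_b. -/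
theorem trace_casimir_term {π : Matrix (ι → Fin m ⊕ Fin m) (ι → Fin m ⊕ Fin m) ℂ}
    (hπ : ∀ g : Sp m, piKron (fun _ => g.1) * π = π * piKron fun _ => g.1) {x : Fin m → ℂˣ}
    (hx : Function.Injective (torusEntry x)) (a b : Fin m ⊕ Fin m) :
    (piKron (fun _ => (spTorus x).1) * (tensorDeriv ι (spProj m (single a b 1)) *
      tensorDeriv ι (spProj m (single b a 1))) * π).trace =
    ∑ j, π j j * ((if a = b then (signedWeight (tensorWeight j) a : ℂ) ^ 2 else
      corootScale a b * (torusEntry x a / (torusEntry x a - torusEntry x b)) *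
        (signedWeight (tensorWeight j) a - signedWeight (tensorWeight j) b)) *
      torusChar x (tensorWeight j)) := by
  by_cases hab : a = b
  · subst hab
    simp only [if_true]
    rw [tensorDeriv_spProj_single_self, diagonal_mul_diagonal, trace_torus_diagonal]
    simp only [sq]
  · simp only [if_neg hab]
    set t := piKron (fun _ : ι => (spTorus x).1) with ht
    set E := tensorDeriv ι (spProj m (single a b 1)) with hE
    set F := tensorDeriv ι (spProj m (single b a 1)) with hF
    have hEπ : E * π = π * E := tensorDeriv_spProj_mul_comm hπ a b
    have hne : torusEntry x a - torusEntry x b ≠ 0 := sub_ne_zero.2 fun h => hab (hx h)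
    have h1 : torusEntry x b • (t * E) = torusEntry x a • (E * t) := by
      have := piKron_mul_tensorDeriv (ι := ι) (spTorus_mul_spProj_single x a b)
      rwa [map_smul, map_smul, Matrix.mul_smul, Matrix.smul_mul] at this
    have h2 : torusEntry x b * (t * (E * F) * π).trace =
        torusEntry x a * (t * (F * E) * π).trace := by
      calc torusEntry x b * (t * (E * F) * π).trace
          = ((torusEntry x b • (t * E)) * (F * π)).trace := by
            rw [Matrix.smul_mul, Matrix.trace_smul, smul_eq_mul]
            simp only [Matrix.mul_assoc]
        _ = torusEntry x a * (E * (t * F * π)).trace := by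
            rw [h1, Matrix.smul_mul, Matrix.trace_smul, smul_eq_mul]
            simp only [Matrix.mul_assoc]
        _ = torusEntry x a * (t * F * π * E).trace := by rw [Matrix.trace_mul_comm]
        _ = _ := by rw [Matrix.mul_assoc _ π E, ← hEπ]; simp only [Matrix.mul_assoc]
    have h3 : E * F - F * E = corootScale a b •
        diagonal (fun j : ι → Fin m ⊕ Fin m => (signedWeight (tensorWeight j) a : ℂ) -
          signedWeight (tensorWeight j) b) := by
      rw [hE, hF, tensorDeriv_mul_sub, spProj_single_commutator hab, map_smul, map_sub,
        tensorDeriv_spProj_single_self, tensorDeriv_spProj_single_self, diagonal_sub]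
    have h4 : (t * (E * F) * π).trace - (t * (F * E) * π).trace = corootScale a b *
        ∑ j, π j j * (((signedWeight (tensorWeight j) a : ℂ) -
          signedWeight (tensorWeight j) b) * torusChar x (tensorWeight j)) := by
      rw [← Matrix.trace_sub, ← Matrix.sub_mul, ← Matrix.mul_sub, h3, Matrix.mul_smul,
        Matrix.smul_mul, Matrix.trace_smul, smul_eq_mul, trace_torus_diagonal]
    have h5 : (t * (E * F) * π).trace = torusEntry x a / (torusEntry x a - torusEntry x b) *
        (corootScale a b * ∑ j, π j j * (((signedWeight (tensorWeight j) a : ℂ) -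
          signedWeight (tensorWeight j) b) * torusChar x (tensorWeight j))) := by
      rw [← h4]
      field_simp
      linear_combination (-1 : ℂ) * h2
    rw [h5, Finset.mul_sum, Finset.mul_sum]
    refine Finset.sum_congr rfl fun j _ => ?_
    ring

theorem trace_casimir {π : Matrix (ι → Fin m ⊕ Fin m) (ι → Fin m ⊕ Fin m) ℂ}
    (hπ : ∀ g : Sp m, piKron (fun _ => g.1) * π = π * piKron fun _ => g.1) {x : Fin m → ℂˣ}
    (hx : Function.Injective (torusEntry x)) :
    (piKron (fun _ => (spTorus x).1) * tensorCasimir m ι * π).trace =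
      ∑ j, π j j * (casimirSymbol x (tensorWeight j) * torusChar x (tensorWeight j)) := by
  simp only [tensorCasimir, casimirSymbol, Finset.mul_sum, Finset.sum_mul, Matrix.trace_sum,
    trace_casimir_term hπ hx]
  rw [Finset.sum_comm (s := (Finset.univ : Finset (ι → Fin m ⊕ Fin m)))]
  refine Finset.sum_congr rfl fun a _ => ?_
  rw [Finset.sum_comm (s := (Finset.univ : Finset (ι → Fin m ⊕ Fin m)))]

/-- The symbol of the radial part of the Casimir operator in type `C`. -/
noncomputable def radialSymbol (x : Fin m → ℂˣ) (μ : Fin m → ℤ) : ℂ :=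
  ∑ i, ((μ i : ℂ) ^ 2 + 2 * ((x i : ℂ) + (x i : ℂ)⁻¹) / ((x i : ℂ) - (x i : ℂ)⁻¹) * μ i +
    ∑ j ∈ Finset.univ.erase i, 2 * ((x i : ℂ) - (x i : ℂ)⁻¹) /
      ((x i : ℂ) + (x i : ℂ)⁻¹ - ((x j : ℂ) + (x j : ℂ)⁻¹)) * μ i)

-- Off the diagonal F - A is antisymmetric and cancels in the double sum. This allows a pair term to
-- be replaced by any other with the same symmetrisation.
omit [Fintype ι] [DecidableEq ι] in
theorem sum_sum_eq_of_symm {n : Type*} [Fintype n] [DecidableEq n] (F A : n → n → ℂ)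
    (h : ∀ i j, i ≠ j → F i j + F j i = A i j + A j i) :
    ∑ i, ∑ j, F i j = ∑ i, (F i i + ∑ j ∈ Finset.univ.erase i, A i j) := by
  have key : ∀ G : n → n → ℂ, ∑ i, ∑ j, G i j = ∑ i, (G i i + ∑ j ∈ Finset.univ.erase i, G i j) :=
    fun G => Finset.sum_congr rfl fun i _ => (Finset.add_sum_erase _ _ (Finset.mem_univ i)).symm
  set D : n → n → ℂ := fun i j => F i j - (if i = j then F i j else A i j) with hD
  have hanti : ∀ i j, D j i = - D i j := by
    intro i j
    simp only [hD]
    by_cases hij : i = j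
    · subst hij; simp
    · rw [if_neg hij, if_neg (Ne.symm hij)]
      linear_combination h i j hij
  have hzero : ∑ i, ∑ j, D i j = 0 := by
    have h1 : ∑ i, ∑ j, D i j = -∑ i, ∑ j, D i j := by
      conv_lhs => rw [Finset.sum_comm]
      rw [← Finset.sum_neg_distrib]
      refine Finset.sum_congr rfl fun i _ => ?_
      rw [← Finset.sum_neg_distrib]
      exact Finset.sum_congr rfl fun j _ => hanti i j
    linear_combination h1 / 2
  have h2 : ∑ i, ∑ j, F i j = ∑ i, ∑ j, if i = j then F i j else A i j := by
    rw [← sub_eq_zero, ← hzero, ← Finset.sum_sub_distrib]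
    exact Finset.sum_congr rfl fun i _ => (Finset.sum_sub_distrib _ _).symm
  rw [h2, key]
  refine Finset.sum_congr rfl fun i _ => ?_
  rw [if_pos rfl]
  congr 1
  refine Finset.sum_congr rfl fun j hj => ?_
  rw [if_neg (Finset.ne_of_mem_erase hj).symm]

/-- The four sign choices for a pair of coordinates combine, after symmetrisation, into one fraction
in x_i + x_i⁻¹ and x_j + x_j⁻¹; the long roots supply the first-order term on the diagonal. -/
theorem casimirSymbol_eq {x : Fin m → ℂˣ} (hx : Function.Injective (torusEntry x))
    (μ : Fin m → ℤ) : casimirSymbol x μ = 2 * radialSymbol x μ := by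
  set S : Fin m ⊕ Fin m → Fin m ⊕ Fin m → ℂ := fun a b =>
    if a = b then (signedWeight μ a : ℂ) ^ 2 else
      corootScale a b * (torusEntry x a / (torusEntry x a - torusEntry x b)) *
        (signedWeight μ a - signedWeight μ b) with hS
  have hsplit : casimirSymbol x μ = ∑ i, ∑ j, (S (Sum.inl i) (Sum.inl j) +
      S (Sum.inl i) (Sum.inr j) + (S (Sum.inr i) (Sum.inl j) + S (Sum.inr i) (Sum.inr j))) := by
    simp only [casimirSymbol, Fintype.sum_sum_type, Finset.sum_add_distrib, hS]
    ring
  have hx0 : ∀ i, (x i : ℂ) ≠ 0 := fun i => (x i).ne_zero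
  have hii : ∀ i, (x i : ℂ) ^ 2 - 1 ≠ 0 := by
    intro i h0
    have : torusEntry x (Sum.inl i) = torusEntry x (Sum.inr i) := by
      simp only [torusEntry, Sum.elim_inl, Sum.elim_inr, Units.val_inv_eq_inv_val]
      refine eq_inv_of_mul_eq_one_left ?_
      linear_combination h0
    simpa using hx this
  have hij : ∀ i j, i ≠ j → (x i : ℂ) - x j ≠ 0 := by
    intro i j hne h0
    have : torusEntry x (Sum.inl i) = torusEntry x (Sum.inl j) := by
      simpa [torusEntry] using sub_eq_zero.1 h0
    exact hne (by simpa using hx this)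
  have hij' : ∀ i j, i ≠ j → (x i : ℂ) * x j - 1 ≠ 0 := by
    intro i j hne h0
    have : torusEntry x (Sum.inl i) = torusEntry x (Sum.inr j) := by
      simp only [torusEntry, Sum.elim_inl, Sum.elim_inr, Units.val_inv_eq_inv_val]
      refine eq_inv_of_mul_eq_one_left ?_
      linear_combination h0
    simpa using hx this
  rw [hsplit, sum_sum_eq_of_symm _ (fun i j => 4 * ((x i : ℂ) - (x i : ℂ)⁻¹) /
      ((x i : ℂ) + (x i : ℂ)⁻¹ - ((x j : ℂ) + (x j : ℂ)⁻¹)) * μ i), radialSymbol, Finset.mul_sum]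
  · refine Finset.sum_congr rfl fun i _ => ?_
    rw [mul_add, Finset.mul_sum]
    congr 1
    · have h1 := hii i
      have h2 := hx0 i
      have e1 : (x i : ℂ) - (x i : ℂ)⁻¹ = ((x i : ℂ) ^ 2 - 1) / x i := by field_simp
      have e2 : (x i : ℂ)⁻¹ - (x i : ℂ) = -(((x i : ℂ) ^ 2 - 1) / x i) := by field_simp; ring
      simp only [hS, if_true, reduceCtorEq, if_false, corootScale, Sum.swap_inl, Sum.swap_inr,
        torusEntry, signedWeight, Sum.elim_inl, Sum.elim_inr, Pi.neg_apply, Int.cast_neg,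
        Units.val_inv_eq_inv_val]
      rw [e1, e2]
      field_simp
      ring
    · refine Finset.sum_congr rfl fun j _ => ?_
      ring
  · intro i j hne
    have h1 := hij i j hne
    have h1' := hij j i hne.symm
    have h2 := hij' i j hne
    have h2' := hij' j i hne.symm
    have h3 := hx0 i
    have h4 := hx0 j
    have e1 : (x i : ℂ) + (x i : ℂ)⁻¹ - ((x j : ℂ) + (x j : ℂ)⁻¹) =
      ((x i : ℂ) - x j) * ((x i : ℂ) * x j - 1) / ((x i : ℂ) * x j) := by field_simp; ring
    have e2 : (x j : ℂ) + (x j : ℂ)⁻¹ - ((x i : ℂ) + (x i : ℂ)⁻¹) =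
      -(((x i : ℂ) - x j) * ((x i : ℂ) * x j - 1) / ((x i : ℂ) * x j)) := by field_simp; ring
    have e3 : (x i : ℂ) - (x j : ℂ)⁻¹ = ((x i : ℂ) * x j - 1) / x j := by field_simp
    have e4 : (x j : ℂ) - (x i : ℂ)⁻¹ = ((x i : ℂ) * x j - 1) / x i := by field_simp
    have e5 : (x i : ℂ)⁻¹ - x j = -(((x i : ℂ) * x j - 1) / x i) := by field_simp; ring
    have e6 : (x j : ℂ)⁻¹ - x i = -(((x i : ℂ) * x j - 1) / x j) := by field_simp; ring
    have e7 : (x i : ℂ)⁻¹ - (x j : ℂ)⁻¹ = -(((x i : ℂ) - x j) / (x i * x j)) := by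
      field_simp; ring
    have e8 : (x j : ℂ)⁻¹ - (x i : ℂ)⁻¹ = ((x i : ℂ) - x j) / (x i * x j) := by field_simp
    have e9 : (x j : ℂ) - x i = -((x i : ℂ) - x j) := by ring
    simp only [hS, Sum.inl.injEq, Sum.inr.injEq, hne, hne.symm, reduceCtorEq, if_false, corootScale,
      Sum.swap_inl, Sum.swap_inr, torusEntry, signedWeight, Sum.elim_inl, Sum.elim_inr,
      Pi.neg_apply, Int.cast_neg, Units.val_inv_eq_inv_val]
    rw [e1, e2, e3, e4, e5, e6, e7, e8, e9]
    field_simp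
    ring

end RadialPart

/-! ### Radial eigenfunctions and their eigenvalues. -/

section RadialEigen

variable {m : ℕ}

/-- Evaluation of a Laurent polynomial, given by its coefficients, on the torus. -/
noncomputable def laurentEval (x : Fin m → ℂˣ) : ((Fin m → ℤ) →₀ ℂ) →ₗ[ℂ] ℂ :=
  Finsupp.linearCombination ℂ (torusChar x)

/-- The radial part of the Casimir operator applied to a Laurent polynomial. -/
noncomputable def laurentRadial (x : Fin m → ℂˣ) : ((Fin m → ℤ) →₀ ℂ) →ₗ[ℂ] ℂ :=
  Finsupp.linearCombination ℂ fun μ => radialSymbol x μ * torusChar x μ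

/-- `f` is an eigenfunction of the radial part of the Casimir operator. -/
def IsRadialEigen (f : (Fin m → ℤ) →₀ ℂ) (c : ℂ) : Prop :=
  ∀ x : Fin m → ℂˣ, Function.Injective (torusEntry x) → laurentRadial x f = c * laurentEval x f

/-- A weight of the `k`-th exterior power of the natural representation. -/
def IsSmallWeight (k : ℕ) (a : Fin m → ℤ) : Prop := (∀ i, |a i| ≤ 1) ∧ ∑ i, |a i| ≤ k

theorem isSmallWeight_of_injective {k : ℕ} {j : Fin k → Fin m ⊕ Fin m}
    (hj : Function.Injective j) : IsSmallWeight k (∑ l, entryWeight (j l)) := by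
  classical
  have hsum : ∑ l, entryWeight (j l) = ∑ a ∈ Finset.univ.image j, entryWeight a := by
    rw [Finset.sum_image fun _ _ _ _ h => hj h]
  have hval : ∀ i, (∑ l, entryWeight (j l)) i =
      (if Sum.inl i ∈ Finset.univ.image j then 1 else 0) -
      (if Sum.inr i ∈ Finset.univ.image j then 1 else 0) := by
    intro i
    rw [hsum, Finset.sum_apply, ← Finset.sum_filter_add_sum_filter_not _ (fun a => a.isLeft)]
    have h1 : ∀ s : Finset (Fin m ⊕ Fin m), ∑ a ∈ s, entryWeight a i =
        (if Sum.inl i ∈ s then 1 else 0) - (if Sum.inr i ∈ s then 1 else 0) := by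
      intro s
      have h2 : ∀ a : Fin m ⊕ Fin m, entryWeight a i =
          (if Sum.inl i = a then 1 else 0) - (if Sum.inr i = a then 1 else 0) := by
        rintro (b | b) <;> simp [entryWeight, Pi.single_apply]
      simp only [h2, Finset.sum_sub_distrib, Finset.sum_ite_eq]
    rw [Finset.sum_filter_add_sum_filter_not, h1]
  refine ⟨fun i => ?_, ?_⟩
  · rw [hval]
    split_ifs <;> simp
  · have hle : ∀ i, |(∑ l, entryWeight (j l)) i| ≤
        (if Sum.inl i ∈ Finset.univ.image j then 1 else 0) +
        (if Sum.inr i ∈ Finset.univ.image j then 1 else 0) := by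
      intro i
      rw [hval]
      split_ifs <;> simp
    calc ∑ i, |(∑ l, entryWeight (j l)) i| ≤
        ∑ i, ((if Sum.inl i ∈ Finset.univ.image j then (1 : ℤ) else 0) +
          (if Sum.inr i ∈ Finset.univ.image j then 1 else 0)) := Finset.sum_le_sum fun i _ => hle i
      _ = ∑ a : Fin m ⊕ Fin m, if a ∈ Finset.univ.image j then (1 : ℤ) else 0 := by
        rw [Finset.sum_add_distrib, Fintype.sum_sum_type]
      _ = k := by
        rw [Finset.sum_ite_mem, Finset.univ_inter, Finset.sum_const,
          Finset.card_image_of_injective _ hj]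
        simp

/-- The character of the irreducible representation of highest weight `(2^q, 1^(p-q))` is a Laurent
polynomial eigenfunction of the radial Casimir operator. -/
theorem exists_laurent_irrCharSp {p q : ℕ} (hp : p ≤ m) (hqp : q ≤ p) :
    ∃ (f : (Fin m → ℤ) →₀ ℂ) (c : ℂ),
      (∀ x, irrCharSp m (twoOnePartition m q (p - q)) (spTorus x) = laurentEval x f) ∧
      IsRadialEigen f c ∧ f (fun i => (twoOnePartition m q (p - q) i : ℤ)) = 1 ∧
      ∀ μ ∈ f.support, ∃ a b, IsSmallWeight p a ∧ IsSmallWeight q b ∧ μ = a + b := by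
  obtain ⟨π, h1, h2, h3, h4, h5⟩ := exists_twoColumn_projection hp hqp
  -- Schur's lemma: the Casimir operator is a scalar c on the irreducible summand. The radial
  -- eigenvalue is c / 2, since the Casimir symbol is twice the radial one.
  obtain ⟨c, hc⟩ := h5 (tensorCasimir m _) tensorCasimir_mul_comm
    (tensorCasimir_mul_comm_of_commute h1)
  set f : (Fin m → ℤ) →₀ ℂ := ∑ j, Finsupp.single (tensorWeight j) (π j j) with hf
  have hev : ∀ x, laurentEval x f = ∑ j, π j j * torusChar x (tensorWeight j) := by
    intro x
    simp [hf, laurentEval, map_sum, Finsupp.linearCombination_single]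
  have hrad : ∀ x, laurentRadial x f =
      ∑ j, π j j * (radialSymbol x (tensorWeight j) * torusChar x (tensorWeight j)) := by
    intro x
    simp [hf, laurentRadial, map_sum, Finsupp.linearCombination_single]
  have htr : ∀ x : Fin m → ℂˣ, (piKron (fun _ => (spTorus x).1) * π).trace = laurentEval x f := by
    intro x
    rw [hev]
    have := trace_torus_diagonal x π (fun _ => 1)
    rw [diagonal_one, mul_one] at this
    simpa using this
  refine ⟨f, c / 2, fun x => ?_, fun x hx => ?_, ?_, fun μ hμ => ?_⟩
  · rw [h2, htr]
  · have e1 := trace_casimir h1 hx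
    rw [Matrix.mul_assoc, hc, Matrix.mul_smul, Matrix.trace_smul, htr, smul_eq_mul] at e1
    have e2 : ∑ j, π j j * (casimirSymbol x (tensorWeight j) * torusChar x (tensorWeight j)) =
        2 * laurentRadial x f := by
      rw [hrad, Finset.mul_sum]
      refine Finset.sum_congr rfl fun j _ => ?_
      rw [casimirSymbol_eq hx]
      ring
    rw [e2] at e1
    linear_combination -e1 / 2
  · rw [← h4, hf, Finsupp.finsetSum_apply]
    refine Finset.sum_congr rfl fun j _ => ?_
    rw [Finsupp.single_apply]
  · have hex : ∃ j, π j j ≠ 0 ∧ tensorWeight j = μ := by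
      by_contra hno
      push Not at hno
      rw [Finsupp.mem_support_iff] at hμ
      apply hμ
      rw [hf, Finsupp.finsetSum_apply]
      refine Finset.sum_eq_zero fun j _ => ?_
      rw [Finsupp.single_apply]
      split_ifs with h
      · by_contra h0
        exact hno j h0 h
      · rfl
    obtain ⟨j, hj, rfl⟩ := hex
    obtain ⟨hj1, hj2⟩ := h3 j hj
    refine ⟨_, _, isSmallWeight_of_injective hj1, isSmallWeight_of_injective hj2, ?_⟩
    rw [tensorWeight, Fintype.sum_sum_type]

/-- The eigenvalue of the Casimir operator attached to a highest weight. -/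
def casimirValue (μ : Fin m → ℤ) : ℤ := ∑ i, (μ i ^ 2 + 2 * ((m : ℤ) - i) * μ i)

/-- The one-parameter subgroup of the torus with exponents `w`. -/
noncomputable def expTorus (w : Fin m → ℤ) (r : ℝ) (i : Fin m) : ℂˣ :=
  Units.mk0 (Complex.exp ((r * w i : ℝ) : ℂ)) (Complex.exp_ne_zero _)

theorem torusEntry_expTorus (w : Fin m → ℤ) (r : ℝ) (a : Fin m ⊕ Fin m) :
    torusEntry (expTorus w r) a = Complex.exp ((r * signedWeight w a : ℝ) : ℂ) := by
  rcases a with i | i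
  · simp [torusEntry, expTorus, signedWeight]
  · simp only [torusEntry, expTorus, signedWeight, Sum.elim_inr, Units.val_inv_eq_inv_val,
      Units.val_mk0, ← Complex.exp_neg]
    congr 1
    push_cast
    simp

theorem torusEntry_expTorus_injective {w : Fin m → ℤ} (hpos : ∀ i, 0 < w i)
    (hanti : StrictAnti w) {r : ℝ} (hr : 0 < r) :
    Function.Injective (torusEntry (expTorus w r)) := by
  intro a b hab
  rw [torusEntry_expTorus, torusEntry_expTorus, ← Complex.ofReal_exp, ← Complex.ofReal_exp,
    Complex.ofReal_inj, Real.exp_eq_exp] at hab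
  have h : signedWeight w a = signedWeight w b := by
    have := mul_left_cancel₀ hr.ne' hab
    exact_mod_cast this
  rcases a with i | i <;> rcases b with j | j <;>
    simp only [signedWeight, Sum.elim_inl, Sum.elim_inr, Pi.neg_apply, neg_inj] at h
  · rw [hanti.injective h]
  · have := hpos i; have := hpos j; omega
  · have := hpos i; have := hpos j; omega
  · rw [hanti.injective h]

theorem torusChar_expTorus (w μ : Fin m → ℤ) (r : ℝ) :
    torusChar (expTorus w r) μ = Complex.exp ((r * (∑ i, w i * μ i : ℤ) : ℝ) : ℂ) := by
  simp only [torusChar, expTorus, Units.val_mk0, ← Complex.exp_int_mul, ← Complex.exp_sum]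
  congr 1
  push_cast
  rw [Finset.mul_sum]
  refine Finset.sum_congr rfl fun i _ => ?_
  ring

theorem tendsto_exp_mul_neg {k : ℤ} (hk : k < 0) :
    Tendsto (fun r : ℝ => Complex.exp ((r * k : ℝ) : ℂ)) atTop (𝓝 0) := by
  have hk' : (k : ℝ) < 0 := by exact_mod_cast hk
  have h1 : Tendsto (fun r : ℝ => Real.exp (r * k)) atTop (𝓝 0) :=
    Real.tendsto_exp_atBot.comp (tendsto_id.atTop_mul_const_of_neg hk')
  have h2 := (Complex.continuous_ofReal.tendsto 0).comp h1
  rw [Complex.ofReal_zero] at h2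
  exact h2.congr fun r => by rw [Function.comp_apply, Complex.ofReal_exp]

theorem tendsto_long_root {k : ℤ} (hk : 0 < k) :
    Tendsto (fun r : ℝ => 2 * (Complex.exp ((r * k : ℝ) : ℂ) + (Complex.exp ((r * k : ℝ) : ℂ))⁻¹) /
      (Complex.exp ((r * k : ℝ) : ℂ) - (Complex.exp ((r * k : ℝ) : ℂ))⁻¹)) atTop (𝓝 2) := by
  have h := tendsto_exp_mul_neg (k := -2 * k) (by omega)
  have h1 : Tendsto (fun r : ℝ => 2 * (1 + Complex.exp ((r * (-2 * k : ℤ) : ℝ) : ℂ)) /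
      (1 - Complex.exp ((r * (-2 * k : ℤ) : ℝ) : ℂ))) atTop (𝓝 (2 * (1 + 0) / (1 - 0))) :=
    ((tendsto_const_nhds.add h).const_mul 2).div (tendsto_const_nhds.sub h) (by simp)
  have e : (2 * (1 + 0) / (1 - 0) : ℂ) = 2 := by norm_num
  rw [e] at h1
  refine h1.congr fun r => ?_
  have hy : Complex.exp ((r * (-2 * k : ℤ) : ℝ) : ℂ) =
      (Complex.exp ((r * k : ℝ) : ℂ))⁻¹ * (Complex.exp ((r * k : ℝ) : ℂ))⁻¹ := by
    rw [← Complex.exp_neg, ← Complex.exp_add]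
    congr 1
    push_cast
    ring
  rw [hy]
  have hy0 := Complex.exp_ne_zero ((r * k : ℝ) : ℂ)
  set y := Complex.exp ((r * k : ℝ) : ℂ)
  rw [← mul_div_mul_left _ _ hy0]
  congr 1 <;> field_simp

theorem tendsto_short_root {k l : ℤ} (hk : 0 < k) (hl : 0 < l) (hkl : k ≠ l) :
    Tendsto (fun r : ℝ => 2 * (Complex.exp ((r * k : ℝ) : ℂ) - (Complex.exp ((r * k : ℝ) : ℂ))⁻¹) /
      (Complex.exp ((r * k : ℝ) : ℂ) + (Complex.exp ((r * k : ℝ) : ℂ))⁻¹ -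
        (Complex.exp ((r * l : ℝ) : ℂ) + (Complex.exp ((r * l : ℝ) : ℂ))⁻¹))) atTop
      (𝓝 (if l < k then 2 else 0)) := by
  have hk0 := fun r : ℝ => Complex.exp_ne_zero ((r * k : ℝ) : ℂ)
  have hl0 := fun r : ℝ => Complex.exp_ne_zero ((r * l : ℝ) : ℂ)
  have hprod : ∀ (r : ℝ) (a b : ℤ), Complex.exp ((r * (a + b : ℤ) : ℝ) : ℂ) =
      Complex.exp ((r * a : ℝ) : ℂ) * Complex.exp ((r * b : ℝ) : ℂ) := by
    intro r a b
    rw [← Complex.exp_add]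
    congr 1
    push_cast
    ring
  have hinv : ∀ (r : ℝ) (a : ℤ), Complex.exp ((r * (-a : ℤ) : ℝ) : ℂ) =
      (Complex.exp ((r * a : ℝ) : ℂ))⁻¹ := by
    intro r a
    rw [← Complex.exp_neg]
    congr 1
    push_cast
    ring
  rcases lt_or_gt_of_ne hkl with hlt | hlt
  · rw [if_neg (not_lt.2 hlt.le)]
    have t1 := tendsto_exp_mul_neg (k := k + -l) (by omega)
    have t2 := tendsto_exp_mul_neg (k := -k + -l) (by omega)
    have t3 := tendsto_exp_mul_neg (k := -l + -l) (by omega)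
    have h1 := ((t1.sub t2).const_mul 2).div
      ((t1.add t2).sub (t3.const_add 1)) (by norm_num)
    have e : (2 * (0 - 0) / (0 + 0 - (1 + 0)) : ℂ) = 0 := by norm_num
    rw [e] at h1
    refine h1.congr fun r => ?_
    have hk1 := hk0 r
    have hl1 := hl0 r
    simp only [hprod, hinv, Pi.div_apply]
    rw [← mul_div_mul_left _ _ hl1]
    set a := Complex.exp ((r * k : ℝ) : ℂ)
    set b := Complex.exp ((r * l : ℝ) : ℂ)
    congr 1 <;> field_simp
  · rw [if_pos hlt]
    have t1 := tendsto_exp_mul_neg (k := -k + -k) (by omega)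
    have t2 := tendsto_exp_mul_neg (k := l + -k) (by omega)
    have t3 := tendsto_exp_mul_neg (k := -l + -k) (by omega)
    have h1 := ((t1.const_sub 1).const_mul 2).div
      ((t1.const_add 1).sub (t2.add t3)) (by norm_num)
    have e : (2 * (1 - 0) / (1 + 0 - (0 + 0)) : ℂ) = 2 := by norm_num
    rw [e] at h1
    refine h1.congr fun r => ?_
    have hk1 := hk0 r
    have hl1 := hl0 r
    simp only [hprod, hinv, Pi.div_apply]
    rw [← mul_div_mul_left _ _ hk1]
    set a := Complex.exp ((r * k : ℝ) : ℂ)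
    set b := Complex.exp ((r * l : ℝ) : ℂ)
    congr 1 <;> field_simp

theorem tendsto_radialSymbol {w : Fin m → ℤ} (hpos : ∀ i, 0 < w i) (hanti : StrictAnti w)
    (μ : Fin m → ℤ) :
    Tendsto (fun r => radialSymbol (expTorus w r) μ) atTop (𝓝 (casimirValue μ : ℂ)) := by
  have hval : (casimirValue μ : ℂ) = ∑ i, ((μ i : ℂ) ^ 2 + 2 * μ i +
      ∑ j ∈ Finset.univ.erase i, (if w j < w i then (2 : ℂ) else 0) * μ i) := by
    rw [casimirValue]
    push_cast
    refine Finset.sum_congr rfl fun i _ => ?_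
    -- Only the m - 1 - i later indices contribute. With the 2 from the long root this gives 2(m -
    -- i), twice the i-th coordinate of the half-sum of positive roots.
    have hcard : ∑ j ∈ Finset.univ.erase i, (if w j < w i then (2 : ℂ) else 0) =
        2 * ((m : ℂ) - 1 - i) := by
      have hfil : (Finset.univ.erase i).filter (fun j => w j < w i) = Finset.Ioi i := by
        ext j
        simp only [Finset.mem_filter, Finset.mem_erase, Finset.mem_univ, and_true,
          Finset.mem_Ioi, hanti.lt_iff_gt]
        exact ⟨fun h => h.2, fun h => ⟨h.ne', h⟩⟩
      rw [← Finset.sum_filter, hfil, Finset.sum_const, Fin.card_Ioi, nsmul_eq_mul]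
      have := i.2
      have hcast : ((m - 1 - (i : ℕ) : ℕ) : ℂ) = (m : ℂ) - 1 - i := by
        rw [Nat.cast_sub (by omega), Nat.cast_sub (by omega)]
        simp
      rw [hcast]
      ring
    rw [← Finset.sum_mul, hcard]
    ring
  rw [hval]
  simp only [radialSymbol]
  refine tendsto_finsetSum _ fun i _ => ?_
  refine Tendsto.add (Tendsto.add tendsto_const_nhds ?_) (tendsto_finsetSum _ fun j hj => ?_)
  · exact (tendsto_long_root (hpos i)).mul_const _
  · refine (tendsto_short_root (hpos i) (hpos j) fun h => ?_).mul_const _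
    exact Finset.ne_of_mem_erase hj (hanti.injective h).symm

/-- The eigenvalue of a radial eigenfunction is determined by its leading exponent. -/
theorem IsRadialEigen.eq_casimirValue {f : (Fin m → ℤ) →₀ ℂ} {c : ℂ} (hf : IsRadialEigen f c)
    {w : Fin m → ℤ} (hpos : ∀ i, 0 < w i) (hanti : StrictAnti w) {μ₀ : Fin m → ℤ}
    (hμ₀ : f μ₀ ≠ 0)
    (htop : ∀ μ ∈ f.support, μ ≠ μ₀ → ∑ i, w i * μ i < ∑ i, w i * μ₀ i) :
    c = casimirValue μ₀ := by
  -- After division by the leading exponential all other exponents decay, and the eigenvalue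
  -- equation reduces in the limit to its leading term.
  have hlim : Tendsto (fun r : ℝ => ∑ μ ∈ f.support, f μ *
      ((radialSymbol (expTorus w r) μ - c) *
        Complex.exp ((r * ((∑ i, w i * μ i) - ∑ i, w i * μ₀ i : ℤ) : ℝ) : ℂ))) atTop
      (𝓝 (∑ μ ∈ f.support, f μ * ((casimirValue μ - c) * if μ = μ₀ then 1 else 0))) := by
    refine tendsto_finsetSum _ fun μ hμ => Tendsto.const_mul _ ?_
    refine ((tendsto_radialSymbol hpos hanti μ).sub_const c).mul ?_
    split_ifs with h
    · subst h; simp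
    · exact tendsto_exp_mul_neg (by have := htop μ hμ h; omega)
  have hzero : ∀ᶠ r : ℝ in atTop, ∑ μ ∈ f.support, f μ *
      ((radialSymbol (expTorus w r) μ - c) *
        Complex.exp ((r * ((∑ i, w i * μ i) - ∑ i, w i * μ₀ i : ℤ) : ℝ) : ℂ)) = 0 := by
    filter_upwards [eventually_gt_atTop (0 : ℝ)] with r hr
    have h1 := hf _ (torusEntry_expTorus_injective hpos hanti hr)
    rw [laurentRadial, laurentEval, Finsupp.linearCombination_apply,
      Finsupp.linearCombination_apply, Finsupp.sum, Finsupp.sum, Finset.mul_sum, ← sub_eq_zero,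
      ← Finset.sum_sub_distrib] at h1
    have h2 := congrArg (fun z => z * Complex.exp (-((r * (∑ i, w i * μ₀ i : ℤ) : ℝ) : ℂ))) h1
    simp only [zero_mul, Finset.sum_mul] at h2
    rw [← h2]
    refine Finset.sum_congr rfl fun μ _ => ?_
    have he : Complex.exp ((r * ((∑ i, w i * μ i) - ∑ i, w i * μ₀ i : ℤ) : ℝ) : ℂ) =
        torusChar (expTorus w r) μ * Complex.exp (-((r * (∑ i, w i * μ₀ i : ℤ) : ℝ) : ℂ)) := by
      rw [torusChar_expTorus, ← Complex.exp_add]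
      congr 1
      push_cast
      ring
    rw [he, smul_eq_mul, smul_eq_mul]
    ring
  have h0 := tendsto_nhds_unique (hlim.congr' hzero) tendsto_const_nhds
  rw [Finset.sum_eq_single μ₀] at h0
  · rw [if_pos rfl, mul_one] at h0
    have := (mul_eq_zero.1 h0).resolve_left hμ₀
    linear_combination -this
  · intro μ _ hne
    rw [if_neg hne, mul_zero, mul_zero]
  · intro h
    exact absurd (Finsupp.mem_support_iff.2 hμ₀) h

end RadialEigen

/-! ### Sums over independent choices. -/

section ProductExpectation

variable {ι S : Type*} [Fintype ι] [DecidableEq ι] [Fintype S]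

/-- Here and in the next two lemmas v i acts as an unnormalised product measure of mass F i. Moments
at distinct sites multiply, and keeping the factor F avoids any division. -/
theorem sum_prod_eq {v : ι → S → ℂ} {F : ι → ℂ} (hF : ∀ i, ∑ a, v i a = F i) :
    ∑ σ : ι → S, ∏ i, v i (σ i) = ∏ i, F i := by
  rw [← Fintype.piFinset_univ, ← Finset.prod_univ_sum]
  simp only [hF]

theorem sum_prod_mul_eq {v : ι → S → ℂ} {F : ι → ℂ} (hF : ∀ i, ∑ a, v i a = F i) {g : S → ℂ}
    {e : ℂ} {k : ι} (hg : ∑ a, v k a * g a = F k * e) :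
    ∑ σ : ι → S, (∏ i, v i (σ i)) * g (σ k) = (∏ i, F i) * e := by
  have h := sum_prod_eq (v := fun i a => v i a * if i = k then g a else 1)
    (F := fun i => F i * if i = k then e else 1) (fun i => by
      by_cases h : i = k
      · subst h; simpa using hg
      · simpa [h] using hF i)
  simp only [Finset.prod_mul_distrib, Finset.prod_ite_eq', Finset.mem_univ, if_true] at h
  exact h

theorem sum_prod_mul_mul_eq {v : ι → S → ℂ} {F : ι → ℂ} (hF : ∀ i, ∑ a, v i a = F i)
    {g g' : S → ℂ} {e f : ℂ} {k l : ι} (hkl : k ≠ l) (hg : ∑ a, v k a * g a = F k * e)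
    (hh : ∑ a, v l a * g' a = F l * f) :
    ∑ σ : ι → S, (∏ i, v i (σ i)) * (g (σ k) * g' (σ l)) = (∏ i, F i) * (e * f) := by
  have h := sum_prod_eq
    (v := fun i a => v i a * ((if i = k then g a else 1) * (if i = l then g' a else 1)))
    (F := fun i => F i * ((if i = k then e else 1) * (if i = l then f else 1))) (fun i => by
      by_cases h : i = k
      · subst h; simpa [hkl] using hg
      · by_cases h' : i = l
        · subst h'; simpa [h] using hh
        · simpa [h, h'] using hF i)
  simp only [Finset.prod_mul_distrib, Finset.prod_ite_eq', Finset.mem_univ, if_true] at h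
  exact h

end ProductExpectation

/-- A Laurent polynomial vanishing off a finite set has zero coefficients: a large power of t makes
it a polynomial with infinitely many roots. The exceptional set F leaves room for poles. -/
theorem sum_coeff_eq_zero {ι : Type*} [Fintype ι] (a : ι → ℤ) (C : ι → ℂ) (F : Finset ℂ)
    (h : ∀ t : ℂ, t ≠ 0 → t ∉ F → ∑ q, C q * t ^ a q = 0) (A : ℤ) :
    ∑ q, (if a q = A then C q else 0) = 0 := by
  obtain ⟨N, hN⟩ : ∃ N : ℕ, ∀ q, 0 ≤ a q + N := by
    refine ⟨∑ q, (a q).natAbs, fun q => ?_⟩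
    have := Finset.single_le_sum (f := fun q => (a q).natAbs) (fun _ _ => Nat.zero_le _)
      (Finset.mem_univ q)
    have h2 : (a q).natAbs ≤ ∑ q, (a q).natAbs := this
    omega
  set P : Polynomial ℂ := ∑ q, Polynomial.C (C q) * Polynomial.X ^ (a q + N).toNat with hP
  have hP0 : P = 0 := by
    refine Polynomial.eq_zero_of_infinite_isRoot _ ?_
    refine Set.Infinite.mono ?_ (Set.Finite.infinite_compl (insert 0 F).finite_toSet)
    intro t ht
    simp only [Finset.coe_insert, Set.mem_compl_iff, Set.mem_insert_iff, Finset.mem_coe,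
      not_or] at ht
    have h1 := h t ht.1 ht.2
    rw [Set.mem_ofPred_eq, Polynomial.IsRoot.def, hP, Polynomial.eval_finsetSum]
    have h2 : ∀ q, Polynomial.eval t (Polynomial.C (C q) * Polynomial.X ^ (a q + N).toNat) =
        C q * t ^ a q * t ^ (N : ℤ) := by
      intro q
      rw [Polynomial.eval_mul, Polynomial.eval_C, Polynomial.eval_pow, Polynomial.eval_X,
        ← zpow_natCast, Int.toNat_of_nonneg (hN q), zpow_add₀ ht.1, mul_assoc]
    simp only [h2, ← Finset.sum_mul, h1, zero_mul]
  by_cases hA : 0 ≤ A + N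
  · have h3 := congrArg (fun Q => Polynomial.coeff Q (A + N).toNat) hP0
    simp only [hP, Polynomial.finsetSum_coeff, Polynomial.coeff_C_mul, Polynomial.coeff_X_pow,
      Polynomial.coeff_zero] at h3
    refine Eq.trans (Finset.sum_congr rfl fun q _ => ?_) h3
    have := hN q
    by_cases hq : a q = A
    · subst hq; simp
    · rw [if_neg hq, if_neg (by omega), mul_zero]
  · refine Finset.sum_eq_zero fun q _ => if_neg ?_
    have := hN q
    omega

theorem zpow_sum_eq_prod {ι : Type*} [Fintype ι] {t : ℂ} (ht : t ≠ 0) (f : ι → ℤ) :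
    t ^ (∑ i, f i) = ∏ i, t ^ f i := by
  classical
  induction (Finset.univ : Finset ι) using Finset.induction_on with
  | empty => simp
  | insert a s ha ih => rw [Finset.sum_insert ha, Finset.prod_insert ha, zpow_add₀ ht, ih]

/-! ### The two-column generating function, one site at a time. -/

section Determinant

variable {m : ℕ}

/-- The degree in the auxiliary variable of the monomials of `t + t⁻¹ + x + x⁻¹`. -/
def auxDegree : Fin 4 → ℤ := ![1, -1, 0, 0]

/-- The exponent of `x` in the monomials of `t + t⁻¹ + x + x⁻¹`. -/
def auxWeight : Fin 4 → ℤ := ![0, 0, 1, -1]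

/-- The degree in the first auxiliary variable of the alternating sum over the Weyl group of
`Sp(4)`. -/
def altFst : Fin 8 → ℤ := ![1, 1, -1, -1, 2, 2, -2, -2]

/-- The degree in the second auxiliary variable of the alternating sum over the Weyl group of
`Sp(4)`. -/
def altSnd : Fin 8 → ℤ := ![2, -2, 2, -2, 1, -1, 1, -1]

/-- The signs of the alternating sum over the Weyl group of `Sp(4)`. -/
def altSign : Fin 8 → ℤ := ![1, -1, -1, 1, -1, 1, 1, -1]

/-- The exponent attached to a pair of families of monomials. -/
def pairWeight (σ : Fin m → Fin 4 × Fin 4) (i : Fin m) : ℤ :=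
  auxWeight (σ i).1 + auxWeight (σ i).2

def fstDegree (σ : Fin m → Fin 4 × Fin 4) : ℤ := ∑ i, auxDegree (σ i).1

def sndDegree (σ : Fin m → Fin 4 × Fin 4) : ℤ := ∑ i, auxDegree (σ i).2

/-- The coefficient of `t ^ (r + 1) * u ^ (s + 2)` in the alternant of `Sp(4)` multiplied by
`∏ i, (x i + (x i)⁻¹ + t + t⁻¹) * (x i + (x i)⁻¹ + u + u⁻¹)`. -/
noncomputable def twoColumnDet (m : ℕ) (r s : ℤ) : (Fin m → ℤ) →₀ ℂ :=
  ∑ q : Fin 8 × (Fin m → Fin 4 × Fin 4),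
    if altFst q.1 + fstDegree q.2 = r + 1 ∧ altSnd q.1 + sndDegree q.2 = s + 2 then
      Finsupp.single (pairWeight q.2) (altSign q.1 : ℂ) else 0

/-- The local weight of the generating function. -/
noncomputable def localWeight (x t u : ℂ) (a : Fin 4 × Fin 4) : ℂ :=
  x ^ auxWeight a.1 * t ^ auxDegree a.1 * (x ^ auxWeight a.2 * u ^ auxDegree a.2)

theorem prod_localWeight (x : Fin m → ℂˣ) {t u : ℂ} (ht : t ≠ 0) (hu : u ≠ 0)
    (σ : Fin m → Fin 4 × Fin 4) :
    ∏ i, localWeight (x i) t u (σ i) =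
      torusChar x (pairWeight σ) * t ^ fstDegree σ * u ^ sndDegree σ := by
  simp only [torusChar, fstDegree, sndDegree, zpow_sum_eq_prod ht,
    zpow_sum_eq_prod hu, ← Finset.prod_mul_distrib]
  refine Finset.prod_congr rfl fun i _ => ?_
  rw [localWeight, pairWeight, zpow_add₀ (x i).ne_zero]
  ring

variable {x t u y z : ℂ}

theorem sum_localWeight :
    ∑ a, localWeight x t u a = (x + x⁻¹ + (t + t⁻¹)) * (x + x⁻¹ + (u + u⁻¹)) := by
  simp only [Fintype.sum_prod_type, Fin.sum_univ_four, localWeight, auxWeight, auxDegree]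
  simp
  ring

/-- In this and the following moment formulas y and z are the inverses of the two factors at a site,
so the first moments are logarithmic derivatives of the site factor. -/
theorem sum_localWeight_weight (hy : (x + x⁻¹ + (t + t⁻¹)) * y = 1)
    (hz : (x + x⁻¹ + (u + u⁻¹)) * z = 1) :
    ∑ a, localWeight x t u a * ((auxWeight a.1 + auxWeight a.2 : ℤ) : ℂ) =
      (x + x⁻¹ + (t + t⁻¹)) * (x + x⁻¹ + (u + u⁻¹)) * ((x - x⁻¹) * (y + z)) := by
  simp only [Fintype.sum_prod_type, Fin.sum_univ_four, localWeight, auxWeight, auxDegree]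
  simp
  linear_combination -(x - x⁻¹) * (x + x⁻¹ + (u + u⁻¹)) * hy -
    (x - x⁻¹) * (x + x⁻¹ + (t + t⁻¹)) * hz

theorem sum_localWeight_weight_sq (hy : (x + x⁻¹ + (t + t⁻¹)) * y = 1)
    (hz : (x + x⁻¹ + (u + u⁻¹)) * z = 1) :
    ∑ a, localWeight x t u a * ((auxWeight a.1 + auxWeight a.2 : ℤ) : ℂ) ^ 2 =
      (x + x⁻¹ + (t + t⁻¹)) * (x + x⁻¹ + (u + u⁻¹)) *
        ((x + x⁻¹) * (y + z) + 2 * (x - x⁻¹) ^ 2 * y * z) := by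
  simp only [Fintype.sum_prod_type, Fin.sum_univ_four, localWeight, auxWeight, auxDegree]
  simp
  linear_combination -(x + x⁻¹) * (x + x⁻¹ + (u + u⁻¹)) * hy -
    (x + x⁻¹) * (x + x⁻¹ + (t + t⁻¹)) * hz -
    2 * (x - x⁻¹) ^ 2 * (x + x⁻¹ + (u + u⁻¹)) * z * hy - 2 * (x - x⁻¹) ^ 2 * hz

theorem sum_localWeight_fst (hy : (x + x⁻¹ + (t + t⁻¹)) * y = 1) :
    ∑ a, localWeight x t u a * (auxDegree a.1 : ℂ) =
      (x + x⁻¹ + (t + t⁻¹)) * (x + x⁻¹ + (u + u⁻¹)) * ((t - t⁻¹) * y) := by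
  simp only [Fintype.sum_prod_type, Fin.sum_univ_four, localWeight, auxWeight, auxDegree]
  simp
  linear_combination -(t - t⁻¹) * (x + x⁻¹ + (u + u⁻¹)) * hy

theorem sum_localWeight_snd (hz : (x + x⁻¹ + (u + u⁻¹)) * z = 1) :
    ∑ a, localWeight x t u a * (auxDegree a.2 : ℂ) =
      (x + x⁻¹ + (t + t⁻¹)) * (x + x⁻¹ + (u + u⁻¹)) * ((u - u⁻¹) * z) := by
  simp only [Fintype.sum_prod_type, Fin.sum_univ_four, localWeight, auxWeight, auxDegree]
  simp
  linear_combination -(u - u⁻¹) * (x + x⁻¹ + (t + t⁻¹)) * hz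

theorem sum_localWeight_fst_sq (hy : (x + x⁻¹ + (t + t⁻¹)) * y = 1) :
    ∑ a, localWeight x t u a * (auxDegree a.1 : ℂ) ^ 2 =
      (x + x⁻¹ + (t + t⁻¹)) * (x + x⁻¹ + (u + u⁻¹)) * ((t + t⁻¹) * y) := by
  simp only [Fintype.sum_prod_type, Fin.sum_univ_four, localWeight, auxWeight, auxDegree]
  simp
  linear_combination -(t + t⁻¹) * (x + x⁻¹ + (u + u⁻¹)) * hy

theorem sum_localWeight_snd_sq (hz : (x + x⁻¹ + (u + u⁻¹)) * z = 1) :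
    ∑ a, localWeight x t u a * (auxDegree a.2 : ℂ) ^ 2 =
      (x + x⁻¹ + (t + t⁻¹)) * (x + x⁻¹ + (u + u⁻¹)) * ((u + u⁻¹) * z) := by
  simp only [Fintype.sum_prod_type, Fin.sum_univ_four, localWeight, auxWeight, auxDegree]
  simp
  linear_combination -(u + u⁻¹) * (x + x⁻¹ + (t + t⁻¹)) * hz

/-- This is the single-site part of the differential equation of the kernel. The last two summands
are the cross terms between the derivatives of the Sp(4) denominator and those of the site factor.
-/
theorem local_identity (hx : x ≠ 0) (ht : t ≠ 0) (hu : u ≠ 0)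
    (hy : (x + x⁻¹ + (t + t⁻¹)) * y = 1) (hz : (x + x⁻¹ + (u + u⁻¹)) * z = 1) :
    (t - t⁻¹) * (u - u⁻¹) * (u + u⁻¹ - (t + t⁻¹)) *
      ((x + x⁻¹) * (y + z) + 2 * (x - x⁻¹) ^ 2 * y * z + 2 * (x + x⁻¹) * (y + z) +
        (t + t⁻¹) * y + (u + u⁻¹) * z - 8) +
      2 * ((u - u⁻¹) * ((t + t⁻¹) * (u + u⁻¹ - (t + t⁻¹)) - (t - t⁻¹) ^ 2)) * ((t - t⁻¹) * y) +
      2 * ((t - t⁻¹) * ((u + u⁻¹) * (u + u⁻¹ - (t + t⁻¹)) + (u - u⁻¹) ^ 2)) * ((u - u⁻¹) * z) = 0 := by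
  have h1 : (x - x⁻¹) ^ 2 = (x + x⁻¹) ^ 2 - 4 := by field_simp; ring
  have h2 : (t - t⁻¹) ^ 2 = (t + t⁻¹) ^ 2 - 4 := by field_simp; ring
  have h3 : (u - u⁻¹) ^ 2 = (u + u⁻¹) ^ 2 - 4 := by field_simp; ring
  rw [h1, h2, h3]
  generalize t - t⁻¹ = p
  generalize u - u⁻¹ = q
  generalize t + t⁻¹ = T at *
  generalize u + u⁻¹ = U at *
  generalize x + x⁻¹ = X at *
  have hy0 : X + T ≠ 0 := left_ne_zero_of_mul (by rw [hy]; exact one_ne_zero)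
  have hz0 : X + U ≠ 0 := left_ne_zero_of_mul (by rw [hz]; exact one_ne_zero)
  obtain rfl := eq_inv_of_mul_eq_one_right hy
  obtain rfl := eq_inv_of_mul_eq_one_right hz
  field_simp
  ring

end Determinant

/-! ### The differential equation of the two-column kernel. -/

section Determinant

variable {m : ℕ}

/-- Leibniz rule for (t∂_t)² + (u∂_u)² on the Sp(4) denominator times a monomial of degree (d, e).
The denominator is an eigenfunction with eigenvalue 5 = 1² + 2²; the other two lines are its first
derivatives. -/
theorem alternant_sum {t u : ℂ} (ht : t ≠ 0) (hu : u ≠ 0) (R d e : ℂ) :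
    ∑ w, (altSign w : ℂ) * (t ^ altFst w * u ^ altSnd w) *
      (R + (altFst w + d) ^ 2 + (altSnd w + e) ^ 2) =
      (t - t⁻¹) * (u - u⁻¹) * (u + u⁻¹ - (t + t⁻¹)) * (R + d ^ 2 + e ^ 2 + 5) +
      2 * ((u - u⁻¹) * ((t + t⁻¹) * (u + u⁻¹ - (t + t⁻¹)) - (t - t⁻¹) ^ 2)) * d +
      2 * ((t - t⁻¹) * ((u + u⁻¹) * (u + u⁻¹ - (t + t⁻¹)) + (u - u⁻¹) ^ 2)) * e := by
  have hz : ∀ z : ℂ, z ^ (-2 : ℤ) = z⁻¹ * z⁻¹ := fun z => by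
    rw [_root_.zpow_neg, zpow_ofNat, sq, mul_inv]
  have hz' : ∀ z : ℂ, z ^ (2 : ℤ) = z * z := fun z => by
    rw [zpow_ofNat, sq]
  simp only [Fin.sum_univ_eight, altSign, altFst, altSnd]
  simp [hz, hz']
  field_simp
  ring

/-- This is the two-site part of the equation: the pole along a + a⁻¹ = b + b⁻¹ cancels, leaving a
constant and the products that the squared t- and u-degrees will absorb. -/
theorem pair_identity {a b T U y y' z z' : ℂ} (hab : a + a⁻¹ - (b + b⁻¹) ≠ 0) (ha : a ≠ 0)
    (hb : b ≠ 0) (hy : (a + a⁻¹ + T) * y = 1) (hy' : (b + b⁻¹ + T) * y' = 1)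
    (hz : (a + a⁻¹ + U) * z = 1) (hz' : (b + b⁻¹ + U) * z' = 1) :
    2 * (a - a⁻¹) / (a + a⁻¹ - (b + b⁻¹)) * ((a - a⁻¹) * (y + z)) +
      2 * (b - b⁻¹) / (b + b⁻¹ - (a + a⁻¹)) * ((b - b⁻¹) * (y' + z')) =
    2 - (T ^ 2 - 4) * y * y' - (U ^ 2 - 4) * z * z' +
      (2 - (T ^ 2 - 4) * y' * y - (U ^ 2 - 4) * z' * z) := by
  have h1 : (a - a⁻¹) ^ 2 = (a + a⁻¹) ^ 2 - 4 := by field_simp; ring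
  have h2 : (b - b⁻¹) ^ 2 = (b + b⁻¹) ^ 2 - 4 := by field_simp; ring
  have e1 : 2 * (a - a⁻¹) / (a + a⁻¹ - (b + b⁻¹)) * ((a - a⁻¹) * (y + z)) +
      2 * (b - b⁻¹) / (b + b⁻¹ - (a + a⁻¹)) * ((b - b⁻¹) * (y' + z')) =
      2 * ((a - a⁻¹) ^ 2 * (y + z) - (b - b⁻¹) ^ 2 * (y' + z')) / (a + a⁻¹ - (b + b⁻¹)) := by
    rw [← neg_sub (a + a⁻¹), div_neg]
    ring
  rw [e1, h1, h2, div_eq_iff hab]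
  generalize a + a⁻¹ = X at *
  generalize b + b⁻¹ = Y at *
  have k1 : X + T ≠ 0 := left_ne_zero_of_mul (by rw [hy]; exact one_ne_zero)
  have k2 : X + U ≠ 0 := left_ne_zero_of_mul (by rw [hz]; exact one_ne_zero)
  have k3 : Y + T ≠ 0 := left_ne_zero_of_mul (by rw [hy']; exact one_ne_zero)
  have k4 : Y + U ≠ 0 := left_ne_zero_of_mul (by rw [hz']; exact one_ne_zero)
  obtain rfl := eq_inv_of_mul_eq_one_right hy
  obtain rfl := eq_inv_of_mul_eq_one_right hz
  obtain rfl := eq_inv_of_mul_eq_one_right hy'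
  obtain rfl := eq_inv_of_mul_eq_one_right hz'
  field_simp
  ring

/-- The sum of the radial symbols against the generating function. -/
theorem sum_prod_mul_radialSymbol {x : Fin m → ℂˣ} (hx : Function.Injective (torusEntry x))
    {t u : ℂ} {y z : Fin m → ℂ}
    (hy : ∀ i, ((x i : ℂ) + (x i : ℂ)⁻¹ + (t + t⁻¹)) * y i = 1)
    (hz : ∀ i, ((x i : ℂ) + (x i : ℂ)⁻¹ + (u + u⁻¹)) * z i = 1) :
    ∑ σ : Fin m → Fin 4 × Fin 4, (∏ i, localWeight (x i) t u (σ i)) *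
        radialSymbol x (pairWeight σ) =
      (∏ i, ((x i : ℂ) + (x i : ℂ)⁻¹ + (t + t⁻¹)) * ((x i : ℂ) + (x i : ℂ)⁻¹ + (u + u⁻¹))) *
      ∑ i, (((x i : ℂ) + (x i : ℂ)⁻¹) * (y i + z i) +
        2 * ((x i : ℂ) - (x i : ℂ)⁻¹) ^ 2 * y i * z i +
        2 * ((x i : ℂ) + (x i : ℂ)⁻¹) * (y i + z i) + ∑ j ∈ Finset.univ.erase i,
        (2 - ((t + t⁻¹) ^ 2 - 4) * y i * y j - ((u + u⁻¹) ^ 2 - 4) * z i * z j)) := by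
  set Z := ∏ i, ((x i : ℂ) + (x i : ℂ)⁻¹ + (t + t⁻¹)) * ((x i : ℂ) + (x i : ℂ)⁻¹ + (u + u⁻¹))
  have hF := fun i => sum_localWeight (x := (x i : ℂ)) (t := t) (u := u)
  have e1 : ∀ i, ∑ σ : Fin m → Fin 4 × Fin 4, (∏ i, localWeight (x i) t u (σ i)) *
      (pairWeight σ i : ℂ) = Z * (((x i : ℂ) - (x i : ℂ)⁻¹) * (y i + z i)) := fun i =>
    sum_prod_mul_eq hF (sum_localWeight_weight (hy i) (hz i))
  have e2 : ∀ i, ∑ σ : Fin m → Fin 4 × Fin 4, (∏ i, localWeight (x i) t u (σ i)) *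
      (pairWeight σ i : ℂ) ^ 2 = Z * (((x i : ℂ) + (x i : ℂ)⁻¹) * (y i + z i) +
        2 * ((x i : ℂ) - (x i : ℂ)⁻¹) ^ 2 * y i * z i) := fun i =>
    sum_prod_mul_eq hF (sum_localWeight_weight_sq (hy i) (hz i))
  have hne : ∀ i, (x i : ℂ) - (x i : ℂ)⁻¹ ≠ 0 := by
    intro i h
    have h1 : torusEntry x (Sum.inl i) = torusEntry x (Sum.inr i) := by
      simpa [torusEntry] using sub_eq_zero.1 h
    simpa using hx h1
  have hne2 : ∀ i j, i ≠ j → (x i : ℂ) + (x i : ℂ)⁻¹ - ((x j : ℂ) + (x j : ℂ)⁻¹) ≠ 0 := by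
    intro i j hij h
    have hi := (x i).ne_zero
    have hj := (x j).ne_zero
    have h1 : ((x i : ℂ) - x j) * ((x i : ℂ) * x j - 1) = 0 := by
      field_simp at h
      linear_combination h
    rcases mul_eq_zero.1 h1 with h2 | h2
    · have h3 : torusEntry x (Sum.inl i) = torusEntry x (Sum.inl j) := by
        simpa [torusEntry] using sub_eq_zero.1 h2
      exact hij (Sum.inl_injective (hx h3))
    · have h3 : torusEntry x (Sum.inl i) = torusEntry x (Sum.inr j) := by
        simpa [torusEntry] using eq_inv_of_mul_eq_one_left (sub_eq_zero.1 h2)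
      simpa using hx h3
  have e3 : ∀ (i : Fin m) (c : ℂ), ∑ σ : Fin m → Fin 4 × Fin 4,
      (∏ i, localWeight (x i) t u (σ i)) * (c * (pairWeight σ i : ℂ)) =
      Z * (c * (((x i : ℂ) - (x i : ℂ)⁻¹) * (y i + z i))) := by
    intro i c
    simp only [mul_left_comm _ c, ← Finset.mul_sum, e1]
  have hpair := fun i j (hij : i ≠ j) => pair_identity (hne2 i j hij) (x i).ne_zero (x j).ne_zero
    (hy i) (hy j) (hz i) (hz j)
  have hswap := sum_sum_eq_of_symm
    (fun i j => 2 * ((x i : ℂ) - (x i : ℂ)⁻¹) /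
      ((x i : ℂ) + (x i : ℂ)⁻¹ - ((x j : ℂ) + (x j : ℂ)⁻¹)) *
        (((x i : ℂ) - (x i : ℂ)⁻¹) * (y i + z i)))
    (fun i j => 2 - ((t + t⁻¹) ^ 2 - 4) * y i * y j - ((u + u⁻¹) ^ 2 - 4) * z i * z j) hpair
  rw [sum_sum_eq_of_symm _ _ fun i j _ => rfl, Finset.sum_add_distrib, Finset.sum_add_distrib,
    add_right_inj] at hswap
  have hterm : ∀ i, ∑ σ : Fin m → Fin 4 × Fin 4, (∏ i, localWeight (x i) t u (σ i)) *
      ((pairWeight σ i : ℂ) ^ 2 +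
        2 * ((x i : ℂ) + (x i : ℂ)⁻¹) / ((x i : ℂ) - (x i : ℂ)⁻¹) * pairWeight σ i +
        ∑ j ∈ Finset.univ.erase i, 2 * ((x i : ℂ) - (x i : ℂ)⁻¹) /
          ((x i : ℂ) + (x i : ℂ)⁻¹ - ((x j : ℂ) + (x j : ℂ)⁻¹)) * pairWeight σ i) =
      Z * ((((x i : ℂ) + (x i : ℂ)⁻¹) * (y i + z i) +
        2 * ((x i : ℂ) - (x i : ℂ)⁻¹) ^ 2 * y i * z i +
        2 * ((x i : ℂ) + (x i : ℂ)⁻¹) * (y i + z i)) +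
        ∑ j ∈ Finset.univ.erase i, 2 * ((x i : ℂ) - (x i : ℂ)⁻¹) /
          ((x i : ℂ) + (x i : ℂ)⁻¹ - ((x j : ℂ) + (x j : ℂ)⁻¹)) *
            (((x i : ℂ) - (x i : ℂ)⁻¹) * (y i + z i))) := by
    intro i
    have hi := hne i
    rw [mul_add Z, Finset.mul_sum, ← Finset.sum_congr rfl fun j _ => e3 i _, Finset.sum_comm]
    simp_rw [mul_add (∏ i, localWeight (x i) t u _), Finset.sum_add_distrib, Finset.mul_sum]
    rw [e2, e3, add_left_inj]
    generalize (x i : ℂ) - (x i : ℂ)⁻¹ = p at hi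
    generalize (x i : ℂ) + (x i : ℂ)⁻¹ = X
    field_simp
  simp only [radialSymbol]
  rw [Finset.sum_congr rfl fun σ _ => Finset.mul_sum _ _ _, Finset.sum_comm, Finset.sum_congr rfl fun i _ => hterm i, ← Finset.mul_sum,
    Finset.sum_add_distrib, hswap, ← Finset.sum_add_distrib, Finset.mul_sum]

theorem sum_prod_mul_degree_sq {F y : Fin m → ℂ} {S : Type*} [Fintype S] {v : Fin m → S → ℂ}
    {g : S → ℂ} {a b : ℂ} (hF : ∀ i, ∑ s, v i s = F i)
    (h1 : ∀ i, ∑ s, v i s * g s = F i * (a * y i))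
    (h2 : ∀ i, ∑ s, v i s * g s ^ 2 = F i * (b * y i)) :
    ∑ σ : Fin m → S, (∏ i, v i (σ i)) * (∑ i, g (σ i)) ^ 2 =
      (∏ i, F i) * ∑ i, (b * y i + ∑ j ∈ Finset.univ.erase i, a ^ 2 * y i * y j) := by
  have hsq : ∀ σ : Fin m → S, (∑ i, g (σ i)) ^ 2 =
      ∑ i, (g (σ i) ^ 2 + ∑ j ∈ Finset.univ.erase i, g (σ i) * g (σ j)) := by
    intro σ
    rw [sq, Finset.sum_mul_sum, sum_sum_eq_of_symm _ _ fun i j _ => rfl]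
    simp only [sq]
  simp only [hsq]
  simp_rw [Finset.mul_sum]
  rw [Finset.sum_comm]
  refine Finset.sum_congr rfl fun i _ => ?_
  simp_rw [mul_add, Finset.sum_add_distrib, Finset.mul_sum]
  rw [Finset.sum_comm (s := (Finset.univ : Finset (Fin m → S)))]
  refine congrArg₂ (· + ·) (sum_prod_mul_eq (g := fun s => g s ^ 2) hF (h2 i))
    (Finset.sum_congr rfl fun j hj => ?_)
  rw [sum_prod_mul_mul_eq hF (Finset.ne_of_mem_erase hj).symm (h1 i) (h1 j)]
  ring

/-- The radial operator in x and the second-order operators in t and u add up to a constant on the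
kernel times the Sp(4) denominator. Single sites cancel by `local_identity`, pairs of sites by
`pair_identity`. -/
theorem sum_generating_eq_zero {x : Fin m → ℂˣ} (hx : Function.Injective (torusEntry x))
    {t u : ℂ} (ht : t ≠ 0) (hu : u ≠ 0) (ht' : ∀ i, (x i : ℂ) + (x i : ℂ)⁻¹ + (t + t⁻¹) ≠ 0)
    (hu' : ∀ i, (x i : ℂ) + (x i : ℂ)⁻¹ + (u + u⁻¹) ≠ 0) :
    ∑ q : Fin 8 × (Fin m → Fin 4 × Fin 4),
      (altSign q.1 : ℂ) * (radialSymbol x (pairWeight q.2) - (2 * m ^ 2 + 6 * m + 5) +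
        ((altFst q.1 + fstDegree q.2 : ℤ) : ℂ) ^ 2 + ((altSnd q.1 + sndDegree q.2 : ℤ) : ℂ) ^ 2) *
        torusChar x (pairWeight q.2) * u ^ (altSnd q.1 + sndDegree q.2) *
        t ^ (altFst q.1 + fstDegree q.2) = 0 := by
  obtain ⟨y, hy⟩ : ∃ y : Fin m → ℂ, ∀ i, ((x i : ℂ) + (x i : ℂ)⁻¹ + (t + t⁻¹)) * y i = 1 :=
    ⟨_, fun i => mul_inv_cancel₀ (ht' i)⟩
  obtain ⟨z, hz⟩ : ∃ z : Fin m → ℂ, ∀ i, ((x i : ℂ) + (x i : ℂ)⁻¹ + (u + u⁻¹)) * z i = 1 :=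
    ⟨_, fun i => mul_inv_cancel₀ (hu' i)⟩
  have hF := fun i => sum_localWeight (x := (x i : ℂ)) (t := t) (u := u)
  have s0 := sum_prod_eq hF
  have s1 := sum_prod_mul_radialSymbol hx hy hz
  have s2 := sum_prod_mul_degree_sq (y := y) (v := fun i => localWeight (x i) t u)
    (g := fun a => (auxDegree a.1 : ℂ)) (a := t - t⁻¹) (b := t + t⁻¹) hF
    (fun i => sum_localWeight_fst (hy i)) (fun i => sum_localWeight_fst_sq (hy i))
  have s3 := sum_prod_mul_degree_sq (y := z) (v := fun i => localWeight (x i) t u)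
    (g := fun a => (auxDegree a.2 : ℂ)) (a := u - u⁻¹) (b := u + u⁻¹) hF
    (fun i => sum_localWeight_snd (hz i)) (fun i => sum_localWeight_snd_sq (hz i))
  have s4 := fun i => sum_prod_mul_eq (g := fun a => (auxDegree a.1 : ℂ)) hF
    (sum_localWeight_fst (hy i))
  have s5 := fun i => sum_prod_mul_eq (g := fun a => (auxDegree a.2 : ℂ)) hF
    (sum_localWeight_snd (hz i))
  have hloc := fun i => local_identity (x i).ne_zero ht hu (hy i) (hz i)
  set Z := ∏ i, ((x i : ℂ) + (x i : ℂ)⁻¹ + (t + t⁻¹)) * ((x i : ℂ) + (x i : ℂ)⁻¹ + (u + u⁻¹))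
  have s4' : ∑ σ : Fin m → Fin 4 × Fin 4, (∏ i, localWeight (x i) t u (σ i)) *
      (fstDegree σ : ℂ) = Z * ∑ i, (t - t⁻¹) * y i := by
    simp only [fstDegree, Int.cast_sum, Finset.mul_sum]
    rw [Finset.sum_comm]
    exact Finset.sum_congr rfl fun i _ => s4 i
  have s5' : ∑ σ : Fin m → Fin 4 × Fin 4, (∏ i, localWeight (x i) t u (σ i)) *
      (sndDegree σ : ℂ) = Z * ∑ i, (u - u⁻¹) * z i := by
    simp only [sndDegree, Int.cast_sum, Finset.mul_sum]
    rw [Finset.sum_comm]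
    exact Finset.sum_congr rfl fun i _ => s5 i
  have hfst : ∀ σ : Fin m → Fin 4 × Fin 4, ∑ i, (auxDegree (σ i).1 : ℂ) = fstDegree σ :=
    fun σ => (Int.cast_sum _ _).symm
  have hsnd : ∀ σ : Fin m → Fin 4 × Fin 4, ∑ i, (auxDegree (σ i).2 : ℂ) = sndDegree σ :=
    fun σ => (Int.cast_sum _ _).symm
  simp only [hfst] at s2
  simp only [hsnd] at s3
  have hsplit : ∀ σ : Fin m → Fin 4 × Fin 4, ∑ w, (altSign w : ℂ) *
      (radialSymbol x (pairWeight σ) - (2 * m ^ 2 + 6 * m + 5) +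
        ((altFst w + fstDegree σ : ℤ) : ℂ) ^ 2 + ((altSnd w + sndDegree σ : ℤ) : ℂ) ^ 2) *
        torusChar x (pairWeight σ) * u ^ (altSnd w + sndDegree σ) * t ^ (altFst w + fstDegree σ) =
      (t - t⁻¹) * (u - u⁻¹) * (u + u⁻¹ - (t + t⁻¹)) *
        ((∏ i, localWeight (x i) t u (σ i)) * radialSymbol x (pairWeight σ) +
        (∏ i, localWeight (x i) t u (σ i)) * (fstDegree σ : ℂ) ^ 2 +
        (∏ i, localWeight (x i) t u (σ i)) * (sndDegree σ : ℂ) ^ 2 -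
        (2 * m ^ 2 + 6 * m) * ∏ i, localWeight (x i) t u (σ i)) +
      2 * ((u - u⁻¹) * ((t + t⁻¹) * (u + u⁻¹ - (t + t⁻¹)) - (t - t⁻¹) ^ 2)) *
        ((∏ i, localWeight (x i) t u (σ i)) * (fstDegree σ : ℂ)) +
      2 * ((t - t⁻¹) * ((u + u⁻¹) * (u + u⁻¹ - (t + t⁻¹)) + (u - u⁻¹) ^ 2)) *
        ((∏ i, localWeight (x i) t u (σ i)) * (sndDegree σ : ℂ)) := by
    intro σ
    have h := alternant_sum ht hu (radialSymbol x (pairWeight σ) - (2 * m ^ 2 + 6 * m + 5))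
      (fstDegree σ) (sndDegree σ)
    have h' := congrArg (fun c => (∏ i, localWeight (x i) t u (σ i)) * c) h
    simp only [Finset.mul_sum] at h'
    refine Eq.trans (Finset.sum_congr rfl fun w _ => ?_) (h'.trans ?_)
    · rw [prod_localWeight x ht hu, zpow_add₀ ht, zpow_add₀ hu]
      push_cast
      ring
    · ring
  rw [Fintype.sum_prod_type, Finset.sum_comm]
  simp only [hsplit, Finset.sum_add_distrib, ← Finset.mul_sum, Finset.sum_sub_distrib]
  rw [s0, s1, s2, s3, s4', s5']
  have hsum := Finset.sum_eq_zero (s := Finset.univ) fun i _ => hloc i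
  have hm : ∀ i : Fin m, ∑ j ∈ Finset.univ.erase i, (2 : ℂ) = 2 * (m - 1) := by
    intro i
    have : 1 ≤ m := by have := i.2; omega
    rw [Finset.sum_const, Finset.card_erase_of_mem (Finset.mem_univ i), Finset.card_univ,
      Fintype.card_fin, nsmul_eq_mul, Nat.cast_sub this]
    push_cast
    ring
  have hfac : (t - t⁻¹) ^ 2 = (t + t⁻¹) ^ 2 - 4 := by field_simp; ring
  have hfac' : (u - u⁻¹) ^ 2 = (u + u⁻¹) ^ 2 - 4 := by field_simp; ring
  -- At each site 8 is the constant of `local_identity`, and 2(m - 1) collects the constants 2 from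
  -- the pairs with the other sites.
  have hK : (2 * (m : ℂ) ^ 2 + 6 * m) = ∑ i : Fin m, (2 * ((m : ℂ) - 1) + 8) := by
    rw [Finset.sum_const, Finset.card_univ, Fintype.card_fin, nsmul_eq_mul]
    ring
  rw [← mul_zero Z, ← hsum, hK]
  simp only [← hfac, ← hfac', Finset.sum_sub_distrib, hm]
  simp only [mul_left_comm _ Z, mul_comm _ Z, ← mul_add, ← mul_sub]
  congr 1
  simp only [Finset.mul_sum, ← Finset.sum_add_distrib, ← Finset.sum_sub_distrib]
  refine Finset.sum_congr rfl fun i _ => ?_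
  ring

theorem isRadialEigen_twoColumnDet (r s : ℤ) :
    IsRadialEigen (twoColumnDet m r s)
      (2 * m ^ 2 + 6 * m + 5 - ((r + 1) ^ 2 + (s + 2) ^ 2)) := by
  intro x hx
  -- These are the values of t or u at which some factor of the kernel vanishes.
  set F : Finset ℂ := Finset.univ.image (fun i => -(x i : ℂ)) ∪
    Finset.univ.image (fun i => -(x i : ℂ)⁻¹) with hF
  have hgood : ∀ t : ℂ, t ≠ 0 → t ∉ F → ∀ i, (x i : ℂ) + (x i : ℂ)⁻¹ + (t + t⁻¹) ≠ 0 := by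
    intro t ht htF i h
    have hi := (x i).ne_zero
    have h1 : (t + x i) * (t + (x i : ℂ)⁻¹) = 0 := by
      field_simp at h ⊢
      linear_combination h
    refine htF ?_
    rw [hF, Finset.mem_union, Finset.mem_image, Finset.mem_image]
    rcases mul_eq_zero.1 h1 with h2 | h2
    · exact Or.inl ⟨i, Finset.mem_univ i, (eq_neg_of_add_eq_zero_left h2).symm⟩
    · exact Or.inr ⟨i, Finset.mem_univ i, (eq_neg_of_add_eq_zero_left h2).symm⟩
  -- On the coefficient of t^(r+1) u^(s+2) the operators in t and u act by the scalars (r+1)² and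
  -- (s+2)², so only the radial operator in x remains.
  have h1 := sum_coeff_eq_zero _ _ F (fun u hu huF => by
    have h2 := sum_coeff_eq_zero _ _ F (fun t ht htF =>
      sum_generating_eq_zero hx ht hu (hgood t ht htF) (hgood u hu huF)) (r + 1)
    simp only [← ite_zero_mul] at h2
    exact h2) (s + 2)
  rw [← sub_eq_zero]
  refine Eq.trans ?_ h1
  simp only [twoColumnDet, map_sum, Finset.mul_sum, ← Finset.sum_sub_distrib]
  refine Finset.sum_congr rfl fun q _ => ?_
  by_cases hs : altSnd q.1 + sndDegree q.2 = s + 2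
  · by_cases hr : altFst q.1 + fstDegree q.2 = r + 1
    · rw [if_pos ⟨hr, hs⟩, if_pos hs, if_pos hr, laurentRadial, laurentEval,
        Finsupp.linearCombination_single, Finsupp.linearCombination_single, hr, hs]
      push_cast
      simp only [smul_eq_mul]
      ring
    · simp [hr]
  · simp [hs]

end Determinant

/-! ### Extremality of the highest weight. -/

section LeadingWeight

variable {m : ℕ}

/-- The highest weight `ε₁ + ⋯ + ε_k`. -/
def headWeight (k : ℕ) (i : Fin m) : ℤ := if (i : ℕ) < k then 1 else 0

theorem sum_mul_headWeight {k : ℕ} (hk : k ≤ m) (f : ℕ → ℤ) :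
    ∑ i : Fin m, f i * headWeight k i = ∑ i ∈ Finset.range k, f i := by
  simp only [headWeight, mul_ite, mul_one, mul_zero]
  rw [Fin.sum_univ_eq_sum_range (fun i => if i < k then f i else 0), ← Finset.sum_filter]
  refine Finset.sum_congr ?_ fun _ _ => rfl
  ext i
  simp only [Finset.mem_filter, Finset.mem_range]
  omega

theorem sum_headWeight {k : ℕ} (hk : k ≤ m) : ∑ i : Fin m, headWeight k i = k := by
  simpa using sum_mul_headWeight hk fun _ => 1

theorem twoOnePartition_eq_headWeight {p q : ℕ} (hqp : q ≤ p) :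
    (fun i => (twoOnePartition m q (p - q) i : ℤ)) = headWeight p + headWeight q := by
  ext i
  simp only [twoOnePartition, headWeight, Pi.add_apply]
  split_ifs <;> omega

/-- Among the weights of an exterior power, the highest weight is strictly maximal. -/
theorem IsSmallWeight.sum_lt {k : ℕ} {a : Fin m → ℤ} (ha : IsSmallWeight k a) (hk : k ≤ m)
    {w : Fin m → ℤ} (hpos : ∀ i, 0 < w i) (hanti : StrictAnti w) (hne : a ≠ headWeight k) :
    ∑ i, w i * a i < ∑ i, w i * headWeight k i := by
  -- θ is a Lagrange multiplier for the bound on ∑ |a i|, separating the first k values of w from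
  -- the rest. Doubling w makes room for an integer strictly between consecutive values.
  obtain ⟨θ, hθ, h1, h2⟩ : ∃ θ : ℤ, 0 ≤ θ ∧ (∀ i : Fin m, (i : ℕ) < k → θ < 2 * w i) ∧
      ∀ i : Fin m, k ≤ i → 2 * w i < θ := by
    rcases Nat.eq_zero_or_pos k with rfl | hk0
    · refine ⟨2 * ∑ i, w i + 1, ?_, fun i hi => absurd hi (Nat.not_lt_zero _), fun i _ => ?_⟩
      · have := Finset.sum_nonneg fun i (_ : i ∈ Finset.univ) => (hpos i).le
        omega
      · have := Finset.single_le_sum (fun i _ => (hpos i).le) (Finset.mem_univ i)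
        omega
    · have hlt : k - 1 < m := by omega
      refine ⟨2 * w ⟨k - 1, hlt⟩ - 1, by have := hpos ⟨k - 1, hlt⟩; omega, fun i hi => ?_,
        fun i hi => ?_⟩
      · have := hanti.antitone (show i ≤ ⟨k - 1, hlt⟩ from Fin.le_def.2 (by simp; omega))
        omega
      · have := hanti (show (⟨k - 1, hlt⟩ : Fin m) < i from Fin.lt_def.2 (by simp; omega))
        omega
  have hslack : ∀ i, a i = headWeight k i ∨
      0 < 2 * (w i * headWeight k i - w i * a i) - θ * (headWeight k i - |a i|) := by
    intro i
    have hi := ha.1 i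
    have hw := hpos i
    rw [abs_le] at hi
    have hcases : a i = -1 ∨ a i = 0 ∨ a i = 1 := by omega
    by_cases hik : (i : ℕ) < k
    · have := h1 i hik
      rcases hcases with h | h | h <;> simp [headWeight, hik, h] <;> omega
    · have := h2 i (by omega)
      rcases hcases with h | h | h <;> simp [headWeight, hik, h] <;> omega
  obtain ⟨i₀, hi₀⟩ := Function.ne_iff.1 hne
  have hsum : 0 < ∑ i, (2 * (w i * headWeight k i - w i * a i) - θ * (headWeight k i - |a i|)) := by
    refine Finset.sum_pos' (fun i _ => ?_) ⟨i₀, Finset.mem_univ _, (hslack i₀).resolve_left hi₀⟩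
    rcases hslack i with h | h
    · rw [h]
      simp only [headWeight]
      split_ifs <;> simp
    · exact h.le
  rw [Finset.sum_sub_distrib, ← Finset.mul_sum, ← Finset.mul_sum, Finset.sum_sub_distrib,
    Finset.sum_sub_distrib, sum_headWeight hk] at hsum
  have h3 := mul_nonneg hθ (sub_nonneg.2 ha.2)
  linarith

theorem IsSmallWeight.sum_le {k : ℕ} {a : Fin m → ℤ} (ha : IsSmallWeight k a) (hk : k ≤ m)
    {w : Fin m → ℤ} (hpos : ∀ i, 0 < w i) (hanti : StrictAnti w) :
    ∑ i, w i * a i ≤ ∑ i, w i * headWeight k i := by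
  by_cases h : a = headWeight k
  · rw [h]
  · exact (ha.sum_lt hk hpos hanti h).le

theorem casimirValue_add (a b : Fin m → ℤ) :
    casimirValue (a + b) = ∑ i, a i ^ 2 + ∑ i, b i ^ 2 + 2 * ∑ i, a i * b i +
      2 * ∑ i, ((m : ℤ) - i) * a i + 2 * ∑ i, ((m : ℤ) - i) * b i := by
  simp only [casimirValue, Finset.mul_sum, ← Finset.sum_add_distrib, Pi.add_apply]
  exact Finset.sum_congr rfl fun i _ => by ring

theorem sum_range_weight (m k : ℕ) :
    2 * ∑ i ∈ Finset.range k, ((m : ℤ) - i) = k * (2 * m + 1 - k) := by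
  induction k with
  | zero => simp
  | succ k ih =>
    rw [Finset.sum_range_succ, mul_add, ih]
    push_cast
    ring

theorem casimirValue_headWeight {k l : ℕ} (hk : k ≤ m) (hlk : l ≤ k) :
    casimirValue (headWeight k + headWeight l : Fin m → ℤ) =
      k * (2 * m + 2 - k) + l * (2 * m + 4 - l) := by
  have hl : l ≤ m := hlk.trans hk
  have hsq : ∀ n (i : Fin m), headWeight n i ^ 2 = headWeight n i := by
    intro n i
    simp only [headWeight]
    split_ifs <;> simp
  have hmul : ∀ i : Fin m, headWeight k i * headWeight l i = headWeight l i := by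
    intro i
    simp only [headWeight]
    split_ifs <;> omega
  rw [casimirValue_add]
  simp only [hsq, hmul]
  rw [sum_headWeight hk, sum_headWeight hl, sum_mul_headWeight hk fun i => (m : ℤ) - i,
    sum_mul_headWeight hl fun i => (m : ℤ) - i, sum_range_weight, sum_range_weight]
  ring

/-- The quadratic terms contribute at most k + l + 2l, and the linear terms are maximal only at the
head weights, so equality determines a and b. -/
theorem IsSmallWeight.casimirValue_le {k l : ℕ} {a b : Fin m → ℤ} (ha : IsSmallWeight k a)
    (hb : IsSmallWeight l b) (hk : k ≤ m) (hl : l ≤ m) :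
    casimirValue (a + b) ≤ k * (2 * m + 2 - k) + l * (2 * m + 4 - l) ∧
      (casimirValue (a + b) = k * (2 * m + 2 - k) + l * (2 * m + 4 - l) →
        a = headWeight k ∧ b = headWeight l) := by
  have hpos : ∀ i : Fin m, 0 < (m : ℤ) - i := fun i => by have := i.2; omega
  have hanti : StrictAnti fun i : Fin m => (m : ℤ) - i := fun i j h => by
    have := Fin.lt_def.1 h
    simp only
    omega
  have hsq : ∀ {n} {c : Fin m → ℤ}, IsSmallWeight n c → ∑ i, c i ^ 2 ≤ n := by
    intro n c hc
    refine le_trans (Finset.sum_le_sum fun i _ => ?_) hc.2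
    rw [← sq_abs]
    nlinarith [hc.1 i, abs_nonneg (c i)]
  have hab : ∑ i, a i * b i ≤ l := by
    refine le_trans (Finset.sum_le_sum fun i _ => ?_) hb.2
    refine (le_abs_self _).trans ?_
    rw [abs_mul]
    nlinarith [ha.1 i, abs_nonneg (b i)]
  have hk1 : 2 * ∑ i : Fin m, ((m : ℤ) - i) * headWeight k i = k * (2 * m + 1 - k) := by
    rw [sum_mul_headWeight hk fun i => (m : ℤ) - i, sum_range_weight]
  have hl1 : 2 * ∑ i : Fin m, ((m : ℤ) - i) * headWeight l i = l * (2 * m + 1 - l) := by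
    rw [sum_mul_headWeight hl fun i => (m : ℤ) - i, sum_range_weight]
  have e1 := ha.sum_le hk hpos hanti
  have e2 := hb.sum_le hl hpos hanti
  have e3 := hsq ha
  have e4 := hsq hb
  rw [casimirValue_add]
  refine ⟨by linarith, fun h => ⟨?_, ?_⟩⟩
  · by_contra hne
    have := ha.sum_lt hk hpos hanti hne
    linarith
  · by_contra hne
    have := hb.sum_lt hl hpos hanti hne
    linarith

theorem abs_auxDegree_add (c : Fin 4) : |auxDegree c| + |auxWeight c| = 1 := by
  fin_cases c <;> rfl

theorem eq_of_auxDegree {c d : Fin 4} (h1 : auxDegree c = auxDegree d)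
    (h2 : auxWeight c = auxWeight d) : c = d := by
  revert c d
  decide

/-- Every site contributes either to the t-degree or to the weight; a total degree d occupies at
least |d| sites and leaves at most m - |d| for x. -/
theorem isSmallWeight_auxWeight (κ : Fin m → Fin 4) :
    (∑ i, auxDegree (κ i)).natAbs ≤ m ∧
      IsSmallWeight (m - (∑ i, auxDegree (κ i)).natAbs) fun i => auxWeight (κ i) := by
  have h1 : ∑ i, |auxDegree (κ i)| + ∑ i, |auxWeight (κ i)| = m := by
    rw [← Finset.sum_add_distrib]
    simp [abs_auxDegree_add]
  have h2 := Finset.abs_sum_le_sum_abs (fun i => auxDegree (κ i)) Finset.univ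
  have h3 := Finset.sum_nonneg fun i (_ : i ∈ Finset.univ) => abs_nonneg (auxWeight (κ i))
  rw [Int.abs_eq_natAbs] at h2
  refine ⟨by omega, fun i => ?_, ?_⟩
  · change |auxWeight (κ i)| ≤ 1
    have := abs_auxDegree_add (κ i)
    have := abs_nonneg (auxDegree (κ i))
    omega
  · change ∑ i, |auxWeight (κ i)| ≤ _
    omega

/-- The terms of the determinant other than the leading one are strictly lower. -/
theorem casimirValue_pairWeight {r s : ℕ} (hrs : r ≤ s) (hs : s ≤ m)
    {q : Fin 8 × (Fin m → Fin 4 × Fin 4)} (h1 : altFst q.1 + fstDegree q.2 = r + 1)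
    (h2 : altSnd q.1 + sndDegree q.2 = s + 2) :
    casimirValue (pairWeight q.2) ≤
        (m - r : ℕ) * (2 * m + 2 - (m - r : ℕ)) + (m - s : ℕ) * (2 * m + 4 - (m - s : ℕ)) ∧
      (casimirValue (pairWeight q.2) =
          (m - r : ℕ) * (2 * m + 2 - (m - r : ℕ)) + (m - s : ℕ) * (2 * m + 4 - (m - s : ℕ)) →
        q.1 = 0 ∧ (fun i => auxWeight (q.2 i).1) = headWeight (m - r) ∧
          (fun i => auxWeight (q.2 i).2) = headWeight (m - s)) := by
  obtain ⟨w, σ⟩ := q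
  obtain ⟨k1, k2⟩ := isSmallWeight_auxWeight fun i => (σ i).1
  obtain ⟨l1, l2⟩ := isSmallWeight_auxWeight fun i => (σ i).2
  obtain ⟨c1, c2⟩ := k2.casimirValue_le l2 (Nat.sub_le _ _) (Nat.sub_le _ _)
  have hsplit : pairWeight σ = (fun i => auxWeight (σ i).1) + fun i => auxWeight (σ i).2 := rfl
  simp only at h1 h2
  rw [fstDegree] at h1
  rw [sndDegree] at h2
  rw [← hsplit] at c1 c2
  simp only
  generalize (∑ i, auxDegree (σ i).1) = d at *
  generalize (∑ i, auxDegree (σ i).2) = e at *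
  rw [Nat.cast_sub k1, Nat.cast_sub l1, Int.natCast_natAbs, Int.natCast_natAbs] at c1 c2
  rw [Nat.cast_sub (hrs.trans hs), Nat.cast_sub hs]
  have hr0 : (0 : ℤ) ≤ r := by omega
  have hrs' : (r : ℤ) ≤ s := by omega
  by_cases hw : w = 0
  · subst hw
    have hd : d = r := by simp [altFst] at h1; omega
    have he : e = s := by simp [altSnd] at h2; omega
    subst hd he
    simp only [Int.natAbs_natCast, Nat.abs_cast] at c1 c2
    exact ⟨c1, fun h => ⟨rfl, c2 h⟩⟩
  · have hd := le_abs_self d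
    have he := le_abs_self e
    have hd' := abs_nonneg d
    have he' := abs_nonneg e
    have hlt : (m - |d|) * (2 * m + 2 - (m - |d|)) + (m - |e|) * (2 * m + 4 - (m - |e|)) <
        ((m : ℤ) - r) * (2 * m + 2 - (m - r)) + (m - s) * (2 * m + 4 - (m - s)) := by
      -- The bound for degrees (d, e) is (m+1)² + (m+2)² - (|d|+1)² - (|e|+2)². A non-identity Weyl
      -- element with first coordinate 2 lowers d by one but raises e, and r ≤ s makes the gain
      -- outweigh the loss; the remaining elements lower neither degree.
      have key : ((r : ℤ) + 1) ^ 2 + (s + 2) ^ 2 < (|d| + 1) ^ 2 + (|e| + 2) ^ 2 := by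
        fin_cases w
        · exact absurd rfl hw
        all_goals
          simp [altFst, altSnd] at h1 h2
          nlinarith
      linarith
    exact ⟨c1.trans hlt.le, fun h => absurd h (c1.trans_lt hlt).ne⟩

end LeadingWeight

/-! ### Identification of the character with the determinant. -/

section CharacterFormula

variable {m : ℕ}

/-- A generic dominant coweight. -/
def genericWeight (i : Fin m) : ℤ := 5 ^ (i.rev : ℕ)

theorem genericWeight_pos (i : Fin m) : 0 < genericWeight i := by
  rw [genericWeight]; positivity

theorem genericWeight_strictAnti : StrictAnti (genericWeight (m := m)) := fun i j h =>
  pow_lt_pow_right₀ (by norm_num) (Fin.lt_def.1 (Fin.rev_lt_rev.2 h))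

/-- Modulo 5 the lowest digit must vanish, and induction does the rest. Differences of exponents
with entries in [-2, 2] satisfy the bound 4, so the generic coweight separates all exponents that
occur. -/
theorem eq_zero_of_sum_five_pow : ∀ {n : ℕ} {d : Fin n → ℤ}, (∀ i, |d i| ≤ 4) →
    ∑ i : Fin n, 5 ^ (i : ℕ) * d i = 0 → d = 0 := by
  intro n
  induction n with
  | zero => intro d _ _; exact Subsingleton.elim _ _
  | succ n ih =>
    intro d hd h
    rw [Fin.sum_univ_succ] at h
    simp only [Fin.val_zero, pow_zero, one_mul, Fin.val_succ, pow_succ, mul_assoc,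
      mul_left_comm _ (5 : ℤ), ← Finset.mul_sum] at h
    have h0 := hd 0
    rw [abs_le] at h0
    have h1 : d 0 = 0 := by omega
    have h2 := ih (d := fun i => d i.succ) (fun i => hd _) (by omega)
    ext i
    refine Fin.cases h1 (fun j => congrFun h2 j) i

theorem sum_genericWeight_injective {μ ν : Fin m → ℤ} (hμ : ∀ i, |μ i| ≤ 2) (hν : ∀ i, |ν i| ≤ 2)
    (h : ∑ i, genericWeight i * μ i = ∑ i, genericWeight i * ν i) : μ = ν := by
  have h1 := eq_zero_of_sum_five_pow (d := fun i => (μ - ν) i.rev) (fun i => by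
    have h1 := hμ i.rev
    have h2 := hν i.rev
    rw [abs_le] at *
    simp only [Pi.sub_apply]
    omega) (by
    rw [← Equiv.sum_comp Fin.revPerm]
    simp only [Fin.revPerm_apply, Fin.rev_rev, Pi.sub_apply, mul_sub, Finset.sum_sub_distrib]
    exact sub_eq_zero.2 h)
  ext i
  have := congrFun h1 i.rev
  simp only [Fin.rev_rev, Pi.sub_apply, Pi.zero_apply] at this
  omega

/-- A radial eigenfunction all of whose exponents have smaller Casimir value vanishes. -/
theorem IsRadialEigen.eq_zero {f : (Fin m → ℤ) →₀ ℂ} {c : ℤ} (hf : IsRadialEigen f c)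
    (hbound : ∀ μ ∈ f.support, ∀ i, |μ i| ≤ 2) (hlt : ∀ μ ∈ f.support, casimirValue μ < c) :
    f = 0 := by
  by_contra h0
  obtain ⟨μ₀, hμ₀, hmax⟩ := Finset.exists_max_image f.support
    (fun μ => ∑ i, genericWeight i * μ i) (Finsupp.support_nonempty_iff.2 h0)
  have h := hf.eq_casimirValue genericWeight_pos genericWeight_strictAnti
    (Finsupp.mem_support_iff.1 hμ₀) fun μ hμ hne => lt_of_le_of_ne (hmax μ hμ) fun he =>
      hne (sum_genericWeight_injective (hbound μ hμ) (hbound μ₀ hμ₀) he)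
  have h' : c = casimirValue μ₀ := by exact_mod_cast h
  exact (hlt μ₀ hμ₀).ne h'.symm

theorem mem_support_twoColumnDet {r s : ℤ} {μ : Fin m → ℤ}
    (h : μ ∈ (twoColumnDet m r s).support) :
    ∃ q : Fin 8 × (Fin m → Fin 4 × Fin 4), altFst q.1 + fstDegree q.2 = r + 1 ∧
      altSnd q.1 + sndDegree q.2 = s + 2 ∧ pairWeight q.2 = μ := by
  by_contra hno
  push Not at hno
  rw [Finsupp.mem_support_iff] at h
  refine h ?_
  rw [twoColumnDet, Finsupp.finsetSum_apply]
  refine Finset.sum_eq_zero fun q _ => ?_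
  split_ifs with hq
  · rw [Finsupp.single_apply, if_neg (hno q hq.1 hq.2)]
  · rfl

theorem abs_pairWeight_le (σ : Fin m → Fin 4 × Fin 4) (i : Fin m) : |pairWeight σ i| ≤ 2 := by
  rw [pairWeight]
  generalize σ i = a
  revert a
  decide

/-- The weight leaves exactly r sites with a t-degree of ±1, and total degree r forces every sign to
be +. -/
theorem auxDegree_eq_one {κ : Fin m → Fin 4} {r : ℕ} (hr : r ≤ m) (hdeg : ∑ i, auxDegree (κ i) = r)
    (hw : (fun i => auxWeight (κ i)) = headWeight (m - r)) :
    κ = fun i : Fin m => if (i : ℕ) < m - r then 2 else 0 := by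
  have hw' : ∀ i, auxWeight (κ i) = headWeight (m - r) i := congrFun hw
  have habs : ∀ i, |auxDegree (κ i)| = 1 - headWeight (m - r) i := by
    intro i
    have h1 := abs_auxDegree_add (κ i)
    have h2 : |headWeight (m - r) i| = headWeight (m - r) i := by
      rw [headWeight]; split_ifs <;> rfl
    rw [hw', h2] at h1
    omega
  have hsum : ∑ i, (|auxDegree (κ i)| - auxDegree (κ i)) = 0 := by
    simp only [Finset.sum_sub_distrib, habs, hdeg, sum_headWeight (Nat.sub_le m r)]
    simp
    omega
  have hz := (Finset.sum_eq_zero_iff_of_nonneg fun i _ => sub_nonneg.2 (le_abs_self _)).1 hsum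
  ext i : 1
  have h1 := hz i (Finset.mem_univ i)
  rw [habs] at h1
  have h2 := hw' i
  simp only [headWeight] at h1 h2
  refine eq_of_auxDegree ?_ ?_
  · split_ifs at h1 ⊢
    · change _ = (0 : ℤ); omega
    · change _ = (1 : ℤ); omega
  · split_ifs at h2 ⊢
    · exact h2
    · exact h2

theorem sum_auxDegree_head {r : ℕ} (hr : r ≤ m) :
    ∑ i : Fin m, auxDegree (if (i : ℕ) < m - r then 2 else 0) = r := by
  have h : ∀ i : Fin m, auxDegree (if (i : ℕ) < m - r then 2 else 0) =
      1 - headWeight (m - r) i := by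
    intro i
    rw [headWeight]
    split_ifs <;> rfl
  simp only [h, Finset.sum_sub_distrib, sum_headWeight (Nat.sub_le m r)]
  simp
  omega

/-- The equality case of `casimirValue_pairWeight` leaves one contribution: the identity of the Weyl
group together with the choice of x at the head sites and of t or u at the others. -/
theorem twoColumnDet_leading {r s : ℕ} (hrs : r ≤ s) (hs : s ≤ m) :
    twoColumnDet m r s (headWeight (m - r) + headWeight (m - s)) = 1 := by
  have hr := hrs.trans hs
  rw [twoColumnDet, Finsupp.finsetSum_apply]
  set σ₀ : Fin m → Fin 4 × Fin 4 := fun i =>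
    (if (i : ℕ) < m - r then 2 else 0, if (i : ℕ) < m - s then 2 else 0) with hσ₀
  rw [Finset.sum_eq_single (0, σ₀)]
  · have e1 : fstDegree σ₀ = r := sum_auxDegree_head hr
    have e2 : sndDegree σ₀ = s := sum_auxDegree_head hs
    have e3 : pairWeight σ₀ = headWeight (m - r) + headWeight (m - s) := by
      ext i
      simp only [pairWeight, hσ₀, Pi.add_apply, headWeight]
      congr 1 <;> split_ifs <;> rfl
    simp only [e1, e2, e3]
    rw [if_pos ⟨by simp [altFst]; ring, by simp [altSnd]; ring⟩, Finsupp.single_eq_same]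
    simp [altSign]
  · rintro q - hne
    split_ifs with hq
    · rw [Finsupp.single_apply, if_neg]
      intro hw
      refine hne ?_
      obtain ⟨c1, c2⟩ := casimirValue_pairWeight hrs hs hq.1 hq.2
      rw [hw] at c2
      obtain ⟨h0, ha, hb⟩ := c2 (casimirValue_headWeight (Nat.sub_le m r)
        (Nat.sub_le_sub_left hrs m))
      obtain ⟨w, σ⟩ := q
      simp only at h0 ha hb
      subst h0
      have d1 : fstDegree σ = r := by have := hq.1; simp [altFst] at this; omega
      have d2 : sndDegree σ = s := by have := hq.2; simp [altSnd] at this; omega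
      refine Prod.ext rfl (funext fun i => Prod.ext ?_ ?_)
      · exact congrFun (auxDegree_eq_one (κ := fun i => (σ i).1) hr d1 ha) i
      · exact congrFun (auxDegree_eq_one (κ := fun i => (σ i).2) hs d2 hb) i
    · rfl
  · simp

/-- The dual Jacobi–Trudi type formula for the irreducible characters of two-column shape. -/
theorem irrCharSp_eq_twoColumnDet {r s : ℕ} (hrs : r ≤ s) (hs : s ≤ m) (x : Fin m → ℂˣ) :
    irrCharSp m (twoOnePartition m (m - s) (s - r)) (spTorus x) =
      laurentEval x (twoColumnDet m r s) := by
  have hr := hrs.trans hs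
  have hqp : m - s ≤ m - r := Nat.sub_le_sub_left hrs m
  obtain ⟨f, c, h1, h2, h3, h4⟩ := exists_laurent_irrCharSp (Nat.sub_le m r) hqp
  have hsub : m - r - (m - s) = s - r := by omega
  rw [twoOnePartition_eq_headWeight hqp] at h3
  rw [hsub] at h1
  set lam : Fin m → ℤ := headWeight (m - r) + headWeight (m - s) with hlam
  set V : ℤ := (m - r : ℕ) * (2 * m + 2 - (m - r : ℕ)) + (m - s : ℕ) * (2 * m + 4 - (m - s : ℕ))
    with hV
  have hcas : casimirValue lam = V := casimirValue_headWeight (Nat.sub_le m r) hqp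
  have hf : ∀ μ ∈ f.support, μ ≠ lam → casimirValue μ < V ∧
      ∑ i, genericWeight i * μ i < ∑ i, genericWeight i * lam i := by
    intro μ hμ hne
    obtain ⟨a, b, ha, hb, rfl⟩ := h4 μ hμ
    obtain ⟨c1, c2⟩ := ha.casimirValue_le hb (Nat.sub_le m r) (Nat.sub_le m s)
    refine ⟨lt_of_le_of_ne c1 fun h => hne ?_, ?_⟩
    · rw [(c2 h).1, (c2 h).2]
    · have e1 := ha.sum_le (Nat.sub_le m r) genericWeight_pos genericWeight_strictAnti
      have e2 := hb.sum_le (Nat.sub_le m s) genericWeight_pos genericWeight_strictAnti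
      simp only [hlam, Pi.add_apply, mul_add, Finset.sum_add_distrib]
      by_cases ha' : a = headWeight (m - r)
      · have hb' : b ≠ headWeight (m - s) := fun hb' => hne (by rw [ha', hb'])
        exact add_lt_add_of_le_of_lt e1
          (hb.sum_lt (Nat.sub_le m s) genericWeight_pos genericWeight_strictAnti hb')
      · exact add_lt_add_of_lt_of_le
          (ha.sum_lt (Nat.sub_le m r) genericWeight_pos genericWeight_strictAnti ha') e2
  have hfb : ∀ μ ∈ f.support, ∀ i, |μ i| ≤ 2 := by
    intro μ hμ i
    obtain ⟨a, b, ha, hb, rfl⟩ := h4 μ hμ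
    have e1 := ha.1 i
    have e2 := hb.1 i
    rw [abs_le] at *
    simp only [Pi.add_apply]
    omega
  have hc : c = (V : ℂ) := by
    rw [h2.eq_casimirValue genericWeight_pos genericWeight_strictAnti (μ₀ := lam)
      (by rw [h3]; exact one_ne_zero) fun μ hμ hne => (hf μ hμ hne).2, hcas]
  have hD := isRadialEigen_twoColumnDet (m := m) r s
  have hVD : (2 * (m : ℂ) ^ 2 + 6 * m + 5 - ((((r : ℤ) : ℂ) + 1) ^ 2 + (((s : ℤ) : ℂ) + 2) ^ 2)) =
      (V : ℂ) := by
    rw [hV, Nat.cast_sub hr, Nat.cast_sub hs]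
    push_cast
    ring
  rw [hVD] at hD
  -- The two coefficients 1 at the highest weight cancel, so every remaining exponent has Casimir
  -- value below the common eigenvalue V.
  have hdiff : f - twoColumnDet m r s = 0 := by
    have hne : ∀ μ ∈ (f - twoColumnDet m r s).support, μ ≠ lam := by
      rintro μ hμ rfl
      rw [Finsupp.mem_support_iff, Finsupp.sub_apply, h3, twoColumnDet_leading hrs hs] at hμ
      exact hμ (sub_self 1)
    have hor : ∀ μ ∈ (f - twoColumnDet m r s).support,
        μ ∈ f.support ∨ μ ∈ (twoColumnDet m r s).support := by
      intro μ hμ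
      classical
      exact Finset.mem_union.1 (Finsupp.support_sub hμ)
    refine IsRadialEigen.eq_zero (c := V) (fun x hx => ?_) (fun μ hμ => ?_) fun μ hμ => ?_
    · rw [map_sub, map_sub, h2 x hx, hD x hx, hc, mul_sub]
    · rcases hor μ hμ with h | h
      · exact hfb μ h
      · obtain ⟨q, -, -, rfl⟩ := mem_support_twoColumnDet h
        exact abs_pairWeight_le q.2
    · rcases hor μ hμ with h | h
      · exact (hf μ h (hne μ hμ)).1
      · obtain ⟨q, hq1, hq2, rfl⟩ := mem_support_twoColumnDet h
        obtain ⟨c1, c2⟩ := casimirValue_pairWeight hrs hs hq1 hq2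
        refine lt_of_le_of_ne c1 fun he => hne _ hμ ?_
        obtain ⟨-, ha, hb⟩ := c2 he
        rw [hlam, ← ha, ← hb]
        rfl
  rw [h1, sub_eq_zero.1 hdiff]

end CharacterFormula

/-! ### Coefficients of the generating function. -/

section GeneratingFunction

variable {m : ℕ}

/-- The coefficient of `t ^ j` in `∏ i, (x i + (x i)⁻¹ + t + t⁻¹)`. -/
noncomputable def genCoeff (x : Fin m → ℂˣ) (j : ℤ) : ℂ :=
  ∑ κ : Fin m → Fin 4, if ∑ i, auxDegree (κ i) = j then torusChar x fun i => auxWeight (κ i) else 0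

theorem genCoeff_eq_zero (x : Fin m → ℂˣ) {j : ℤ} (hj : (m : ℤ) < |j|) : genCoeff x j = 0 := by
  refine Finset.sum_eq_zero fun κ _ => if_neg ?_
  rintro rfl
  have := (isSmallWeight_auxWeight κ).1
  rw [Int.abs_eq_natAbs] at hj
  omega

theorem genCoeff_neg (x : Fin m → ℂˣ) (j : ℤ) : genCoeff x (-j) = genCoeff x j := by
  have h1 : ∀ c, auxDegree (Equiv.swap 0 1 c) = -auxDegree c := by decide
  have h2 : ∀ c, auxWeight (Equiv.swap 0 1 c) = auxWeight c := by decide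
  rw [genCoeff, genCoeff, ← Equiv.sum_comp (Equiv.arrowCongr (Equiv.refl (Fin m))
    (Equiv.swap (0 : Fin 4) 1))]
  simp [h1, h2, neg_inj]

/-- Without the Sp(4) denominator the kernel is a function of t times a function of u, so each of
the eight Weyl terms gives a product of two coefficients. The eight signed products group into a 2 ×
2 determinant. -/
theorem laurentEval_twoColumnDet (x : Fin m → ℂˣ) (r s : ℤ) :
    laurentEval x (twoColumnDet m r s) =
      (genCoeff x r - genCoeff x (r + 2)) * (genCoeff x s - genCoeff x (s + 4)) -
      (genCoeff x (r - 1) - genCoeff x (r + 3)) * (genCoeff x (s + 1) - genCoeff x (s + 3)) := by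
  have hprod : ∀ j k : ℤ, ∑ σ : Fin m → Fin 4 × Fin 4,
      (if fstDegree σ = j ∧ sndDegree σ = k then torusChar x (pairWeight σ) else 0) =
      genCoeff x j * genCoeff x k := by
    intro j k
    rw [genCoeff, genCoeff, Finset.sum_mul_sum, ← Fintype.sum_prod_type',
      ← Equiv.sum_comp (Equiv.arrowProdEquivProdArrow (Fin m) (fun _ => Fin 4) fun _ => Fin 4)]
    refine Finset.sum_congr rfl fun σ _ => ?_
    have h : pairWeight σ = (fun i => auxWeight (σ i).1) + fun i => auxWeight (σ i).2 := rfl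
    rw [h, torusChar_add, ite_zero_mul_ite_zero]
    rfl
  have hterm : ∀ w : Fin 8, ∑ σ : Fin m → Fin 4 × Fin 4,
      laurentEval x (if altFst w + fstDegree σ = r + 1 ∧ altSnd w + sndDegree σ = s + 2 then
        Finsupp.single (pairWeight σ) (altSign w : ℂ) else 0) =
      altSign w * (genCoeff x (r + 1 - altFst w) * genCoeff x (s + 2 - altSnd w)) := by
    intro w
    rw [← hprod, Finset.mul_sum]
    refine Finset.sum_congr rfl fun σ _ => ?_
    simp only [eq_sub_iff_add_eq', apply_ite (laurentEval x), map_zero, mul_ite, mul_zero]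
    rw [laurentEval, Finsupp.linearCombination_single, smul_eq_mul]
  rw [twoColumnDet, map_sum, Fintype.sum_prod_type, Finset.sum_congr rfl fun w _ => hterm w]
  simp only [Fin.sum_univ_eight, altFst, altSnd, altSign]
  simp
  ring_nf

theorem sum_torusChar_mul (x : Fin m → ℂˣ) (g : ℤ → ℂ) :
    ∑ κ : Fin m → Fin 4, torusChar x (fun i => auxWeight (κ i)) * g (∑ i, auxDegree (κ i)) =
      ∑ n ∈ Finset.range (m + 1 + 1 + (m + 1)),
        genCoeff x ((n : ℤ) - m - 2) * g ((n : ℤ) - m - 2) := by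
  simp only [genCoeff, Finset.sum_mul]
  rw [Finset.sum_comm]
  refine Finset.sum_congr rfl fun κ _ => ?_
  have h := (isSmallWeight_auxWeight κ).1
  rw [Finset.sum_eq_single (∑ i, auxDegree (κ i) + m + 2).toNat]
  · have e : (((∑ i, auxDegree (κ i) + m + 2).toNat : ℕ) : ℤ) - m - 2 = ∑ i, auxDegree (κ i) := by
      omega
    rw [e, if_pos rfl]
  · intro n _ hn
    rw [if_neg (by omega), zero_mul]
  · intro hn
    exact absurd (Finset.mem_range.2 (by omega)) hn

/-- The summation window runs from -m - 2 to m, beyond the support of the coefficients, so as to be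
symmetric under j ↦ -j - 2, with fixed point -1. -/
theorem sum_range_fold (m : ℕ) (f : ℤ → ℂ) :
    ∑ n ∈ Finset.range (m + 1 + 1 + (m + 1)), f ((n : ℤ) - m - 2) =
      ∑ j ∈ Finset.range (m + 1), (f j + f (-j - 2)) + f (-1) := by
  rw [Finset.sum_range_add, Finset.sum_range_succ, ← Finset.sum_range_reflect,
    Finset.sum_add_distrib]
  have e1 : ∀ j ∈ Finset.range (m + 1), f (((m + 1 - 1 - j : ℕ) : ℤ) - m - 2) = f (-j - 2) := by
    intro j hj
    rw [Finset.mem_range] at hj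
    congr 1
    omega
  have e2 : ∀ j ∈ Finset.range (m + 1), f (((m + 1 + 1 + j : ℕ) : ℤ) - m - 2) = f j := by
    intro j _
    congr 1
    push_cast
    ring
  have e3 : (((m + 1 : ℕ) : ℤ) - m - 2) = -1 := by push_cast; ring
  rw [Finset.sum_congr rfl e1, Finset.sum_congr rfl e2, e3]
  ring

theorem sum_coeff_eq {ι κ : Type*} [Fintype ι] [Fintype κ] {a : ι → ℤ} {b : κ → ℤ} {C : ι → ℂ}
    {E : κ → ℂ} (h : ∀ t : ℂ, t ≠ 0 → ∑ q, C q * t ^ a q = ∑ q, E q * t ^ b q) (A : ℤ) :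
    ∑ q, (if a q = A then C q else 0) = ∑ q, if b q = A then E q else 0 := by
  have h1 := sum_coeff_eq_zero (Sum.elim a b) (Sum.elim C (-E)) ∅ (fun t ht _ => by
    simp [Fintype.sum_sum_type, h t ht]) A
  simp only [Fintype.sum_sum_type, Sum.elim_inl, Sum.elim_inr, Pi.neg_apply] at h1
  rw [← sub_eq_zero, sub_eq_add_neg, ← Finset.sum_neg_distrib]
  refine Eq.trans (congrArg₂ (· + ·) rfl (Finset.sum_congr rfl fun q _ => ?_)) h1
  by_cases hq : b q = A
  · rw [if_pos hq]
    exact (if_pos hq).symm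
  · rw [if_neg hq, neg_zero]
    exact (if_neg hq).symm

theorem generating_product (x : Fin m → ℂˣ) {t : ℂ} (ht : t ≠ 0) :
    ∑ κ : Fin m → Fin 4, torusChar x (fun i => auxWeight (κ i)) * t ^ (∑ i, auxDegree (κ i)) =
      ∏ i, ((x i : ℂ) + (x i : ℂ)⁻¹ + (t + t⁻¹)) := by
  rw [← sum_prod_eq (v := fun i c => (x i : ℂ) ^ auxWeight c * t ^ auxDegree c)]
  · simp only [torusChar, zpow_sum_eq_prod ht, Finset.prod_mul_distrib]
  · intro i
    simp [Fin.sum_univ_four, auxWeight, auxDegree]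
    ring

/-- In (-1)^n (t² + t⁻²)^n the exponent 0 occurs only for even n and the exponent -2 only for odd n.
Subtracting cancels the sign of the odd case, so both parities give the central binomial
coefficient. -/
theorem central_coeff (n : ℕ) :
    ∑ k ∈ Finset.range (n + 1), ((-1 : ℂ) ^ n * n.choose k * (if 4 * (k : ℤ) - 2 * n = 0 then 1 else 0) -
      (-1) ^ n * n.choose k * (if 4 * (k : ℤ) - 2 * n = -2 then 1 else 0)) = n.choose (n / 2) := by
  rw [Finset.sum_eq_single (n / 2)]
  · rcases Nat.even_or_odd' n with ⟨k, rfl | rfl⟩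
    · have : 2 * k / 2 = k := by omega
      rw [this, if_pos (by push_cast; ring), if_neg (by push_cast; omega)]
      simp
    · have : (2 * k + 1) / 2 = k := by omega
      rw [this, if_neg (by push_cast; omega), if_pos (by push_cast; ring)]
      simp [pow_succ]
  · intro k _ hk
    rw [if_neg (by omega), if_neg (by omega)]
    simp
  · intro h
    exact absurd (Finset.mem_range.2 (by omega)) h

theorem sum_choose_eq (x : Fin m → ℂˣ) :
    ∑ k ∈ Finset.range (m + 1), ((m - k).choose ((m - k) / 2) : ℂ) *
        ∑ s ∈ Finset.powersetCard k (Finset.univ : Finset (Fin m)),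
          ∏ i ∈ s, ((x i : ℂ) ^ 2 + (((x i)⁻¹ : ℂˣ) : ℂ) ^ 2) =
      ∑ j ∈ Finset.range (m + 1), (-1) ^ j * (genCoeff x j - genCoeff x (j + 2)) ^ 2 := by
  set b : Fin m → ℂ := fun i => (x i : ℂ) ^ 2 + (((x i)⁻¹ : ℂˣ) : ℂ) ^ 2 with hb
  have hgen : ∀ t : ℂ, t ≠ 0 →
      ∑ q : (Fin m → Fin 4) × (Fin m → Fin 4),
        (torusChar x (fun i => auxWeight (q.1 i)) * (torusChar x (fun i => auxWeight (q.2 i)) *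
          (-1) ^ ∑ i, auxDegree (q.2 i))) * t ^ (∑ i, auxDegree (q.1 i) + ∑ i, auxDegree (q.2 i)) =
      ∑ q : (s : Finset (Fin m)) × Fin (m - s.card + 1),
        ((∏ i ∈ q.1, b i) * ((-1) ^ (m - q.1.card) * (m - q.1.card).choose q.2)) *
          t ^ (4 * ((q.2 : ℕ) : ℤ) - 2 * (m - q.1.card : ℕ)) := by
    intro t ht
    -- A difference of two squares at each site: (x + x⁻¹)² - (t + t⁻¹)².
    have hL : ∏ i, (((x i : ℂ) + (x i : ℂ)⁻¹ + (t + t⁻¹)) *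
        ((x i : ℂ) + (x i : ℂ)⁻¹ + (-t + (-t)⁻¹))) = ∏ i, (b i + -(t ^ 2 + (t ^ 2)⁻¹)) := by
      refine Finset.prod_congr rfl fun i _ => ?_
      have hi := (x i).ne_zero
      simp only [hb, Units.val_inv_eq_inv_val]
      field_simp
      ring
    rw [Finset.prod_mul_distrib, ← generating_product x ht,
      ← generating_product x (neg_ne_zero.2 ht), Finset.sum_mul_sum, Finset.prod_add,
      ← Fintype.sum_prod_type'] at hL
    rw [Fintype.sum_sigma]
    refine Eq.trans (Finset.sum_congr rfl fun q _ => ?_) (hL.trans ?_)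
    · rw [neg_eq_neg_one_mul t, mul_zpow, zpow_add₀ ht]
      ring
    · rw [Finset.powerset_univ]
      refine Finset.sum_congr rfl fun s _ => ?_
      rw [Finset.prod_const, Finset.card_sdiff_of_subset (Finset.subset_univ s), Finset.card_univ,
        Fintype.card_fin, neg_pow, add_pow, Finset.mul_sum, Finset.mul_sum, Finset.sum_range]
      refine Finset.sum_congr rfl fun k _ => ?_
      have hk : (k : ℕ) ≤ m - s.card := Nat.lt_succ_iff.1 k.2
      have hpow : t ^ (4 * ((k : ℕ) : ℤ) - 2 * (m - s.card : ℕ)) =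
          (t ^ 2) ^ (k : ℕ) * ((t ^ 2)⁻¹) ^ (m - s.card - k) := by
        rw [← zpow_natCast (t ^ 2), ← zpow_natCast (t ^ 2)⁻¹, _root_.inv_zpow, ← _root_.zpow_neg,
          ← zpow_natCast t 2, ← _root_.zpow_mul, ← _root_.zpow_mul, ← zpow_add₀ ht,
          Nat.cast_sub hk]
        congr 1
        push_cast
        ring
      rw [hpow]
      ring
  have hleft : ∀ A : ℤ, ∑ q : (Fin m → Fin 4) × (Fin m → Fin 4),
      (if ∑ i, auxDegree (q.1 i) + ∑ i, auxDegree (q.2 i) = A then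
        torusChar x (fun i => auxWeight (q.1 i)) * (torusChar x (fun i => auxWeight (q.2 i)) *
          (-1) ^ ∑ i, auxDegree (q.2 i)) else 0) =
      ∑ n ∈ Finset.range (m + 1 + 1 + (m + 1)), genCoeff x ((n : ℤ) - m - 2) *
        ((-1) ^ ((n : ℤ) - m - 2) * genCoeff x (A - ((n : ℤ) - m - 2))) := by
    intro A
    rw [← sum_torusChar_mul x fun j => (-1) ^ j * genCoeff x (A - j), Fintype.sum_prod_type_right]
    refine Finset.sum_congr rfl fun κ _ => ?_
    rw [genCoeff, Finset.mul_sum, Finset.mul_sum]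
    refine Finset.sum_congr rfl fun κ' _ => ?_
    simp only [eq_sub_iff_add_eq]
    split_ifs
    · ring
    · ring
  have h0 := sum_coeff_eq hgen 0
  have h2 := sum_coeff_eq hgen (-2)
  rw [hleft] at h0 h2
  have hright : ∑ q : (s : Finset (Fin m)) × Fin (m - s.card + 1),
        (if 4 * ((q.2 : ℕ) : ℤ) - 2 * (m - q.1.card : ℕ) = 0 then
          (∏ i ∈ q.1, b i) * ((-1) ^ (m - q.1.card) * ((m - q.1.card).choose q.2 : ℂ)) else 0) -
      ∑ q : (s : Finset (Fin m)) × Fin (m - s.card + 1),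
        (if 4 * ((q.2 : ℕ) : ℤ) - 2 * (m - q.1.card : ℕ) = -2 then
          (∏ i ∈ q.1, b i) * ((-1) ^ (m - q.1.card) * ((m - q.1.card).choose q.2 : ℂ)) else 0) =
      ∑ s : Finset (Fin m), ((m - s.card).choose ((m - s.card) / 2) : ℂ) * ∏ i ∈ s, b i := by
    rw [← Finset.sum_sub_distrib, Fintype.sum_sigma]
    refine Finset.sum_congr rfl fun s _ => ?_
    rw [← central_coeff, Finset.sum_mul, Finset.sum_range]
    refine Finset.sum_congr rfl fun k _ => ?_
    simp only [mul_ite, ite_mul, mul_one, mul_zero, sub_mul, zero_mul, mul_comm (∏ i ∈ s, b i)]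
  rw [← h0, ← h2, ← Finset.sum_sub_distrib] at hright
  have hsum : ∑ k ∈ Finset.range (m + 1), ((m - k).choose ((m - k) / 2) : ℂ) *
      ∑ s ∈ Finset.powersetCard k (Finset.univ : Finset (Fin m)), ∏ i ∈ s, b i =
      ∑ s : Finset (Fin m), ((m - s.card).choose ((m - s.card) / 2) : ℂ) * ∏ i ∈ s, b i := by
    rw [← Finset.powerset_univ, Finset.sum_powerset, Finset.card_univ, Fintype.card_fin]
    refine Finset.sum_congr rfl fun k _ => ?_
    rw [Finset.mul_sum]
    refine Finset.sum_congr rfl fun s hs => ?_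
    rw [(Finset.mem_powersetCard.1 hs).2]
  rw [hsum, ← hright]
  -- Pairing j with -j - 2 and using g_{-j} = g_j completes the square (g_j - g_{j+2})²; the fixed
  -- point j = -1 contributes g_{-1} - g_1 = 0.
  have hfold := sum_range_fold m fun j => (-1) ^ j * (genCoeff x j *
    (genCoeff x j - genCoeff x (j + 2)))
  have hone : genCoeff x (-1) - genCoeff x (-1 + 2) = 0 := by
    rw [genCoeff_neg]
    norm_num
  simp only [hone, mul_zero, add_zero] at hfold
  refine Eq.trans (Finset.sum_congr rfl fun n _ => ?_) (hfold.trans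
    (Finset.sum_congr rfl fun j _ => ?_))
  · generalize (n : ℤ) - m - 2 = j
    have e1 : (0 : ℤ) - j = -j := by ring
    have e2 : (-2 : ℤ) - j = -(j + 2) := by ring
    rw [e1, e2, genCoeff_neg, genCoeff_neg]
    ring
  · have e1 : (-(j : ℤ) - 2) = -((j : ℤ) + 2) := by ring
    have e2 : (-((j : ℤ) + 2) + 2) = -(j : ℤ) := by ring
    have e3 : (-1 : ℂ) ^ (-((j : ℤ) + 2)) = (-1) ^ j := by
      rw [_root_.zpow_neg, zpow_add₀ (by norm_num), zpow_natCast]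
      rcases neg_one_pow_eq_or ℂ j with h | h <;> rw [h] <;> norm_num
    rw [e1, e2, genCoeff_neg, genCoeff_neg, e3, zpow_natCast]
    ring

end GeneratingFunction

/-! ### Telescoping of the determinants. -/

theorem sum_det_eq (d : ℤ → ℂ) (n : ℕ) (h0 : d (-1) = 0) (hn : d (2 * n + 2) = 0) :
    ∑ l ∈ Finset.range (n + 1), ∑ z ∈ Finset.range (n - l + 1), (-1 : ℂ) ^ z *
      (d (2 * l) * (d (2 * l + 2 * z) + d (2 * l + 2 * z + 2)) -
        (d (2 * l - 1) + d (2 * l + 1)) * d (2 * l + 2 * z + 1)) =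
      ∑ l ∈ Finset.range (n + 1), (d (2 * l) ^ 2 - d (2 * l + 1) ^ 2) := by
  -- The alternating tails satisfy t l + t (l + 1) = d (2l + 1). In the inner sum the first product
  -- telescopes to d (2l)², and summation by parts in l, with d (-1) = 0 and t (n + 1) = 0 at the
  -- ends, turns the second into ∑ d (2l + 1)².
  set t : ℕ → ℂ := fun l => ∑ z ∈ Finset.range (n + 1 - l), (-1) ^ z * d (2 * l + 2 * z + 1) with ht
  have htel : ∀ (N : ℕ) (a : ℤ), ∑ z ∈ Finset.range N, (-1 : ℂ) ^ z *
      (d (a + 2 * z) + d (a + 2 * z + 2)) = d a - (-1) ^ N * d (a + 2 * N) := by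
    intro N a
    induction N with
    | zero => simp
    | succ N ih =>
      rw [Finset.sum_range_succ, ih]
      have e : a + 2 * ((N + 1 : ℕ) : ℤ) = a + 2 * N + 2 := by push_cast; ring
      rw [e]
      ring
  have hrec : ∀ l ∈ Finset.range (n + 1), t l + t (l + 1) = d (2 * l + 1) := by
    intro l hl
    rw [Finset.mem_range] at hl
    have e : n + 1 - l = (n + 1 - (l + 1)) + 1 := by omega
    simp only [ht]
    rw [e, Finset.sum_range_succ', add_assoc, add_comm (_ * _) (∑ _ ∈ _, _), ← add_assoc,
      ← Finset.sum_add_distrib, Finset.sum_eq_zero]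
    · simp
    · intro z _
      push_cast
      have : (2 * (l : ℤ) + 2 * (z + 1) + 1) = 2 * (l + 1) + 2 * z + 1 := by ring
      rw [this]
      ring
  have hlast : t (n + 1) = 0 := by simp [ht]
  have hinner : ∀ l ∈ Finset.range (n + 1), ∑ z ∈ Finset.range (n - l + 1), (-1 : ℂ) ^ z *
      (d (2 * l) * (d (2 * l + 2 * z) + d (2 * l + 2 * z + 2)) -
        (d (2 * l - 1) + d (2 * l + 1)) * d (2 * l + 2 * z + 1)) =
      d (2 * l) ^ 2 - (d (2 * l - 1) + d (2 * l + 1)) * t l := by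
    intro l hl
    rw [Finset.mem_range] at hl
    have e : n - l + 1 = n + 1 - l := by omega
    have h1 := htel (n + 1 - l) (2 * l)
    have e2 : (2 * (l : ℤ) + 2 * (n + 1 - l : ℕ)) = 2 * n + 2 := by omega
    rw [e2, hn, mul_zero, sub_zero] at h1
    rw [e, sq, ← congrArg (d (2 * l) * ·) h1]
    simp only [ht]
    rw [Finset.mul_sum, Finset.mul_sum, ← Finset.sum_sub_distrib]
    exact Finset.sum_congr rfl fun z _ => by ring
  rw [Finset.sum_congr rfl hinner, Finset.sum_sub_distrib, Finset.sum_sub_distrib]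
  congr 1
  have hsq : ∀ l ∈ Finset.range (n + 1), d (2 * l + 1) ^ 2 =
      d (2 * l + 1) * t l + d (2 * l + 1) * t (l + 1) := by
    intro l hl
    rw [← mul_add, hrec l hl, sq]
  rw [Finset.sum_congr rfl hsq, Finset.sum_add_distrib]
  have hshift := Finset.sum_range_succ' (fun l : ℕ => d (2 * l - 1) * t l) (n + 1)
  rw [Finset.sum_range_succ, hlast, mul_zero, add_zero] at hshift
  simp only [add_mul, Finset.sum_add_distrib]
  rw [hshift]
  simp only [Nat.cast_zero, mul_zero, zero_sub, h0, zero_mul, add_zero]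
  rw [add_comm]
  congr 1
  refine Finset.sum_congr rfl fun l _ => ?_
  congr 2
  push_cast
  ring

theorem sum_range_pair (f : ℕ → ℂ) (n : ℕ) :
    ∑ l ∈ Finset.range n, (f (2 * l) - f (2 * l + 1)) =
      ∑ j ∈ Finset.range (2 * n), (-1) ^ j * f j := by
  induction n with
  | zero => simp
  | succ n ih =>
    rw [Finset.sum_range_succ, ih, mul_add, mul_one, Finset.sum_range_succ, Finset.sum_range_succ]
    simp [pow_succ, pow_mul]
    ring

end SymplecticCharacters

theorem theorem1p2 (m : ℕ) (hm : 1 ≤ m) (x : Fin m → ℂˣ) :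
    ∑ k ∈ Finset.range (m + 1), ((m - k).choose ((m - k) / 2) : ℂ) *
        ∑ s ∈ Finset.powersetCard k (Finset.univ : Finset (Fin m)),
          ∏ i ∈ s, ((x i : ℂ) ^ 2 + (((x i)⁻¹ : ℂˣ) : ℂ) ^ 2) =
      ∑ l ∈ Finset.range (m / 2 + 1), ∑ z ∈ Finset.range (m / 2 - l + 1),
        (-1 : ℂ) ^ z *
          irrCharSp m (twoOnePartition m (m - 2 * l - 2 * z) (2 * z)) (spTorus x) := by
  set d : ℤ → ℂ := fun j => genCoeff x j - genCoeff x (j + 2) with hd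
  have hbig : ∀ j : ℤ, (m : ℤ) < j → d j = 0 := by
    intro j hj
    simp only [hd]
    rw [genCoeff_eq_zero x (hj.trans_le (le_abs_self j)),
      genCoeff_eq_zero x ((show (m : ℤ) < j + 2 by omega).trans_le (le_abs_self _)), sub_zero]
  have hneg : d (-1) = 0 := by
    simp only [hd]
    rw [genCoeff_neg]
    norm_num
  have hdet := sum_det_eq d (m / 2) hneg (hbig _ (by omega))
  have hpair := sum_range_pair (fun j => d j ^ 2) (m / 2 + 1)
  rw [sum_choose_eq]
  have hlhs : ∑ j ∈ Finset.range (m + 1), (-1 : ℂ) ^ j *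
      (genCoeff x j - genCoeff x (j + 2)) ^ 2 =
      ∑ j ∈ Finset.range (2 * (m / 2 + 1)), (-1) ^ j * d j ^ 2 := by
    -- For even m the larger range adds only j = m + 1, where d vanishes; for odd m the ranges
    -- agree.
    refine Finset.sum_subset (fun j hj => ?_) fun j _ hj => ?_
    · rw [Finset.mem_range] at *
      omega
    · rw [Finset.mem_range] at hj
      have := hbig j (by omega)
      simp only [hd] at this
      rw [this]
      ring
  rw [hlhs, ← hpair]
  push_cast
  rw [← hdet]
  refine Finset.sum_congr rfl fun l hl => Finset.sum_congr rfl fun z hz => ?_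
  rw [Finset.mem_range] at hl hz
  have hchar := irrCharSp_eq_twoColumnDet (m := m) (r := 2 * l) (s := 2 * l + 2 * z) (by omega)
    (by omega) x
  have e1 : m - (2 * l + 2 * z) = m - 2 * l - 2 * z := by omega
  have e2 : 2 * l + 2 * z - 2 * l = 2 * z := by omega
  rw [e1, e2] at hchar
  rw [hchar, laurentEval_twoColumnDet]
  simp only [hd]
  push_cast
  ring_nf
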